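/- Corollary 1.8. Graphs are finite and may have parallel edges but no loops. For positive integers $p \ge q$, a $(p,q)$-coloring of a graph $H$ is a map $f : V(H) \to \{0,1,\dots,p-1\}$ such that $q \le |f(x)-f(y)| \le p-q$ for every edge $xy$ of $H$. The circular chromatic number is $\chi_c(H) = \inf\{p/q : H \text{ has a } (p,q)\text{-coloring}\}$, and the circular chromatic index of a graph $G$ is $\chi'_c(G) = \chi_c(L(G))$, where the line graph $L(G)$ has the edges of $G$ as its vertices, two distinct edges being adjacent if they have an end vertex in common. A graph is cubic if every vertex has degree $3$, and $2$-edge-connected if it is connected and remains connected after the deletion of any one edge. Every $2$-edge-connected cubic graph $G$ satisfies $\chi'_c(G) \le 11/3$. -/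

import Mathlib

open scoped ENNReal

namespace SimpleGraph

/-- A `(p, q)`-coloring of `G`: a map `f` from the vertices to `{0, 1, …, p - 1}` such that
`q ≤ |f x - f y| ≤ p - q` (computed in `ℤ`) for every edge `xy`. -/
def IsCircularColoring {V : Type*} (G : SimpleGraph V) (p q : ℕ) (f : V → Fin p) : Prop :=
  ∀ x y : V, G.Adj x y →
    (q : ℤ) ≤ |((f x : ℕ) : ℤ) - ((f y : ℕ) : ℤ)| ∧
      |((f x : ℕ) : ℤ) - ((f y : ℕ) : ℤ)| ≤ (p : ℤ) - (q : ℤ)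

/-- The circular chromatic number: the infimum of `p / q` over all positive integers `p ≥ q` such
that `G` has a `(p, q)`-coloring.  It takes values in `[0, ∞]`, so that the infimum is `∞` (and not
a junk value) if there is no such coloring at all; this does not happen for finite graphs. -/
noncomputable def circularChromaticNumber {V : Type*} (G : SimpleGraph V) : ℝ≥0∞ :=
  sInf {r : ℝ≥0∞ | ∃ p q : ℕ, 0 < q ∧ q ≤ p ∧
    (∃ f : V → Fin p, G.IsCircularColoring p q f) ∧ r = (p : ℝ≥0∞) / (q : ℝ≥0∞)}

end SimpleGraph

namespace Graph

/-- The line graph of a multigraph `G`: its vertices are the edges of `G`, and two distinct edges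
are adjacent if they have an end vertex in common (parallel edges are adjacent). -/
def lineGraph {α β : Type*} (G : Graph α β) : SimpleGraph G.edgeSet where
  Adj e f := e ≠ f ∧ ∃ x : α, G.Inc (e : β) x ∧ G.Inc (f : β) x
  symm := ⟨fun _ _ h => ⟨h.1.symm, h.2.imp fun _ hx => ⟨hx.2, hx.1⟩⟩⟩
  loopless := ⟨fun _ h => h.1 rfl⟩

/-- The circular chromatic index of a multigraph. -/
noncomputable def circularChromaticIndex {α β : Type*} (G : Graph α β) : ℝ≥0∞ :=
  G.lineGraph.circularChromaticNumber

/-- The degree of a vertex: the number of edge ends at it (a loop would count twice). -/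
noncomputable def vertexDegree {α β : Type*} (G : Graph α β) (x : α) : ℕ∞ :=
  (G.incidenceSet x).encard + (G.loopSet x).encard

/-- A cubic multigraph: every vertex has degree `3`. -/
def IsCubic {α β : Type*} (G : Graph α β) : Prop :=
  ∀ x ∈ G.vertexSet, G.vertexDegree x = 3

/-- A multigraph is connected if it has a vertex and any two of its vertices are joined by a
walk. -/
def IsConnected {α β : Type*} (G : Graph α β) : Prop :=
  G.vertexSet.Nonempty ∧
    ∀ x ∈ G.vertexSet, ∀ y ∈ G.vertexSet, Relation.ReflTransGen G.Adj x y

/-- A multigraph is `2`-edge-connected if it is connected and stays connected after the deletion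
of any one edge, that is, if it is connected and has no bridge. -/
def IsTwoEdgeConnected {α β : Type*} (G : Graph α β) : Prop :=
  G.IsConnected ∧ ∀ e ∈ G.edgeSet, (G.deleteEdges {e}).IsConnected

end Graph

namespace CubicEdgeColoring

universe u v
variable {V : Type u} {E : Type v}

/-! Take a proper partial edge colouring with colours 1, 2, 3 that leaves as few edges uncoloured as
possible. A Kempe exchange shows that the uncoloured edges form a matching
(`IsBest.blank_matching`). The two ends of an uncoloured edge see exactly one common colour, its
type. Together with edges of the other two colours it closes an odd cycle (`cyc`), and by shifting
colours the uncoloured place can be moved to any edge of this cycle (`IsMove.step`). By minimality,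
cycles of different uncoloured edges are vertex-disjoint (`IsBest.cycVerts_disjoint`), so all
uncoloured places move independently (`Frame.realize`).

On a circle of length 11, put the colours 1, 2, 3 at 0, 4, 7, with gaps 4, 3, 4. The uncoloured edge
of a cycle is absorbed by a window, a path `o s t r` on the cycle whose middle edge is the
uncoloured one. Its three edges get special values. The legs (edges of the type colour leaving the
cycle) at `o` and `s` are strong: they must move by one unit, from 4 to 3 for type 2, from 7 to 8
for type 3, and by either +1 or -1, the sign of the window, for type 1. The legs at `t` and `r` are
weak: they may keep their value or, for type 1, move the opposite way.

Conflicts arise only when a leg belongs to two windows, or when two strong legs meet at a vertex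
away from the cycles. If the number of uncoloured edges of type 1 is maximal, cycles of equal type 2
or 3 are never joined by a leg (`Frame.not_linked`). On type 1 cycles the windows are chosen one
after the other. Double Kempe exchanges at the ends of a cycle edge (`Frame.not_link_link`,
`Frame.not_link_link_adj`, `Frame.not_link_cross`, `Frame.not_cross_cross`) limit what earlier
choices can demand of consecutive vertices, and the oddness of the cycle then leaves room for a
window (`exists_good_path`).

All this needs a graph without cycles of length at most four. These are removed by induction on the
number of vertices: delete some vertices of the short cycle and join the leaving edges in pairs. A
new bridge would have to separate two pairs (`Splice.exists_separated`), which is impossible for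
digons and triangles and, for squares, fails for at least one of the two pairings
(`Square.noBridge_or`). A colouring extends back because each colour forbids five of the eleven
values, so two colours never forbid all of them (`exists_far_common`). -/

/-- The incidence relation of a loopless cubic multigraph: every edge has two ends and every vertex
lies on three edges. -/
structure IsCubic (inc : E → V → Prop) : Prop where
  ends : ∀ e, ∃ u v, u ≠ v ∧ ∀ w, inc e w ↔ w = u ∨ w = v
  star : ∀ v, ∃ e f g, e ≠ f ∧ e ≠ g ∧ f ≠ g ∧ ∀ h, inc h v ↔ h = e ∨ h = f ∨ h = g

/-- The edge `e` joins the distinct vertices `u` and `v`. -/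
def Joins (inc : E → V → Prop) (e : E) (u v : V) : Prop := u ≠ v ∧ inc e u ∧ inc e v

theorem Joins.symm {inc : E → V → Prop} {e : E} {u v : V} (h : Joins inc e u v) :
    Joins inc e v u := ⟨h.1.symm, h.2.2, h.2.1⟩

theorem IsCubic.exists_joins {inc : E → V → Prop} (hc : IsCubic inc) {e : E} {u : V}
    (h : inc e u) : ∃ v, Joins inc e u v := by
  obtain ⟨a, b, hab, hw⟩ := hc.ends e
  rcases (hw u).1 h with rfl | rfl
  · exact ⟨b, hab, h, (hw b).2 (Or.inr rfl)⟩
  · exact ⟨a, hab.symm, h, (hw a).2 (Or.inl rfl)⟩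

theorem IsCubic.eq_or_eq {inc : E → V → Prop} (hc : IsCubic inc) {e : E} {u v w : V}
    (h : Joins inc e u v) (hw : inc e w) : w = u ∨ w = v := by
  obtain ⟨a, b, hab, hx⟩ := hc.ends e
  have h1 := (hx u).1 h.2.1
  have h2 := (hx v).1 h.2.2
  have h3 := (hx w).1 hw
  have := h.1
  grind

theorem IsCubic.joins_right_unique {inc : E → V → Prop} (hc : IsCubic inc) {e : E} {u v w : V}
    (h : Joins inc e u v) (h' : Joins inc e u w) : w = v := by
  rcases hc.eq_or_eq h h'.2.2 with h1 | h1
  · exact absurd h1.symm h'.1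
  · exact h1

theorem IsCubic.exists_others {inc : E → V → Prop} (hc : IsCubic inc) {e : E} {v : V}
    (h : inc e v) : ∃ f g, f ≠ e ∧ g ≠ e ∧ f ≠ g ∧ inc f v ∧ inc g v ∧
      ∀ h, inc h v → h = e ∨ h = f ∨ h = g := by
  obtain ⟨a, b, d, hab, had, hbd, hx⟩ := hc.star v
  have ha := (hx a).2 (by simp)
  have hb := (hx b).2 (by simp)
  have hd := (hx d).2 (by simp)
  rcases (hx e).1 h with rfl | rfl | rfl
  · exact ⟨b, d, hab.symm, had.symm, hbd, hb, hd, fun h hh => (hx h).1 hh⟩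
  · exact ⟨a, d, hab, hbd.symm, had, ha, hd, fun h hh => by have := (hx h).1 hh; tauto⟩
  · exact ⟨a, b, had, hbd, hab, ha, hb, fun h hh => by have := (hx h).1 hh; tauto⟩

theorem IsCubic.exists_third {inc : E → V → Prop} (hc : IsCubic inc) {e f : E} {v : V}
    (he : inc e v) (hf : inc f v) (hef : e ≠ f) : ∃ g, g ≠ e ∧ g ≠ f ∧ inc g v ∧
      ∀ h, inc h v → h = e ∨ h = f ∨ h = g := by
  obtain ⟨a, b, ha, hb, hab, hav, hbv, hx⟩ := hc.exists_others he
  rcases hx f hf with rfl | rfl | rfl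
  · exact absurd rfl hef
  · exact ⟨b, hb, hab.symm, hbv, hx⟩
  · exact ⟨a, ha, hab, hav, fun h hh => by have := hx h hh; tauto⟩

/-! ### Partial edge colourings with three colours -/

/-- A proper partial edge colouring with the colours `1, 2, 3`; the colour `0` marks the uncoloured
edges. -/
def Proper (inc : E → V → Prop) (c : E → Fin 4) : Prop :=
  ∀ v e f, inc e v → inc f v → c e = c f → c e ≠ 0 → e = f

/-- No edge at `v` has the colour `k`. -/
def Misses (inc : E → V → Prop) (c : E → Fin 4) (v : V) (k : Fin 4) : Prop :=
  ∀ e, inc e v → c e ≠ k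

/-- The set of uncoloured edges. -/
def blank (c : E → Fin 4) : Set E := {e | c e = 0}

/-- A proper partial colouring with as few uncoloured edges as possible. -/
def IsBest (inc : E → V → Prop) (c : E → Fin 4) : Prop :=
  Proper inc c ∧ ∀ c', Proper inc c' → (blank c).ncard ≤ (blank c').ncard

theorem IsBest.of_ncard_le {inc : E → V → Prop} {c c' : E → Fin 4} (h : IsBest inc c)
    (hp : Proper inc c') (hle : (blank c').ncard ≤ (blank c).ncard) : IsBest inc c' :=
  ⟨hp, fun c'' h'' => hle.trans (h.2 c'' h'')⟩

-- The alternative `k = 0` in the hypothesis makes the statement cover uncolouring an edge as well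
-- as recolouring it.
open Classical in
theorem Proper.update {inc : E → V → Prop} {c : E → Fin 4} (h : Proper inc c) {d : E} {k : Fin 4}
    (hm : ∀ v, inc d v → ∀ e, inc e v → e ≠ d → c e = k → k = 0) :
    Proper inc (Function.update c d k) := by
  intro v e f he hf hef hne
  by_cases h1 : e = d <;> by_cases h2 : f = d
  · rw [h1, h2]
  · subst h1
    rw [Function.update_self, Function.update_of_ne h2] at hef
    rw [Function.update_self] at hne
    exact absurd (hm v he f hf h2 hef.symm) hne
  · subst h2
    rw [Function.update_self, Function.update_of_ne h1] at hef
    rw [Function.update_of_ne h1] at hne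
    exact absurd (hm v hf e he h1 hef) (hef ▸ hne)
  · rw [Function.update_of_ne h1, Function.update_of_ne h2] at hef
    rw [Function.update_of_ne h1] at hne
    exact h v e f he hf hef hne

/-- Otherwise `d` could receive the colour `k`. Nearly every contradiction drawn from minimality
goes through this lemma. -/
theorem IsBest.not_misses_both {inc : E → V → Prop} [Finite E] (hc : IsCubic inc)
    {c : E → Fin 4} (h : IsBest inc c)
    {d : E} {x y : V} (hd : Joins inc d x y) (h0 : c d = 0) {k : Fin 4} (hk : k ≠ 0)
    (hx : Misses inc c x k) (hy : Misses inc c y k) : False := by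
  classical
  have hp : Proper inc (Function.update c d k) := by
    apply h.1.update
    intro v hv e he _ hek
    rcases hc.eq_or_eq hd hv with rfl | rfl
    · exact absurd hek (hx e he)
    · exact absurd hek (hy e he)
  have := h.2 _ hp
  have hlt : (blank (Function.update c d k)).ncard < (blank c).ncard := by
    apply Set.ncard_lt_ncard _ (Set.toFinite _)
    refine ⟨fun e he => ?_, fun hs => ?_⟩
    · simp only [blank, Set.mem_ofPred_eq] at he ⊢
      by_cases hed : e = d
      · rw [hed, h0]
      · rwa [Function.update_of_ne hed] at he
    · have := hs (show d ∈ blank c from h0)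
      simp [blank] at this
      exact hk this
  omega

open Classical in
/-- The colouring obtained by exchanging the colours `a` and `b` on all edges that meet `X`. -/
noncomputable def swapOn (inc : E → V → Prop) (c : E → Fin 4) (X : Set V) (a b : Fin 4) :
    E → Fin 4 :=
  fun e => if ∃ v ∈ X, inc e v then Equiv.swap a b (c e) else c e

/-- `X` is a union of components of the graph formed by the edges of the colours `a` and `b`. -/
def KempeClosed (inc : E → V → Prop) (c : E → Fin 4) (X : Set V) (a b : Fin 4) : Prop :=
  ∀ e v w, (c e = a ∨ c e = b) → inc e v → inc e w → v ∈ X → w ∈ X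

theorem swapOn_of_mem {inc : E → V → Prop} {c : E → Fin 4} {X : Set V} {a b : Fin 4} {e : E}
    {v : V} (hv : v ∈ X) (he : inc e v) : swapOn inc c X a b e = Equiv.swap a b (c e) := by
  rw [swapOn, if_pos ⟨v, hv, he⟩]

theorem swapOn_of_notMem {inc : E → V → Prop} {c : E → Fin 4} {X : Set V} {a b : Fin 4}
    (hX : KempeClosed inc c X a b) {e : E} {v : V} (hv : v ∉ X) (he : inc e v) :
    swapOn inc c X a b e = c e := by
  rw [swapOn]
  split_ifs with h
  · obtain ⟨w, hw, hew⟩ := h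
    apply Equiv.swap_apply_of_ne_of_ne
    · exact fun hh => hv (hX e w v (Or.inl hh) hew he hw)
    · exact fun hh => hv (hX e w v (Or.inr hh) hew he hw)
  · rfl

theorem swapOn_eq_zero {inc : E → V → Prop} {c : E → Fin 4} {X : Set V} {a b : Fin 4}
    (ha : a ≠ 0) (hb : b ≠ 0) (e : E) : swapOn inc c X a b e = 0 ↔ c e = 0 := by
  rw [swapOn]
  split_ifs
  · rw [Equiv.swap_apply_eq_iff, Equiv.swap_apply_of_ne_of_ne ha.symm hb.symm]
  · rfl

theorem Proper.proper_swapOn {inc : E → V → Prop} {c : E → Fin 4} (h : Proper inc c) {X : Set V}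
    {a b : Fin 4} (ha : a ≠ 0) (hb : b ≠ 0) (hX : KempeClosed inc c X a b) :
    Proper inc (swapOn inc c X a b) := by
  intro v e f he hf hef hne
  have hne' : c e ≠ 0 := fun hh => hne ((swapOn_eq_zero ha hb e).2 hh)
  refine h v e f he hf ?_ hne'
  by_cases hv : v ∈ X
  · rw [swapOn_of_mem hv he, swapOn_of_mem hv hf] at hef
    exact (Equiv.swap a b).injective hef
  · rwa [swapOn_of_notMem hX hv he, swapOn_of_notMem hX hv hf] at hef

theorem IsBest.isBest_swapOn {inc : E → V → Prop} {c : E → Fin 4} (h : IsBest inc c) {X : Set V}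
    {a b : Fin 4} (ha : a ≠ 0) (hb : b ≠ 0) (hX : KempeClosed inc c X a b) :
    IsBest inc (swapOn inc c X a b) := by
  refine h.of_ncard_le (h.1.proper_swapOn ha hb hX) (le_of_eq ?_)
  congr 1
  ext e
  exact swapOn_eq_zero ha hb e

theorem misses_swapOn_of_mem {inc : E → V → Prop} {c : E → Fin 4} {X : Set V} {a b : Fin 4}
    {v : V} (hv : v ∈ X) (hm : Misses inc c v b) : Misses inc (swapOn inc c X a b) v a := by
  intro e he
  rw [swapOn_of_mem hv he, Ne, Equiv.swap_apply_eq_iff, Equiv.swap_apply_left]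
  exact hm e he

theorem misses_swapOn_of_notMem {inc : E → V → Prop} {c : E → Fin 4} {X : Set V} {a b k : Fin 4}
    (hX : KempeClosed inc c X a b) {v : V} (hv : v ∉ X) (hm : Misses inc c v k) :
    Misses inc (swapOn inc c X a b) v k := by
  intro e he
  rw [swapOn_of_notMem hX hv he]
  exact hm e he

/-! ### Uncoloured edges form a matching -/

theorem dihedral_conj {A B : Equiv.Perm V} (hA : A * A = 1) (hB : B * B = 1) (k : ℤ) :
    A * (A * B) ^ k = (A * B) ^ (-k) * A := by
  have hA' : A⁻¹ = A := inv_eq_of_mul_eq_one_left hA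
  have hB' : B⁻¹ = B := inv_eq_of_mul_eq_one_left hB
  have h1 : A * (A * B) * A⁻¹ = (A * B)⁻¹ := by
    rw [mul_inv_rev, hA', hB', ← mul_assoc, hA, one_mul]
  have h2 : (A * (A * B) * A⁻¹) ^ k = A * (A * B) ^ k * A⁻¹ := conj_zpow
  rw [h1, inv_zpow'] at h2
  rw [h2]
  simp

/-- With `A` and `B` the two involutions "go to the other end of the edge of colour a, respectively
b", the orbit of a fixed point of `A` under the cyclic group of `A * B` is already closed under
both. It is thus a whole Kempe chain, described without walks. -/
theorem dihedral_orbit_left {A B : Equiv.Perm V} (hA : A * A = 1) (hB : B * B = 1) {w : V}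
    (hw : A w = w) (k : ℤ) : A (((A * B) ^ k) w) = ((A * B) ^ (-k)) w := by
  have := congrArg (fun f : Equiv.Perm V => f w) (dihedral_conj hA hB k)
  simpa [hw] using this

theorem dihedral_orbit_right {A B : Equiv.Perm V} (hA : A * A = 1) (hB : B * B = 1) {w : V}
    (hw : A w = w) (k : ℤ) : B (((A * B) ^ k) w) = ((A * B) ^ (-(k + 1))) w := by
  rw [← dihedral_orbit_left hA hB hw (k + 1), add_comm, zpow_add, zpow_one]
  have : ∀ z, A (A z) = z := fun z => by
    have := congrArg (fun f : Equiv.Perm V => f z) hA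
    simpa using this
  simp [this]

/-- A chain with an end is a path and has only two ends. In the orbit of `w`, a fixed point of `B`
forces the odd period `2 * i + 1` and a further fixed point of `A` the even period `2 * j`; these
combine to `p ^ j` fixing `w`. -/
theorem dihedral_three_fixed {A B : Equiv.Perm V} (hA : A * A = 1) (hB : B * B = 1) {w w' v : V}
    (hw : A w = w) (hw' : A w' = w') (hv : B v = v) {i j : ℤ} (hi : ((A * B) ^ i) w = v)
    (hj : ((A * B) ^ j) w = w') : w' = w := by
  set p := A * B with hp
  have h1 : (p ^ (2 * i + 1)) w = w := by
    have := dihedral_orbit_right hA hB hw i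
    rw [← hp, hi, hv, ← hi] at this
    have h2 := congrArg (p ^ (i + 1)) this
    rw [← Equiv.Perm.mul_apply, ← Equiv.Perm.mul_apply, ← zpow_add, ← zpow_add] at h2
    rw [show i + 1 + -(i + 1) = 0 by ring, show i + 1 + i = 2 * i + 1 by ring] at h2
    simpa using h2
  have h2 : (p ^ (2 * j)) w = w := by
    have := dihedral_orbit_left hA hB hw j
    rw [← hp, hj, hw', ← hj] at this
    have h2 := congrArg (p ^ j) this
    rw [← Equiv.Perm.mul_apply, ← Equiv.Perm.mul_apply, ← zpow_add, ← zpow_add] at h2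
    rw [show j + -j = 0 by ring, show j + j = 2 * j by ring] at h2
    simpa using h2
  have h3 : (p ^ ((2 * i + 1) * j)) w = w := by
    rw [zpow_mul]
    exact Equiv.Perm.zpow_apply_eq_self_of_apply_eq_self h1 j
  have h4 : (p ^ (2 * j * (-i))) w = w := by
    rw [zpow_mul]
    exact Equiv.Perm.zpow_apply_eq_self_of_apply_eq_self h2 (-i)
  rw [← hj]
  calc (p ^ j) w = (p ^ (2 * j * (-i) + (2 * i + 1) * j)) w := by congr 2; ring
    _ = w := by rw [zpow_add, Equiv.Perm.mul_apply, h3, h4]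

open Classical in
/-- The other end of the edge of colour `k` at `v`, or `v` itself if there is no such edge. -/
noncomputable def partner (inc : E → V → Prop) (c : E → Fin 4) (k : Fin 4) (v : V) : V :=
  if h : ∃ w e, Joins inc e v w ∧ c e = k then h.choose else v

theorem partner_eq {inc : E → V → Prop} (hc : IsCubic inc) {c : E → Fin 4} (hp : Proper inc c)
    {k : Fin 4} (hk : k ≠ 0) {e : E} {v w : V} (he : Joins inc e v w) (hek : c e = k) :
    partner inc c k v = w := by
  have hex : ∃ w e, Joins inc e v w ∧ c e = k := ⟨w, e, he, hek⟩
  rw [partner, dif_pos hex]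
  obtain ⟨f, hf, hfk⟩ := hex.choose_spec
  have : e = f := hp v e f he.2.1 hf.2.1 (hek.trans hfk.symm) (hek ▸ hk)
  subst this
  exact hc.joins_right_unique he hf

theorem partner_of_misses {inc : E → V → Prop} {c : E → Fin 4} {k : Fin 4} {v : V}
    (h : Misses inc c v k) : partner inc c k v = v := by
  rw [partner, dif_neg]
  rintro ⟨w, e, he, hek⟩
  exact h e he.2.1 hek

theorem partner_involutive {inc : E → V → Prop} (hc : IsCubic inc) {c : E → Fin 4}
    (hp : Proper inc c) {k : Fin 4} (hk : k ≠ 0) :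
    Function.Involutive (partner inc c k) := by
  intro v
  by_cases h : ∃ w e, Joins inc e v w ∧ c e = k
  · obtain ⟨w, e, he, hek⟩ := h
    rw [partner_eq hc hp hk he hek, partner_eq hc hp hk he.symm hek]
  · rw [show partner inc c k v = v by rw [partner, dif_neg h],
      show partner inc c k v = v by rw [partner, dif_neg h]]

/-- Three vertices, two of which miss `a` and the third of which misses `b`, do not lie on a
common `a`-`b`-path. -/
theorem exists_kempeClosed {inc : E → V → Prop} (hc : IsCubic inc) {c : E → Fin 4}
    (hp : Proper inc c) {a b : Fin 4} (ha : a ≠ 0) (hb : b ≠ 0) {w w' v : V} (hww : w' ≠ w)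
    (hw : Misses inc c w a) (hw' : Misses inc c w' a) (hv : Misses inc c v b) :
    ∃ X, KempeClosed inc c X a b ∧ v ∉ X ∧ (w ∈ X ∨ w' ∈ X) := by
  set A : Equiv.Perm V := (partner_involutive hc hp ha).toPerm with hAdef
  set B : Equiv.Perm V := (partner_involutive hc hp hb).toPerm with hBdef
  have hA : A * A = 1 := by ext z; simp [A, partner_involutive hc hp ha z]
  have hB : B * B = 1 := by ext z; simp [B, partner_involutive hc hp hb z]
  have hclosed : ∀ z, A z = z →
      KempeClosed inc c {q | ∃ k : ℤ, ((A * B) ^ k) z = q} a b := by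
    rintro z hz e x y hcol hex hey ⟨k, rfl⟩
    by_cases hxy : ((A * B) ^ k) z = y
    · exact ⟨k, hxy⟩
    have hj : Joins inc e (((A * B) ^ k) z) y := ⟨hxy, hex, hey⟩
    rcases hcol with h | h
    · refine ⟨-k, ?_⟩
      rw [← dihedral_orbit_left hA hB hz k]
      exact partner_eq hc hp ha hj h
    · refine ⟨-(k + 1), ?_⟩
      rw [← dihedral_orbit_right hA hB hz k]
      exact partner_eq hc hp hb hj h
  have hAw : A w = w := partner_of_misses hw
  have hAw' : A w' = w' := partner_of_misses hw'
  have hBv : B v = v := partner_of_misses hv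
  -- If the chain of `w` ends at `v`, the chain of `w'` cannot also do so, or it would have three
  -- ends.
  by_cases h1 : ∃ k : ℤ, ((A * B) ^ k) w = v
  · refine ⟨_, hclosed w' hAw', ?_, Or.inr ⟨0, rfl⟩⟩
    rintro ⟨j, hj⟩
    obtain ⟨i, hi⟩ := h1
    refine hww (dihedral_three_fixed hA hB hAw hAw' hBv hi (j := -j + i) ?_)
    rw [zpow_add, Equiv.Perm.mul_apply, hi, ← hj, ← Equiv.Perm.mul_apply, ← zpow_add]
    simp
  · exact ⟨_, hclosed w hAw, h1, Or.inl ⟨0, rfl⟩⟩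

theorem exists_color_ne (a : Fin 4) : ∃ b : Fin 4, b ≠ 0 ∧ b ≠ a := by
  revert a; decide

/-- Suppose `e` and `f` are both uncoloured at `v`, and let `a` be the colour of the third edge
there. Minimality makes the far ends of `e` and `f` see the two other colours, hence miss `a`, while
`v` misses any other colour `b`. The `a`-`b` chain of one far end avoids `v`; exchanging on it lets
that edge be coloured `b`. -/
theorem IsBest.blank_matching {inc : E → V → Prop} [Finite E] (hc : IsCubic inc)
    {c : E → Fin 4} (h : IsBest inc c) {e f : E} {v : V} (he : inc e v) (hf : inc f v)
    (he0 : c e = 0) (hf0 : c f = 0) : e = f := by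
  by_contra hef
  obtain ⟨g, hge, hgf, hg, hall⟩ := hc.exists_third he hf hef
  have hmiss : ∀ k, k ≠ 0 → k ≠ c g → Misses inc c v k := by
    intro k hk hkg d hd
    rcases hall d hd with rfl | rfl | rfl
    · exact he0 ▸ hk.symm
    · exact hf0 ▸ hk.symm
    · exact hkg.symm
  have key : ∀ d w, Joins inc d v w → c d = 0 → c g ≠ 0 ∧ Misses inc c w (c g) := by
    intro d w hd hd0
    obtain ⟨p, q, hp, hq, hpq, hpw, hqw, hw⟩ := hc.exists_others hd.2.2
    have hsee : ∀ k, k ≠ 0 → k ≠ c g → c p = k ∨ c q = k := by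
      intro k hk hkg
      by_contra hcon
      push Not at hcon
      refine h.not_misses_both hc hd hd0 hk (hmiss k hk hkg) ?_
      intro x hx
      rcases hw x hx with rfl | rfl | rfl
      · exact hd0 ▸ hk.symm
      · exact hcon.1
      · exact hcon.2
    have hfin : ∀ P Q a : Fin 4, (∀ k, k ≠ 0 → k ≠ a → P = k ∨ Q = k) →
        a ≠ 0 ∧ P ≠ a ∧ Q ≠ a := by decide
    obtain ⟨h1, h2, h3⟩ := hfin _ _ _ hsee
    refine ⟨h1, fun x hx => ?_⟩
    rcases hw x hx with rfl | rfl | rfl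
    · exact hd0 ▸ h1.symm
    · exact h2
    · exact h3
  obtain ⟨w, hw⟩ := hc.exists_joins he
  obtain ⟨w', hw'⟩ := hc.exists_joins hf
  obtain ⟨hg0, hma⟩ := key e w hw he0
  obtain ⟨-, hma'⟩ := key f w' hw' hf0
  -- If `e` and `f` were parallel, each common end would have only one coloured edge, and some
  -- colour would be missed at both.
  have hww : w' ≠ w := by
    rintro rfl
    obtain ⟨p, hpe, hpf, hpw, hpall⟩ := hc.exists_third hw.2.2 hw'.2.2 hef
    have hfin : ∀ P a : Fin 4, ∃ k, k ≠ 0 ∧ k ≠ a ∧ k ≠ P := by decide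
    obtain ⟨k, hk0, hkg, hkp⟩ := hfin (c p) (c g)
    refine h.not_misses_both hc hw he0 hk0 (hmiss k hk0 hkg) ?_
    intro x hx
    rcases hpall x hx with rfl | rfl | rfl
    · exact he0 ▸ hk0.symm
    · exact hf0 ▸ hk0.symm
    · exact hkp.symm
  obtain ⟨b, hb0, hbg⟩ := exists_color_ne (c g)
  have hvb := hmiss b hb0 hbg
  obtain ⟨X, hX, hvX, hwX⟩ := exists_kempeClosed hc h.1 hg0 hb0 hww hma hma' hvb
  have hX' : KempeClosed inc c X b (c g) := fun e v w hcol => hX e v w hcol.symm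
  have hbest := h.isBest_swapOn hb0 hg0 hX'
  rcases hwX with hwX | hwX
  · exact hbest.not_misses_both hc hw ((swapOn_eq_zero hb0 hg0 _).2 he0) hb0
      (misses_swapOn_of_notMem hX' hvX hvb) (misses_swapOn_of_mem hwX hma)
  · exact hbest.not_misses_both hc hw' ((swapOn_eq_zero hb0 hg0 _).2 hf0) hb0
      (misses_swapOn_of_notMem hX' hvX hvb) (misses_swapOn_of_mem hwX hma')

/-! ### Moving an uncoloured edge around its cycle -/

/-- No two edges are parallel. -/
def NoDigon (inc : E → V → Prop) : Prop :=
  ∀ e f u v, Joins inc e u v → Joins inc f u v → e = f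

/-- The colour `k` occurs at both ends of `d`. -/
def IsType (inc : E → V → Prop) (c : E → Fin 4) (d : E) (k : Fin 4) : Prop :=
  k ≠ 0 ∧ ∀ v, inc d v → ∃ e, inc e v ∧ c e = k

/-- The edges that can be reached from `d` through edges not coloured `k`. -/
def cyc (inc : E → V → Prop) (c : E → Fin 4) (k : Fin 4) (d : E) : Set E :=
  {f | Relation.ReflTransGen (fun e f => c f ≠ k ∧ ∃ v, inc e v ∧ inc f v) d f}

/-- The vertices on the edges of `cyc inc c k d`. -/
def cycVerts (inc : E → V → Prop) (c : E → Fin 4) (k : Fin 4) (d : E) : Set V :=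
  {v | ∃ e ∈ cyc inc c k d, inc e v}

theorem self_mem_cyc {inc : E → V → Prop} {c : E → Fin 4} {k : Fin 4} {d : E} :
    d ∈ cyc inc c k d := Relation.ReflTransGen.refl

theorem mem_cyc_of_adj {inc : E → V → Prop} {c : E → Fin 4} {k : Fin 4} {d e f : E} {v : V}
    (he : e ∈ cyc inc c k d) (hev : inc e v) (hfv : inc f v) (hf : c f ≠ k) :
    f ∈ cyc inc c k d := Relation.ReflTransGen.tail he ⟨hf, v, hev, hfv⟩

theorem mem_cyc_of_mem_cycVerts {inc : E → V → Prop} {c : E → Fin 4} {k : Fin 4} {d f : E} {v : V}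
    (hv : v ∈ cycVerts inc c k d) (hfv : inc f v) (hf : c f ≠ k) :
    f ∈ cyc inc c k d := by
  obtain ⟨e, he, hev⟩ := hv
  exact mem_cyc_of_adj he hev hfv hf

theorem ne_of_mem_cyc {inc : E → V → Prop} {c : E → Fin 4} {k : Fin 4} {d f : E}
    (hd : c d ≠ k) (hf : f ∈ cyc inc c k d) : c f ≠ k := by
  induction hf with
  | refl => exact hd
  | tail _ h _ => exact h.1

/-- Each end sees two of the three colours, because the uncoloured edges form a matching, and two
such pairs meet. -/
theorem IsBest.exists_isType {inc : E → V → Prop} [Finite E] (hc : IsCubic inc) {c : E → Fin 4}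
    (h : IsBest inc c) {d : E} (h0 : c d = 0) : ∃ k, IsType inc c d k := by
  obtain ⟨x, y, hxy, hw⟩ := hc.ends d
  have hx := (hw x).2 (Or.inl rfl)
  have hy := (hw y).2 (Or.inr rfl)
  obtain ⟨p, q, hp, hq, hpq, hpx, hqx, -⟩ := hc.exists_others hx
  obtain ⟨p', q', hp', hq', hpq', hpy, hqy, -⟩ := hc.exists_others hy
  have n1 : c p ≠ 0 := fun hh => hp (h.blank_matching hc hpx hx hh h0)
  have n2 : c q ≠ 0 := fun hh => hq (h.blank_matching hc hqx hx hh h0)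
  have n3 : c p' ≠ 0 := fun hh => hp' (h.blank_matching hc hpy hy hh h0)
  have n4 : c q' ≠ 0 := fun hh => hq' (h.blank_matching hc hqy hy hh h0)
  have n5 : c p ≠ c q := fun hh => hpq (h.1 x p q hpx hqx hh n1)
  have n6 : c p' ≠ c q' := fun hh => hpq' (h.1 y p' q' hpy hqy hh n3)
  have hfin : ∀ P Q P' Q' : Fin 4, P ≠ 0 → Q ≠ 0 → P' ≠ 0 → Q' ≠ 0 → P ≠ Q → P' ≠ Q' →
      ∃ k, k ≠ 0 ∧ (P = k ∨ Q = k) ∧ (P' = k ∨ Q' = k) := by decide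
  obtain ⟨k, hk, h1, h2⟩ := hfin _ _ _ _ n1 n2 n3 n4 n5 n6
  refine ⟨k, hk, fun v hv => ?_⟩
  rcases (hw v).1 hv with rfl | rfl
  · rcases h1 with h1 | h1
    · exact ⟨p, hpx, h1⟩
    · exact ⟨q, hqx, h1⟩
  · rcases h2 with h2 | h2
    · exact ⟨p', hpy, h2⟩
    · exact ⟨q', hqy, h2⟩

/-- `c'` arises from `c` by moving the uncoloured edge `d` to `f` without changing the edges
coloured `k`. -/
structure IsMove (inc : E → V → Prop) (c : E → Fin 4) (k : Fin 4) (d f : E) (c' : E → Fin 4) :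
    Prop where
  proper : Proper inc c'
  blank_iff : ∀ e, c' e = 0 ↔ e = f ∨ (c e = 0 ∧ e ≠ d)
  color_iff : ∀ e, c' e = k ↔ c e = k
  sees : ∀ v, inc f v → ∃ e, inc e v ∧ c e = k

theorem ncard_blank_le [Finite E] {c c' : E → Fin 4} {d f : E} (h0 : c d = 0)
    (h : ∀ e, c' e = 0 → e = f ∨ (c e = 0 ∧ e ≠ d)) : (blank c').ncard ≤ (blank c).ncard := by
  have hsub : blank c' ⊆ insert f (blank c \ {d}) := fun e he => h e he
  refine (Set.ncard_le_ncard hsub (Set.toFinite _)).trans ((Set.ncard_insert_le _ _).trans ?_)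
  exact le_of_eq (Set.ncard_sdiff_singleton_add_one (show d ∈ blank c from h0) (Set.toFinite _))

theorem IsMove.isBest {inc : E → V → Prop} [Finite E] {c c' : E → Fin 4} {k : Fin 4} {d f : E}
    (h : IsMove inc c k d f c') (hb : IsBest inc c) (h0 : c d = 0) : IsBest inc c' :=
  hb.of_ncard_le h.proper (ncard_blank_le h0 fun e => (h.blank_iff e).1)

/-- A move onto another uncoloured edge would reduce the number of uncoloured edges. Hence a cycle
carries no second one. -/
theorem IsMove.eq_of_blank {inc : E → V → Prop} [Finite E] {c c' : E → Fin 4} {k : Fin 4}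
    {d f : E} (h : IsMove inc c k d f c') (hb : IsBest inc c) (h0 : c d = 0) (hf : c f = 0) :
    f = d := by
  by_contra hfd
  have hsub : blank c' ⊆ blank c \ {d} := fun e he => by
    rcases (h.blank_iff e).1 he with rfl | h1
    · exact ⟨hf, hfd⟩
    · exact h1
  have h1 := Set.ncard_le_ncard hsub (Set.toFinite _)
  have h2 := Set.ncard_sdiff_singleton_lt_of_mem (show d ∈ blank c from h0) (Set.toFinite _)
  have h3 := hb.2 c' h.proper
  omega

theorem IsMove.refl {inc : E → V → Prop} {c : E → Fin 4} {k : Fin 4} {d : E}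
    (hp : Proper inc c) (h0 : c d = 0) (ht : IsType inc c d k) : IsMove inc c k d d c :=
  ⟨hp, fun e => ⟨fun h => by tauto, fun h => by rcases h with rfl | h <;> tauto⟩, fun _ => Iff.rfl,
    ht.2⟩

-- The colour of `g` is shifted to `f` and `g` becomes uncoloured. This is proper because the far
-- end of `f` sees `k` and the third colour `n`, so it misses the colour of `g`. The far end of `g`
-- sees `k`: its two other edges are coloured, with distinct colours different from the old colour
-- of `g`.
open Classical in
theorem IsMove.step {inc : E → V → Prop} [Finite E] (hc : IsCubic inc) (hs : NoDigon inc)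
    {c c' : E → Fin 4} {k : Fin 4} {d f g : E} (hk : k ≠ 0)
    (h : IsMove inc c k d f c') (hb : IsBest inc c) (h0 : c d = 0) {v : V} (hfv : inc f v)
    (hgv : inc g v) (hgk : c g ≠ k) (hgf : g ≠ f) :
    IsMove inc c k d g (Function.update (Function.update c' g 0) f (c' g)) := by
  have hb' := h.isBest hb h0
  have hf0 : c' f = 0 := (h.blank_iff f).2 (Or.inl rfl)
  have hg0 : c' g ≠ 0 := fun hh => hgf (hb'.blank_matching hc hgv hfv hh hf0)
  have hgk' : c' g ≠ k := fun hh => hgk ((h.color_iff g).1 hh)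
  obtain ⟨w, hw⟩ := hc.exists_joins hfv
  obtain ⟨w2, hw2⟩ := hc.exists_joins hgv
  obtain ⟨t, htf, htg, htv, hallv⟩ := hc.exists_third hfv hgv hgf.symm
  have htk : c' t = k := by
    obtain ⟨e, hev, hek⟩ := h.sees v hfv
    have hek' := (h.color_iff e).2 hek
    rcases hallv e hev with rfl | rfl | rfl
    · exact absurd (hf0.symm.trans hek').symm hk
    · exact absurd hek' hgk'
    · exact hek'
  have hfin : ∀ a b : Fin 4, ∃ n, n ≠ 0 ∧ n ≠ a ∧ n ≠ b := by decide
  obtain ⟨n, hn0, hnk, hng⟩ := hfin k (c' g)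
  have hvn : Misses inc c' v n := by
    intro e he
    rcases hallv e he with rfl | rfl | rfl
    · exact hf0 ▸ hn0.symm
    · exact hng.symm
    · exact htk ▸ hnk.symm
  -- `w` sees `k` because `f` has type `k`, and sees `n` because `v` misses it; no third coloured
  -- edge is left.
  have hwm : Misses inc c' w (c' g) := by
    obtain ⟨p, q, hp, hq, hpq, hpw, hqw, hallw⟩ := hc.exists_others hw.2.2
    obtain ⟨e, hew, hek⟩ := h.sees w hw.2.2
    have hek' := (h.color_iff e).2 hek
    have h1 : c' p = k ∨ c' q = k := by
      rcases hallw e hew with rfl | rfl | rfl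
      · exact absurd (hf0.symm.trans hek').symm hk
      · exact Or.inl hek'
      · exact Or.inr hek'
    have h2 : c' p = n ∨ c' q = n := by
      by_contra hcon
      push Not at hcon
      refine hb'.not_misses_both hc hw hf0 hn0 hvn fun x hx => ?_
      rcases hallw x hx with rfl | rfl | rfl
      · exact hf0 ▸ hn0.symm
      · exact hcon.1
      · exact hcon.2
    intro x hx
    rcases hallw x hx with rfl | rfl | rfl
    · exact hf0 ▸ hg0.symm
    · rintro hh; rw [hh] at h1 h2
      rcases h1 with h1 | h1 <;> rcases h2 with h2 | h2
      · exact hgk' h1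
      · exact hgk' h1
      · exact hng h2.symm
      · exact hnk (h2.symm.trans h1)
    · rintro hh; rw [hh] at h1 h2
      rcases h1 with h1 | h1 <;> rcases h2 with h2 | h2
      · exact hnk (h2.symm.trans h1)
      · exact hng h2.symm
      · exact hgk' h1
      · exact hgk' h1
  have hfd : c f = 0 → f = d := h.eq_of_blank hb h0
  have hp1 : Proper inc (Function.update c' g 0) := h.proper.update fun _ _ _ _ _ _ => rfl
  have hp2 : Proper inc (Function.update (Function.update c' g 0) f (c' g)) := by
    apply hp1.update
    intro z hz e he hef hcol
    by_cases heg : e = g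
    · rw [heg, Function.update_self] at hcol
      exact hcol.symm
    rw [Function.update_of_ne heg] at hcol
    rcases hc.eq_or_eq hw hz with rfl | rfl
    · rcases hallv e he with rfl | rfl | rfl
      · exact absurd rfl hef
      · exact absurd rfl heg
      · exact absurd (hcol.symm.trans htk) hgk'
    · exact absurd hcol (hwm e he)
  have hval : ∀ e, e ≠ f → e ≠ g →
      Function.update (Function.update c' g 0) f (c' g) e = c' e := by
    intro e h1 h2
    rw [Function.update_of_ne h1, Function.update_of_ne h2]
  have hvalf : Function.update (Function.update c' g 0) f (c' g) f = c' g :=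
    Function.update_self _ _ _
  have hvalg : Function.update (Function.update c' g 0) f (c' g) g = 0 := by
    rw [Function.update_of_ne hgf, Function.update_self]
  have hblank : ∀ e, Function.update (Function.update c' g 0) f (c' g) e = 0 ↔
      e = g ∨ (c e = 0 ∧ e ≠ d) := by
    intro e
    by_cases hef : e = f
    · subst hef
      rw [hvalf]
      exact ⟨fun hh => absurd hh hg0, fun hh => by
        rcases hh with hh | ⟨h1, h2⟩
        · exact absurd hh.symm hgf
        · exact absurd (hfd h1) h2⟩
    by_cases heg : e = g
    · subst heg
      rw [hvalg]
      simp
    rw [hval e hef heg, h.blank_iff e]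
    tauto
  have hcolor : ∀ e, Function.update (Function.update c' g 0) f (c' g) e = k ↔ c e = k := by
    intro e
    by_cases hef : e = f
    · subst hef
      rw [hvalf, ← h.color_iff e, hf0]
      exact ⟨fun hh => absurd hh hgk', fun hh => absurd hh.symm hk⟩
    by_cases heg : e = g
    · subst heg
      rw [hvalg]
      exact ⟨fun hh => absurd hh.symm hk, fun hh => absurd hh hgk⟩
    rw [hval e hef heg, h.color_iff e]
  refine ⟨hp2, hblank, hcolor, ?_⟩
  have hb2 : IsBest inc (Function.update (Function.update c' g 0) f (c' g)) :=
    hb.of_ncard_le hp2 (ncard_blank_le h0 fun e => (hblank e).1)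
  intro z hz
  rcases hc.eq_or_eq hw2 hz with rfl | rfl
  · exact ⟨t, htv, (h.color_iff t).1 htk⟩
  obtain ⟨p, q, hp, hq, hpq, hpz, hqz, hallz⟩ := hc.exists_others hz
  set c2 := Function.update (Function.update c' g 0) f (c' g) with hc2
  have hne0 : ∀ x, x ≠ g → inc x z → c2 x ≠ 0 := fun x hx hxz hh =>
    hx (hb2.blank_matching hc hxz hz hh hvalg)
  have hnem : ∀ x, x ≠ g → inc x z → c2 x ≠ c' g := by
    intro x hx hxz hh
    -- The only edge other than `g` whose colour changed is `f`, and `f` reaches `z` only if it is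
    -- parallel to `g`.
    by_cases hxf : x = f
    · subst hxf
      exact hgf (hs g x v z hw2 ⟨hw2.1, hfv, hxz⟩)
    · rw [hval x hxf hx] at hh
      exact hx (h.proper z x g hxz hz hh (hh ▸ hg0))
  have hseen : c2 p = n ∨ c2 q = n := by
    by_contra hcon
    push Not at hcon
    refine hb2.not_misses_both hc hw2 hvalg hn0 (fun x hx => ?_) fun x hx => ?_
    · rcases hallv x hx with rfl | rfl | rfl
      · rw [hvalf]; exact hng.symm
      · rw [hvalg]; exact hn0.symm
      · rw [hval x htf htg, htk]; exact hnk.symm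
    · rcases hallz x hx with rfl | rfl | rfl
      · rw [hvalg]; exact hn0.symm
      · exact hcon.1
      · exact hcon.2
  have hpq' : c2 p ≠ c2 q := fun hh => hpq (hp2 z p q hpz hqz hh (hne0 p hp hpz))
  have hfin2 : ∀ P Q m k n : Fin 4, P ≠ 0 → Q ≠ 0 → P ≠ m → Q ≠ m → P ≠ Q → m ≠ 0 → k ≠ 0 →
      n ≠ 0 → m ≠ k → n ≠ k → n ≠ m → P = k ∨ Q = k := by decide
  rcases hfin2 _ _ _ k n (hne0 p hp hpz) (hne0 q hq hqz) (hnem p hp hpz) (hnem q hq hqz) hpq' hg0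
    hk hn0 hgk' hnk hng with h1 | h1
  · exact ⟨p, hpz, (hcolor p).1 h1⟩
  · exact ⟨q, hqz, (hcolor q).1 h1⟩

theorem IsBest.exists_isMove {inc : E → V → Prop} [Finite E] (hc : IsCubic inc)
    (hs : NoDigon inc) {c : E → Fin 4} {k : Fin 4} {d f : E} (hb : IsBest inc c) (h0 : c d = 0)
    (ht : IsType inc c d k) (hf : f ∈ cyc inc c k d) :
    ∃ c', IsMove inc c k d f c' ∧ ∀ e ∉ cyc inc c k d, c' e = c e := by
  classical
  induction hf with
  | refl => exact ⟨c, IsMove.refl hb.1 h0 ht, fun _ _ => rfl⟩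
  | @tail b g hb' hg ih =>
    obtain ⟨c', hm, hoff⟩ := ih
    obtain ⟨hgk, v, hbv, hgv⟩ := hg
    by_cases hgb : g = b
    · subst hgb
      exact ⟨c', hm, hoff⟩
    refine ⟨_, hm.step hc hs ht.1 hb h0 hbv hgv hgk hgb, fun e he => ?_⟩
    have h1 : e ≠ b := fun hh => he (hh ▸ hb')
    have h2 : e ≠ g := fun hh => he (hh ▸ mem_cyc_of_adj hb' hbv hgv hgk)
    rw [Function.update_of_ne h1, Function.update_of_ne h2, hoff e he]

theorem IsBest.eq_of_mem_cyc {inc : E → V → Prop} [Finite E] (hc : IsCubic inc)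
    (hs : NoDigon inc) {c : E → Fin 4} {k : Fin 4} {d f : E} (hb : IsBest inc c) (h0 : c d = 0)
    (ht : IsType inc c d k) (hf : f ∈ cyc inc c k d) (hf0 : c f = 0) : f = d := by
  obtain ⟨c', hm, -⟩ := hb.exists_isMove hc hs h0 ht hf
  exact hm.eq_of_blank hb h0 hf0

/-- The cycle is a union of Kempe components for the two colours other than `k`. If the shift leaves
the wrong colour missing at `p`, exchanging these two colours along the whole cycle corrects it
without affecting edges elsewhere. -/
theorem IsBest.exists_placement {inc : E → V → Prop} [Finite E] (hc : IsCubic inc)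
    (hs : NoDigon inc) {c : E → Fin 4} {k : Fin 4} {d f : E} (hb : IsBest inc c) (h0 : c d = 0)
    (ht : IsType inc c d k) (hf : f ∈ cyc inc c k d) {p : V} (hp : inc f p) {m : Fin 4}
    (hm0 : m ≠ 0) (hmk : m ≠ k) :
    ∃ c', IsMove inc c k d f c' ∧ (∀ e ∉ cyc inc c k d, c' e = c e) ∧ Misses inc c' p m := by
  obtain ⟨c', hm, hoff⟩ := hb.exists_isMove hc hs h0 ht hf
  by_cases hmiss : Misses inc c' p m
  · exact ⟨c', hm, hoff, hmiss⟩
  have hfin : ∀ a b : Fin 4, ∃ n, n ≠ 0 ∧ n ≠ a ∧ n ≠ b := by decide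
  obtain ⟨n, hn0, hnk, hnm⟩ := hfin k m
  have hd : c d ≠ k := h0 ▸ ht.1.symm
  have hX : KempeClosed inc c' (cycVerts inc c k d) m n := by
    intro e v w hcol hev hew hv
    have hek : c e ≠ k := by
      rw [Ne, ← hm.color_iff e]
      rcases hcol with h | h <;> rw [h]
      · exact hmk
      · exact hnk
    exact ⟨e, mem_cyc_of_mem_cycVerts hv hev hek, hew⟩
  have hpX : p ∈ cycVerts inc c k d := ⟨f, hf, hp⟩
  have hpn : Misses inc c' p n := by
    obtain ⟨a, b, ha, hb', hab, hap, hbp, hall⟩ := hc.exists_others hp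
    rw [Misses] at hmiss
    push Not at hmiss
    obtain ⟨e, hep, hem⟩ := hmiss
    obtain ⟨e', hep', hek⟩ := hm.sees p hp
    rw [← hm.color_iff] at hek
    have hf0 : c' f = 0 := (hm.blank_iff f).2 (Or.inl rfl)
    have hne : e ≠ f := by rintro rfl; exact hm0 (hem.symm.trans hf0)
    have hne' : e' ≠ f := by rintro rfl; exact ht.1 (hek.symm.trans hf0)
    have hee : e ≠ e' := by rintro rfl; exact hmk (hem.symm.trans hek)
    intro x hx
    have : x = f ∨ x = e ∨ x = e' := by
      have h1 := hall x hx
      have h2 := hall e hep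
      have h3 := hall e' hep'
      grind
    rcases this with rfl | rfl | rfl
    · rw [hf0]; exact hn0.symm
    · rw [hem]; exact hnm.symm
    · rw [hek]; exact hnk.symm
  refine ⟨swapOn inc c' (cycVerts inc c k d) m n, ⟨hm.proper.proper_swapOn hm0 hn0 hX, fun e => ?_,
    fun e => ?_, hm.sees⟩, fun e he => ?_, misses_swapOn_of_mem hpX hpn⟩
  · rw [swapOn_eq_zero hm0 hn0, hm.blank_iff]
  · rw [← hm.color_iff e, swapOn]
    split_ifs
    · rw [Equiv.swap_apply_eq_iff, Equiv.swap_apply_of_ne_of_ne hmk.symm hnk.symm]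
    · rfl
  · rw [← hoff e he]
    by_cases hX' : ∃ v ∈ cycVerts inc c k d, inc e v
    · obtain ⟨v, hv, hev⟩ := hX'
      have hek : c e = k := by
        by_contra hek
        exact he (mem_cyc_of_mem_cycVerts hv hev hek)
      rw [swapOn_of_mem hv hev, (hm.color_iff e).2 hek,
        Equiv.swap_apply_of_ne_of_ne hmk.symm hnk.symm]
    · rw [swapOn, if_neg hX']

/-! ### Disjointness of the cycles -/

theorem IsBest.sees_of_mem_cycVerts {inc : E → V → Prop} [Finite E] (hc : IsCubic inc)
    (hs : NoDigon inc) {c : E → Fin 4} {k : Fin 4} {d : E} (hb : IsBest inc c) (h0 : c d = 0)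
    (ht : IsType inc c d k) {v : V} (hv : v ∈ cycVerts inc c k d) :
    ∃ e, inc e v ∧ c e = k := by
  obtain ⟨f, hf, hfv⟩ := hv
  obtain ⟨c', hm, -⟩ := hb.exists_isMove hc hs h0 ht hf
  exact hm.sees v hfv

/-- Move the second uncoloured edge along its cycle towards the first cycle. Until contact, no
colour on an edge at the first cycle changes. On contact the moved edge becomes a second uncoloured
edge on the first cycle, which `IsBest.eq_of_mem_cyc` forbids. -/
theorem IsBest.cycVerts_disjoint {inc : E → V → Prop} [Finite E] (hc : IsCubic inc)
    (hs : NoDigon inc) {c : E → Fin 4} {k₁ k₂ : Fin 4} {d₁ d₂ : E} (hb : IsBest inc c)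
    (h1 : c d₁ = 0) (h2 : c d₂ = 0) (ht1 : IsType inc c d₁ k₁) (ht2 : IsType inc c d₂ k₂) {v : V}
    (hv1 : v ∈ cycVerts inc c k₁ d₁) (hv2 : v ∈ cycVerts inc c k₂ d₂) : d₁ = d₂ := by
  classical
  by_contra hne
  have hd1 : c d₁ ≠ k₁ := h1 ▸ ht1.1.symm
  have hd2 : c d₂ ≠ k₂ := h2 ▸ ht2.1.symm
  have key : ∀ f ∈ cyc inc c k₂ d₂, (∀ w, inc f w → w ∉ cycVerts inc c k₁ d₁) ∧
      ∃ c', IsMove inc c k₂ d₂ f c' ∧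
        ∀ e w, inc e w → w ∈ cycVerts inc c k₁ d₁ → c' e = c e := by
    intro f hf
    induction hf with
    | refl =>
      refine ⟨fun w hw hw1 => ?_, c, IsMove.refl hb.1 h2 ht2, fun _ _ _ _ => rfl⟩
      have : d₂ ∈ cyc inc c k₁ d₁ := mem_cyc_of_mem_cycVerts hw1 hw (h2 ▸ ht1.1.symm)
      exact hne (hb.eq_of_mem_cyc hc hs h1 ht1 this h2).symm
    | @tail f g hf' hg ih =>
      obtain ⟨hfX, c', hm, hag⟩ := ih
      obtain ⟨hgk, u, hfu, hgu⟩ := hg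
      have hg' : g ∈ cyc inc c k₂ d₂ := mem_cyc_of_adj hf' hfu hgu hgk
      by_cases hgf : g = f
      · subst hgf
        exact ⟨hfX, c', hm, hag⟩
      have hm' := hm.step hc hs ht2.1 hb h2 hfu hgu hgk hgf
      set c'' := Function.update (Function.update c' g 0) f (c' g) with hc''
      have hag' : ∀ e w, inc e w → w ∈ cycVerts inc c k₁ d₁ → e ≠ g → c'' e = c e := by
        intro e w hew hw heg
        have hef : e ≠ f := fun hh => hfX w (hh ▸ hew) hw
        rw [hc'', Function.update_of_ne hef, Function.update_of_ne heg]
        exact hag e w hew hw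
      have hgX : ∀ w, inc g w → w ∉ cycVerts inc c k₁ d₁ := by
        intro q hgq hq
        have hb'' := hm'.isBest hb h2
        have hg0 : c'' g = 0 := (hm'.blank_iff g).2 (Or.inl rfl)
        have hd0 : c'' d₁ = 0 := (hm'.blank_iff d₁).2 (Or.inr ⟨h1, hne⟩)
        have hgd : g ≠ d₁ := by
          rintro rfl
          exact hne (hb.eq_of_mem_cyc hc hs h2 ht2 hg' h1)
        -- The edges of colour `k₁` at `d₁` survive: the only one that could have changed is `g`,
        -- but `g` and `d₁` are both uncoloured and so do not meet.
        have ht'' : IsType inc c'' d₁ k₁ := by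
          refine ⟨ht1.1, fun x hx => ?_⟩
          obtain ⟨e, hex, hek⟩ := ht1.2 x hx
          refine ⟨e, hex, ?_⟩
          rw [hag' e x hex ⟨d₁, self_mem_cyc, hx⟩, hek]
          rintro rfl
          exact hgd (hb''.blank_matching hc hex hx hg0 hd0)
        have hmono : ∀ e ∈ cyc inc c k₁ d₁, e ∈ cyc inc c'' k₁ d₁ := by
          intro e he
          induction he with
          | refl => exact self_mem_cyc
          | @tail a b ha hb1 ihb =>
            obtain ⟨hbk, z, haz, hbz⟩ := hb1
            refine mem_cyc_of_adj ihb haz hbz ?_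
            by_cases hbg : b = g
            · rw [hbg, hg0]; exact ht1.1.symm
            · rw [hag' b z hbz ⟨a, ha, haz⟩ hbg]; exact hbk
        obtain ⟨e, he, heq⟩ := hq
        have : g ∈ cyc inc c'' k₁ d₁ :=
          mem_cyc_of_adj (hmono e he) heq hgq (hg0 ▸ ht1.1.symm)
        exact hgd (hb''.eq_of_mem_cyc hc hs hd0 ht'' this hg0)
      refine ⟨hgX, c'', hm', fun e w hew hw => hag' e w hew hw ?_⟩
      rintro rfl
      exact hgX w hew hw
  obtain ⟨e, he, hev⟩ := hv2
  exact (key e he).1 v hev hv1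

/-! ### Maximal colourings and independent moves -/

/-- The uncoloured edges of type `1`. -/
def typeOne (inc : E → V → Prop) (c : E → Fin 4) : Set E := {d | c d = 0 ∧ IsType inc c d 1}

/-- A best colouring with as many uncoloured edges of type `1` as possible, together with a choice
of a type for each uncoloured edge. -/
structure Frame (inc : E → V → Prop) (c ty : E → Fin 4) : Prop where
  cubic : IsCubic inc
  simple : NoDigon inc
  best : IsBest inc c
  maximal : ∀ c', IsBest inc c' → (typeOne inc c').ncard ≤ (typeOne inc c).ncard
  type : ∀ d, c d = 0 → IsType inc c d (ty d)

theorem exists_frame {inc : E → V → Prop} [Finite E] (hc : IsCubic inc) (hs : NoDigon inc) :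
    ∃ c ty, Frame inc c ty := by
  classical
  have hfin : Finite (E → Fin 4) := inferInstance
  obtain ⟨c₀, hc₀, hmin⟩ := Set.exists_min_image {c : E → Fin 4 | Proper inc c}
    (fun c => (blank c).ncard) (Set.toFinite _) ⟨fun _ => 0, fun _ _ _ _ _ _ h => absurd rfl h⟩
  have hb₀ : IsBest inc c₀ := ⟨hc₀, hmin⟩
  obtain ⟨c, hb, hmax⟩ := Set.exists_max_image {c : E → Fin 4 | IsBest inc c}
    (fun c => (typeOne inc c).ncard) (Set.toFinite _) ⟨c₀, hb₀⟩
  have hb : IsBest inc c := hb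
  have : ∀ d, ∃ k, c d = 0 → IsType inc c d k := fun d => by
    by_cases h : c d = 0
    · obtain ⟨k, hk⟩ := hb.exists_isType hc h
      exact ⟨k, fun _ => hk⟩
    · exact ⟨0, fun h' => absurd h' h⟩
  choose ty hty using this
  exact ⟨c, ty, hc, hs, hb, hmax, hty⟩

/-- Since `v` misses `m`, minimality makes `w` see `m`; together with `k` this uses up both coloured
edges at `w`. Prescribing the colour missed at one end of an uncoloured edge thus determines the
other end. -/
theorem IsBest.misses_other_end {inc : E → V → Prop} [Finite E] (hc : IsCubic inc)
    {c : E → Fin 4} (hb : IsBest inc c) {f e : E} {v w : V} (hf : Joins inc f v w) (h0 : c f = 0)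
    {k m n : Fin 4} (hk : k ≠ 0) (hm : m ≠ 0) (hn : n ≠ 0) (hkm : k ≠ m) (hkn : k ≠ n)
    (hmn : m ≠ n) (hv : Misses inc c v m) (he : inc e w) (hek : c e = k) : Misses inc c w n := by
  obtain ⟨p, q, hp, hq, hpq, hpw, hqw, hall⟩ := hc.exists_others hf.2.2
  have h1 : c p = k ∨ c q = k := by
    rcases hall e he with rfl | rfl | rfl
    · exact absurd (hek.symm.trans h0) hk
    · exact Or.inl hek
    · exact Or.inr hek
  have h2 : c p = m ∨ c q = m := by
    by_contra hcon
    push Not at hcon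
    refine hb.not_misses_both hc hf h0 hm hv fun x hx => ?_
    rcases hall x hx with rfl | rfl | rfl
    · exact h0 ▸ hm.symm
    · exact hcon.1
    · exact hcon.2
  intro x hx
  rcases hall x hx with rfl | rfl | rfl
  · exact h0 ▸ hn.symm
  · grind
  · grind

/-- With two common colours, both ends would miss the third. -/
theorem IsBest.type_unique {inc : E → V → Prop} [Finite E] (hc : IsCubic inc)
    {c : E → Fin 4} (hb : IsBest inc c) {d : E} (h0 : c d = 0) {k k' : Fin 4}
    (hk : IsType inc c d k) (hk' : IsType inc c d k') : k = k' := by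
  by_contra hne
  obtain ⟨x, y, hxy, hw⟩ := hc.ends d
  have hx := (hw x).2 (Or.inl rfl)
  have hy := (hw y).2 (Or.inr rfl)
  have hfin : ∀ a b : Fin 4, ∃ n, n ≠ 0 ∧ n ≠ a ∧ n ≠ b := by decide
  obtain ⟨n, hn0, hnk, hnk'⟩ := hfin k k'
  have hmiss : ∀ z, inc d z → Misses inc c z n := by
    intro z hz
    obtain ⟨p, q, hp, hq, hpq, hpz, hqz, hall⟩ := hc.exists_others hz
    obtain ⟨e, hez, hek⟩ := hk.2 z hz
    obtain ⟨e', hez', hek'⟩ := hk'.2 z hz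
    have h1 := hall e hez
    have h2 := hall e' hez'
    have hed : e ≠ d := by rintro rfl; exact hk.1 (hek.symm.trans h0)
    have hed' : e' ≠ d := by rintro rfl; exact hk'.1 (hek'.symm.trans h0)
    have hee : e ≠ e' := by rintro rfl; exact hne (hek.symm.trans hek')
    intro x hx
    have : x = d ∨ x = e ∨ x = e' := by
      have := hall x hx
      grind
    rcases this with rfl | rfl | rfl
    · rw [h0]; exact hn0.symm
    · rw [hek]; exact hnk.symm
    · rw [hek']; exact hnk'.symm
  exact hb.not_misses_both hc ⟨hxy, hx, hy⟩ h0 hn0 (hmiss x hx) (hmiss y hy)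

namespace Frame

variable {inc : E → V → Prop} {c ty : E → Fin 4}

/-- A vertex on the cycles of two uncoloured edges determines the edge. -/
theorem eq_of_mem [Finite E] (F : Frame inc c ty) {d d' : E} (h : c d = 0) (h' : c d' = 0) {v : V}
    (hv : v ∈ cycVerts inc c (ty d) d) (hv' : v ∈ cycVerts inc c (ty d') d') : d = d' :=
  F.best.cycVerts_disjoint F.cubic F.simple h h' (F.type d h) (F.type d' h') hv hv'

theorem blank_ne (F : Frame inc c ty) {d : E} (h : c d = 0) : c d ≠ ty d :=
  h ▸ (F.type d h).1.symm

theorem leg_notMem_cyc [Finite E] (F : Frame inc c ty) {d d' e : E} (h : c d = 0) (h' : c d' = 0)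
    {v : V} (hv : v ∈ cycVerts inc c (ty d) d) (he : inc e v) (hek : c e = ty d) :
    e ∉ cyc inc c (ty d') d' := by
  intro hmem
  have : d = d' := F.eq_of_mem h h' hv ⟨e, hmem, he⟩
  subst this
  exact ne_of_mem_cyc (F.blank_ne h) hmem hek

/-- A target position of the uncoloured edge `d`: the edge, one of its ends, and the colour to be
missed there. -/
def Valid (inc : E → V → Prop) (c ty : E → Fin 4) (d : E) (s : E × V × Fin 4) : Prop :=
  s.1 ∈ cyc inc c (ty d) d ∧ inc s.1 s.2.1 ∧ s.2.2 ≠ 0 ∧ s.2.2 ≠ ty d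

/-- All uncoloured edges can be moved independently of each other. -/
theorem realize [Finite E] (F : Frame inc c ty) (Q : E → E × V × Fin 4 → Prop)
    (hQ : ∀ d, c d = 0 → ∃ s, Valid inc c ty d s ∧ Q d s) :
    ∃ (c' : E → Fin 4) (s : E → E × V × Fin 4), IsBest inc c' ∧
      (∀ d, c d = 0 → Valid inc c ty d (s d) ∧ Q d (s d) ∧ c' (s d).1 = 0 ∧
        Misses inc c' (s d).2.1 (s d).2.2 ∧ ∀ e ∈ cyc inc c (ty d) d, c' e ≠ ty d) ∧
      (∀ e, c' e = 0 → ∃ d, c d = 0 ∧ e = (s d).1) ∧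
      (∀ e, (∀ d, c d = 0 → e ∉ cyc inc c (ty d) d) → c' e = c e) := by
  classical
  have hch : ∀ d, ∃ (s : E × V × Fin 4) (g : E → Fin 4), c d = 0 →
      Valid inc c ty d s ∧ Q d s ∧ IsMove inc c (ty d) d s.1 g ∧
        (∀ e ∉ cyc inc c (ty d) d, g e = c e) ∧ Misses inc g s.2.1 s.2.2 := by
    intro d
    by_cases h : c d = 0
    · obtain ⟨s, hv, hq⟩ := hQ d h
      obtain ⟨g, h1, h2, h3⟩ := F.best.exists_placement F.cubic F.simple h (F.type d h) hv.1 hv.2.1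
        hv.2.2.1 hv.2.2.2
      exact ⟨s, g, fun _ => ⟨hv, hq, h1, h2, h3⟩⟩
    · obtain ⟨v, _⟩ := F.cubic.ends d
      exact ⟨(d, v, 0), c, fun h' => absurd h' h⟩
  choose s g hsg using hch
  -- The individual moves are pasted together. Disjointness of the cycles makes the chosen `d`
  -- unique, and around each vertex the result agrees either with a single move or with `c`.
  let c' : E → Fin 4 := fun e =>
    if h : ∃ d, c d = 0 ∧ e ∈ cyc inc c (ty d) d then g h.choose e else c e
  have hend : ∀ e, ∃ v, inc e v := fun e => by
    obtain ⟨a, b, _, h⟩ := F.cubic.ends e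
    exact ⟨a, (h a).2 (Or.inl rfl)⟩
  have hmem : ∀ d e, c d = 0 → e ∈ cyc inc c (ty d) d → c' e = g d e := by
    intro d e hd he
    have hex : ∃ d, c d = 0 ∧ e ∈ cyc inc c (ty d) d := ⟨d, hd, he⟩
    simp only [c']
    rw [dif_pos hex]
    obtain ⟨v, hv⟩ := hend e
    rw [F.eq_of_mem hex.choose_spec.1 hd ⟨e, hex.choose_spec.2, hv⟩ ⟨e, he, hv⟩]
  have hnot : ∀ e, (∀ d, c d = 0 → e ∉ cyc inc c (ty d) d) → c' e = c e := by
    intro e he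
    simp only [c']
    rw [dif_neg]
    rintro ⟨d, hd, hed⟩
    exact he d hd hed
  have hinc : ∀ d e v, c d = 0 → v ∈ cycVerts inc c (ty d) d → inc e v → c' e = g d e := by
    intro d e v hd hv hev
    by_cases hed : e ∈ cyc inc c (ty d) d
    · exact hmem d e hd hed
    · rw [(hsg d hd).2.2.2.1 e hed]
      refine hnot e fun d' hd' hed' => hed ?_
      rwa [F.eq_of_mem hd hd' hv ⟨e, hed', hev⟩]
  have hproper : Proper inc c' := by
    intro v e f he hf hef hne
    by_cases hv : ∃ d, c d = 0 ∧ v ∈ cycVerts inc c (ty d) d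
    · obtain ⟨d, hd, hv⟩ := hv
      rw [hinc d e v hd hv he] at hef hne
      rw [hinc d f v hd hv hf] at hef
      exact (hsg d hd).2.2.1.proper v e f he hf hef hne
    · have hn : ∀ x, inc x v → c' x = c x := fun x hx => hnot x fun d hd hxd =>
        hv ⟨d, hd, x, hxd, hx⟩
      rw [hn e he] at hef hne
      rw [hn f hf] at hef
      exact F.best.1 v e f he hf hef hne
  have hblank : ∀ e, c' e = 0 → ∃ d, c d = 0 ∧ e = (s d).1 := by
    intro e he
    by_cases hex : ∃ d, c d = 0 ∧ e ∈ cyc inc c (ty d) d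
    · obtain ⟨d, hd, hed⟩ := hex
      rw [hmem d e hd hed, (hsg d hd).2.2.1.blank_iff] at he
      rcases he with h | ⟨h1, h2⟩
      · exact ⟨d, hd, h⟩
      · exact absurd (F.best.eq_of_mem_cyc F.cubic F.simple hd (F.type d hd) hed h1) h2
    · have hex' : ∀ d, c d = 0 → e ∉ cyc inc c (ty d) d := fun d hd hh => hex ⟨d, hd, hh⟩
      rw [hnot e hex'] at he
      exact absurd ⟨e, he, self_mem_cyc⟩ hex
  refine ⟨c', s, F.best.of_ncard_le hproper ?_, ?_, hblank, hnot⟩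
  · have hsub : blank c' ⊆ (fun d => (s d).1) '' blank c := fun e he => by
      obtain ⟨d, hd, rfl⟩ := hblank e he
      exact ⟨d, hd, rfl⟩
    exact (Set.ncard_le_ncard hsub (Set.toFinite _)).trans (Set.ncard_image_le (Set.toFinite _))
  · intro d hd
    obtain ⟨h1, h2, h3, h4, h5⟩ := hsg d hd
    refine ⟨h1, h2, ?_, ?_, ?_⟩
    · rw [hmem d _ hd h1.1]
      exact (h3.blank_iff _).2 (Or.inl rfl)
    · intro e he
      rw [hinc d e _ hd ⟨_, h1.1, h1.2.1⟩ he]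
      exact h5 e he
    · intro e he
      rw [hmem d e hd he, Ne, h3.color_iff]
      exact ne_of_mem_cyc (F.blank_ne hd) he

theorem exists_valid (F : Frame inc c ty) (d : E) :
    ∃ s, Valid inc c ty d s ∧ s.1 = d := by
  obtain ⟨v, _, _, hv⟩ := F.cubic.ends d
  have hfin : ∀ a : Fin 4, ∃ n, n ≠ 0 ∧ n ≠ a := by decide
  obtain ⟨n, hn, hn'⟩ := hfin (ty d)
  exact ⟨(d, v, n), ⟨self_mem_cyc, (hv v).2 (Or.inl rfl), hn, hn'⟩, rfl⟩

/-- Three different uncoloured edges can be moved to prescribed positions. -/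
theorem realize_three [Finite E] (F : Frame inc c ty) {i j k : E} (hij : i ≠ j) (hik : i ≠ k)
    (hjk : j ≠ k) {s₁ s₂ s₃ : E × V × Fin 4} (h1 : Valid inc c ty i s₁)
    (h2 : Valid inc c ty j s₂) (h3 : Valid inc c ty k s₃) (hi : c i = 0) (hj : c j = 0)
    (hk : c k = 0) :
    ∃ c' : E → Fin 4, IsBest inc c' ∧ c' s₁.1 = 0 ∧ c' s₂.1 = 0 ∧ c' s₃.1 = 0 ∧
      Misses inc c' s₁.2.1 s₁.2.2 ∧ Misses inc c' s₂.2.1 s₂.2.2 ∧ Misses inc c' s₃.2.1 s₃.2.2 ∧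
      (∀ e, (∀ d, c d = 0 → e ∉ cyc inc c (ty d) d) → c' e = c e) := by
  obtain ⟨c', s, hb, hs, -, hoff⟩ := F.realize
    (fun d s => (d = i → s = s₁) ∧ (d = j → s = s₂) ∧ (d = k → s = s₃)) (by
      intro d hd
      by_cases hdi : d = i
      · subst hdi; exact ⟨s₁, h1, fun _ => rfl, fun h => absurd h hij, fun h => absurd h hik⟩
      by_cases hdj : d = j
      · subst hdj; exact ⟨s₂, h2, fun h => absurd h hdi, fun _ => rfl, fun h => absurd h hjk⟩
      by_cases hdk : d = k
      · subst hdk; exact ⟨s₃, h3, fun h => absurd h hdi, fun h => absurd h hdj, fun _ => rfl⟩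
      obtain ⟨s, hs, -⟩ := F.exists_valid d
      exact ⟨s, hs, fun h => absurd h hdi, fun h => absurd h hdj, fun h => absurd h hdk⟩)
  have e1 := (hs i hi).2.1.1 rfl
  have e2 := (hs j hj).2.1.2.1 rfl
  have e3 := (hs k hk).2.1.2.2 rfl
  refine ⟨c', hb, ?_, ?_, ?_, ?_, ?_, ?_, hoff⟩
  · rw [← e1]; exact (hs i hi).2.2.1
  · rw [← e2]; exact (hs j hj).2.2.1
  · rw [← e3]; exact (hs k hk).2.2.1
  · rw [← e1]; exact (hs i hi).2.2.2.1
  · rw [← e2]; exact (hs j hj).2.2.2.1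
  · rw [← e3]; exact (hs k hk).2.2.2.1

/-- Two different uncoloured edges can be moved to prescribed positions, the others being kept. -/
theorem realize_two [Finite E] (F : Frame inc c ty) {i j : E} (hij : i ≠ j)
    {s₁ s₂ : E × V × Fin 4} (h1 : Valid inc c ty i s₁)
    (h2 : Valid inc c ty j s₂) (hi : c i = 0) (hj : c j = 0) :
    ∃ c' : E → Fin 4, IsBest inc c' ∧ c' s₁.1 = 0 ∧ c' s₂.1 = 0 ∧
      (∀ d, c d = 0 → d ≠ i → d ≠ j → c' d = 0) ∧
      Misses inc c' s₁.2.1 s₁.2.2 ∧ Misses inc c' s₂.2.1 s₂.2.2 ∧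
      (∀ e, (∀ d, c d = 0 → e ∉ cyc inc c (ty d) d) → c' e = c e) := by
  obtain ⟨c', s, hb, hs, -, hoff⟩ := F.realize
    (fun d s => (d = i → s = s₁) ∧ (d = j → s = s₂) ∧ (d ≠ i → d ≠ j → s.1 = d)) (by
      intro d hd
      by_cases hdi : d = i
      · subst hdi; exact ⟨s₁, h1, fun _ => rfl, fun h => absurd h hij, fun h => absurd rfl h⟩
      by_cases hdj : d = j
      · subst hdj; exact ⟨s₂, h2, fun h => absurd h hdi, fun _ => rfl, fun _ h => absurd rfl h⟩
      obtain ⟨s, hs, hs'⟩ := F.exists_valid d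
      exact ⟨s, hs, fun h => absurd h hdi, fun h => absurd h hdj, fun _ _ => hs'⟩)
  have e1 := (hs i hi).2.1.1 rfl
  have e2 := (hs j hj).2.1.2.1 rfl
  refine ⟨c', hb, ?_, ?_, ?_, ?_, ?_, hoff⟩
  · rw [← e1]; exact (hs i hi).2.2.1
  · rw [← e2]; exact (hs j hj).2.2.1
  · intro d hd hdi hdj
    have := (hs d hd).2.2.1
    rwa [(hs d hd).2.1.2.2 hdi hdj] at this
  · rw [← e1]; exact (hs i hi).2.2.2.1
  · rw [← e2]; exact (hs j hj).2.2.2.1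

/-- Cycles of a type other than `1` are not linked. -/
theorem not_linked [Finite E] (F : Frame inc c ty) {i j e : E} (hi : c i = 0) (hj : c j = 0)
    (hij : i ≠ j) (hty : ty i ≠ 1) (htij : ty i = ty j) {v v' : V} (he : Joins inc e v v')
    (hec : c e = ty i) (hv : v ∈ cycVerts inc c (ty i) i) (hv' : v' ∈ cycVerts inc c (ty j) j) :
    False := by
  classical
  obtain ⟨f, hf, hfv⟩ := id hv
  obtain ⟨f', hf', hfv'⟩ := id hv'
  -- Both uncoloured places are brought to the ends of `e` with colour 1 missing there, so that `e`
  -- can be recoloured with 1. This keeps the colouring best and will create a new uncoloured edge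
  -- of type 1.
  obtain ⟨c', hb, h1, h2, hk, hm1, hm2, hoff⟩ := F.realize_two hij (s₁ := (f, v, 1))
    (s₂ := (f', v', 1)) ⟨hf, hfv, one_ne_zero, hty.symm⟩
    ⟨hf', hfv', one_ne_zero, htij ▸ hty.symm⟩ hi hj
  dsimp only at h1 h2 hm1 hm2
  have hec' : c' e = ty i :=
    (hoff e fun d hd => F.leg_notMem_cyc hi hd hv he.2.1 hec).trans hec
  have hti0 := (F.type i hi).1
  have hp : Proper inc (Function.update c' e 1) := by
    apply hb.1.update
    intro z hz x hx _ hx1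
    rcases F.cubic.eq_or_eq he hz with rfl | rfl
    · exact absurd hx1 (hm1 x hx)
    · exact absurd hx1 (hm2 x hx)
  have hval : ∀ x, c' x = 1 → Function.update c' e 1 x = 1 := by
    intro x hx
    by_cases hxe : x = e
    · rw [hxe, Function.update_self]
    · rw [Function.update_of_ne hxe, hx]
  have hb' : IsBest inc (Function.update c' e 1) := by
    refine hb.of_ncard_le hp (Set.ncard_le_ncard (fun x hx => ?_) (Set.toFinite _))
    by_cases hxe : x = e
    · simp [blank, hxe] at hx
    · simpa [blank, Function.update_of_ne hxe] using hx
  have hfe : f ≠ e := by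
    rintro rfl
    exact ne_of_mem_cyc (F.blank_ne hi) hf hec
  have hmax := F.maximal _ hb'
  have hlt : (typeOne inc c).ncard < (typeOne inc (Function.update c' e 1)).ncard := by
    apply Set.ncard_lt_ncard _ (Set.toFinite _)
    have hnot : ∀ d, c d = 0 → IsType inc c d 1 → ty d = 1 := fun d hd ht =>
      F.best.type_unique F.cubic hd (F.type d hd) ht
    refine ⟨fun d hd => ?_, fun hsub => ?_⟩
    · obtain ⟨hd0, hdt⟩ := hd
      have htd := hnot d hd0 hdt
      have hdi : d ≠ i := by rintro rfl; exact hty htd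
      have hdj : d ≠ j := by rintro rfl; exact hty (htij.trans htd)
      have hde : d ≠ e := by
        rintro rfl
        exact hti0 (hec.symm.trans hd0)
      refine ⟨?_, one_ne_zero, fun z hz => ?_⟩
      · rw [Function.update_of_ne hde]
        exact hk d hd0 hdi hdj
      · obtain ⟨x, hxz, hx1⟩ := hdt.2 z hz
        refine ⟨x, hxz, hval x ?_⟩
        rw [hoff x fun d' hd' => F.leg_notMem_cyc hd0 hd' ⟨d, self_mem_cyc, hz⟩ hxz
          (hx1.trans htd.symm), hx1]
    -- At `v` colour 1 is now seen on `e`; the other end of `f` saw it before, since otherwise `f`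
    -- could have been coloured 1.
    · have hmem : f ∈ typeOne inc (Function.update c' e 1) := by
        refine ⟨?_, one_ne_zero, fun z hz => ?_⟩
        · rw [Function.update_of_ne hfe]; exact h1
        · obtain ⟨w, hw⟩ := F.cubic.exists_joins hfv
          rcases F.cubic.eq_or_eq hw hz with rfl | rfl
          · exact ⟨e, he.2.1, Function.update_self _ _ _⟩
          · by_contra hcon
            push Not at hcon
            exact hb.not_misses_both F.cubic hw h1 one_ne_zero hm1 fun x hx hx1 =>
              hcon x hx (hval x hx1)
      obtain ⟨hf0, hft⟩ := hsub hmem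
      have : f = i := F.best.eq_of_mem_cyc F.cubic F.simple hi (F.type i hi) hf hf0
      subst this
      exact hty (hnot f hf0 hft)
  omega

end Frame

/-! ### Kempe changes at the ends of an uncoloured edge -/

/-- Exchanging on the disjoint sets `Z₁` and `Z₂` one after the other makes `a` missing at both `v`
and `w`, so `d` could be coloured `a`. -/
theorem IsBest.not_two_chains {inc : E → V → Prop} [Finite E] (hc : IsCubic inc)
    {c : E → Fin 4} (hb : IsBest inc c) {d : E} {v w : V} (hd : Joins inc d v w) (h0 : c d = 0)
    {a m n : Fin 4} (ha : a ≠ 0) (hm : m ≠ 0) (hn : n ≠ 0) {Z₁ Z₂ : Set V}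
    (h1 : KempeClosed inc c Z₁ a m) (h2 : KempeClosed inc c Z₂ a n) (hv : v ∈ Z₁) (hw : w ∈ Z₂)
    (hdis : ∀ x ∈ Z₁, x ∉ Z₂) (hvm : Misses inc c v m) (hwn : Misses inc c w n) : False := by
  have hb1 := hb.isBest_swapOn ha hm h1
  have hZ : ∀ e x, x ∈ Z₂ → inc e x → swapOn inc c Z₁ a m e = c e := fun e x hx hex =>
    swapOn_of_notMem h1 (fun hh => hdis x hh hx) hex
  have h2' : KempeClosed inc (swapOn inc c Z₁ a m) Z₂ a n := by
    intro e x y hcol hex hey hx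
    rw [hZ e x hx hex] at hcol
    exact h2 e x y hcol hex hey hx
  have hb2 := hb1.isBest_swapOn ha hn h2'
  have hw1 : Misses inc (swapOn inc c Z₁ a m) w n :=
    misses_swapOn_of_notMem h1 (fun hh => hdis w hh hw) hwn
  refine hb2.not_misses_both hc hd ?_ ha
    (misses_swapOn_of_notMem h2' (hdis v hv) (misses_swapOn_of_mem hv hvm))
    (misses_swapOn_of_mem hw hw1)
  rw [swapOn_eq_zero ha hn, swapOn_eq_zero ha hm, h0]

theorem kempeClosed_pair {inc : E → V → Prop} (hc : IsCubic inc) {c : E → Fin 4}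
    (hp : Proper inc c) {e : E} {v v' : V} {a m : Fin 4} (ha : a ≠ 0) (he : Joins inc e v v')
    (hea : c e = a) (hv : Misses inc c v m) (hv' : Misses inc c v' m) :
    KempeClosed inc c {v, v'} a m := by
  intro x y z hcol hxy hxz hy
  have hx : x = e := by
    rcases hcol with h | h
    · rcases hy with rfl | rfl
      · exact hp _ x e hxy he.2.1 (h.trans hea.symm) (h ▸ ha)
      · exact hp _ x e hxy he.2.2 (h.trans hea.symm) (h ▸ ha)
    · rcases hy with rfl | rfl
      · exact absurd h (hv x hxy)
      · exact absurd h (hv' x hxy)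
  subst hx
  exact hc.eq_or_eq he hxz

theorem kempeClosed_triple {inc : E → V → Prop} (hc : IsCubic inc) {c : E → Fin 4}
    (hp : Proper inc c) {e e' : E} {w x y : V} {a m : Fin 4} (ha : a ≠ 0) (hm : m ≠ 0)
    (he : Joins inc e w x) (hea : c e = a) (he' : Joins inc e' x y) (hem : c e' = m)
    (hw : Misses inc c w m) (hy : Misses inc c y a) :
    KempeClosed inc c {w, x, y} a m := by
  intro f p q hcol hfp hfq hpm
  have hf : f = e ∨ f = e' := by
    rcases hcol with h | h
    · rcases hpm with rfl | rfl | rfl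
      · exact Or.inl (hp _ f e hfp he.2.1 (h.trans hea.symm) (h ▸ ha))
      · exact Or.inl (hp _ f e hfp he.2.2 (h.trans hea.symm) (h ▸ ha))
      · exact absurd h (hy f hfp)
    · rcases hpm with rfl | rfl | rfl
      · exact absurd h (hw f hfp)
      · exact Or.inr (hp _ f e' hfp he'.2.1 (h.trans hem.symm) (h ▸ hm))
      · exact Or.inr (hp _ f e' hfp he'.2.2 (h.trans hem.symm) (h ▸ hm))
  rcases hf with rfl | rfl
  · rcases hc.eq_or_eq he hfq with rfl | rfl <;> simp
  · rcases hc.eq_or_eq he' hfq with rfl | rfl <;> simp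

/-! ### Configurations excluded at the ends of an edge on a cycle of type 1 -/

namespace Frame

variable {inc : E → V → Prop} {c ty : E → Fin 4}

/-- The vertex `v` has an edge of colour `1` to a vertex on the cycle of `j`, of type `1`. -/
def Link (inc : E → V → Prop) (c ty : E → Fin 4) (j : E) (e : E) (v v' : V) : Prop :=
  c j = 0 ∧ ty j = 1 ∧ Joins inc e v v' ∧ c e = 1 ∧ v' ∈ cycVerts inc c (ty j) j

/-- The vertex `v` has an edge of colour `1` to a vertex whose edge of colour `ty k` leads to the
cycle of `k`, of type other than `1`. -/
def Cross (inc : E → V → Prop) (c ty : E → Fin 4) (k : E) (e e' : E) (v u v' : V) : Prop :=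
  c k = 0 ∧ ty k ≠ 1 ∧ Joins inc e v u ∧ c e = 1 ∧ Joins inc e' u v' ∧ c e' = ty k ∧
    v' ∈ cycVerts inc c (ty k) k

theorem leg_keeps [Finite E] (F : Frame inc c ty) {c' : E → Fin 4}
    (hoff : ∀ e, (∀ d, c d = 0 → e ∉ cyc inc c (ty d) d) → c' e = c e) {d e : E} (h : c d = 0)
    {v : V} (hv : v ∈ cycVerts inc c (ty d) d) (he : inc e v) (hek : c e = ty d) :
    c' e = c e :=
  hoff e fun _ hd' => F.leg_notMem_cyc h hd' hv he hek

theorem two_ne : (2 : Fin 4) ≠ 0 := by decide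

theorem three_ne : (3 : Fin 4) ≠ 0 := by decide

theorem two_ne_one : (2 : Fin 4) ≠ 1 := by decide

theorem three_ne_one : (3 : Fin 4) ≠ 1 := by decide

theorem leg_ne_of_adj [Finite E] (F : Frame inc c ty) {i f e : E} (hi : c i = 0) (hti : ty i = 1)
    (hf : f ∈ cyc inc c (ty i) i) {v w u u' : V} (hfv : Joins inc f v w) (he : Joins inc e v u)
    (he1 : c e = 1) {e' : E} (he' : Joins inc e' w u') (he1' : c e' = 1) :
    u ≠ w ∧ u' ≠ v ∧ u ≠ u' := by
  have hfc : c f ≠ 1 := fun hh => ne_of_mem_cyc (F.blank_ne hi) hf (hh.trans hti.symm)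
  refine ⟨?_, ?_, ?_⟩
  · rintro rfl
    exact hfc (F.simple e f _ _ he hfv ▸ he1)
  · rintro rfl
    exact hfc (F.simple e' f _ _ he' hfv.symm ▸ he1')
  · rintro rfl
    have : e = e' := F.best.1 u e e' he.2.2 he'.2.2 (he1.trans he1'.symm)
      (by rw [he1]; exact one_ne_zero)
    subst this
    rcases F.cubic.eq_or_eq he he'.2.1 with h | h
    · exact hfv.1 h.symm
    · exact he'.1 h

/-- Make `f` the uncoloured edge with `v` missing 2, so that `w` misses 3, and place the other two
uncoloured edges so that `v'` misses 2 and `w'` misses 3. Then the two legs are entire Kempe chains,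
for the colours 1, 2 and 1, 3, and exchanging both frees colour 1 for `f`. -/
theorem not_link_link [Finite E] (F : Frame inc c ty) {i j k f e e' : E} (hi : c i = 0)
    (hti : ty i = 1) (hf : f ∈ cyc inc c (ty i) i) {v w v' w' : V} (hfv : Joins inc f v w)
    (hij : i ≠ j) (hik : i ≠ k) (hjk : j ≠ k) (h1 : Link inc c ty j e v v')
    (h2 : Link inc c ty k e' w w') : False := by
  obtain ⟨hj, htj, he, he1, hv'⟩ := h1
  obtain ⟨hk, htk, he', he1', hw'⟩ := h2
  obtain ⟨g, hg, hgv⟩ := id hv'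
  obtain ⟨g', hg', hgw⟩ := id hw'
  have hvX : v ∈ cycVerts inc c (ty i) i := ⟨f, hf, hfv.2.1⟩
  have hwX : w ∈ cycVerts inc c (ty i) i := ⟨f, hf, hfv.2.2⟩
  obtain ⟨c', hb, b1, b2, b3, m1, m2, m3, hoff⟩ := F.realize_three hij hik hjk
    (s₁ := (f, v, 2)) (s₂ := (g, v', 2)) (s₃ := (g', w', 3))
    ⟨hf, hfv.2.1, two_ne, by rw [hti]; exact two_ne_one⟩
    ⟨hg, hgv, two_ne, by rw [htj]; exact two_ne_one⟩
    ⟨hg', hgw, three_ne, by rw [htk]; exact three_ne_one⟩ hi hj hk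
  dsimp only at b1 b2 b3 m1 m2 m3
  have hec : c' e = 1 := (F.leg_keeps hoff hi hvX he.2.1 (he1.trans hti.symm)).trans he1
  have hec' : c' e' = 1 := (F.leg_keeps hoff hi hwX he'.2.1 (he1'.trans hti.symm)).trans he1'
  have m4 : Misses inc c' w 3 := hb.misses_other_end F.cubic hfv b1 (k := 1) (m := 2) (by decide)
    (by decide) (by decide) (by decide) (by decide) (by decide) m1 he'.2.1 hec'
  obtain ⟨n1, n2, n3⟩ := F.leg_ne_of_adj hi hti hf hfv he he1 he' he1'
  refine hb.not_two_chains F.cubic hfv b1 one_ne_zero (by decide) (by decide)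
    (kempeClosed_pair F.cubic hb.1 one_ne_zero he hec m1 m2)
    (kempeClosed_pair F.cubic hb.1 one_ne_zero he' hec' m4 m3) (by simp) (by simp) ?_ m1 m4
  rintro x (rfl | rfl) (h | h)
  · exact hfv.1 h
  · exact n2 h.symm
  · exact n1 h
  · exact n3 h

/-- A single second cycle suffices when `v'` and `w'` are consecutive on it: with `g` uncoloured and
`v'` missing 2, its other end `w'` misses 3. -/
theorem not_link_link_adj [Finite E] (F : Frame inc c ty) {i j f g e e' : E} (hi : c i = 0)
    (hti : ty i = 1) (hf : f ∈ cyc inc c (ty i) i) {v w v' w' : V} (hfv : Joins inc f v w)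
    (hij : i ≠ j) (h1 : Link inc c ty j e v v') (h2 : Link inc c ty j e' w w')
    (hg : g ∈ cyc inc c (ty j) j) (hgv : Joins inc g v' w') : False := by
  obtain ⟨hj, htj, he, he1, hv'⟩ := h1
  obtain ⟨-, -, he', he1', hw'⟩ := h2
  have hvX : v ∈ cycVerts inc c (ty i) i := ⟨f, hf, hfv.2.1⟩
  have hwX : w ∈ cycVerts inc c (ty i) i := ⟨f, hf, hfv.2.2⟩
  obtain ⟨c', hb, b1, b2, -, m1, m2, hoff⟩ := F.realize_two hij
    (s₁ := (f, v, 2)) (s₂ := (g, v', 2))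
    ⟨hf, hfv.2.1, two_ne, by rw [hti]; exact two_ne_one⟩
    ⟨hg, hgv.2.1, two_ne, by rw [htj]; exact two_ne_one⟩
    hi hj
  dsimp only at b1 b2 m1 m2
  have hec : c' e = 1 := (F.leg_keeps hoff hi hvX he.2.1 (he1.trans hti.symm)).trans he1
  have hec' : c' e' = 1 := (F.leg_keeps hoff hi hwX he'.2.1 (he1'.trans hti.symm)).trans he1'
  have m4 : Misses inc c' w 3 := hb.misses_other_end F.cubic hfv b1 (k := 1) (m := 2) (by decide)
    (by decide) (by decide) (by decide) (by decide) (by decide) m1 he'.2.1 hec'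
  have m3 : Misses inc c' w' 3 := hb.misses_other_end F.cubic hgv b2 (k := 1) (m := 2) (by decide)
    (by decide) (by decide) (by decide) (by decide) (by decide) m2 he'.2.2 hec'
  obtain ⟨n1, n2, n3⟩ := F.leg_ne_of_adj hi hti hf hfv he he1 he' he1'
  refine hb.not_two_chains F.cubic hfv b1 one_ne_zero (by decide) (by decide)
    (kempeClosed_pair F.cubic hb.1 one_ne_zero he hec m1 m2)
    (kempeClosed_pair F.cubic hb.1 one_ne_zero he' hec' m4 m3) (by simp) (by simp) ?_ m1 m4
  rintro x (rfl | rfl) (h | h)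
  · exact hfv.1 h
  · exact n2 h.symm
  · exact n1 h
  · exact n3 h

/-- The second chain now has two edges: from `w` by colour 1 to `u`, then by colour `ty k` to `w'`.
It ends there because `w` misses `ty k` and the uncoloured edge of `k` is placed so that `w'` misses
1. -/
theorem not_link_cross [Finite E] (F : Frame inc c ty) {i j k f e e' e'' : E} (hi : c i = 0)
    (hti : ty i = 1) (hf : f ∈ cyc inc c (ty i) i) {v w v' u w' : V} (hfv : Joins inc f v w)
    (hij : i ≠ j) (h1 : Link inc c ty j e v v') (h2 : Cross inc c ty k e' e'' w u w') :
    False := by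
  obtain ⟨hj, htj, he, he1, hv'⟩ := h1
  obtain ⟨hk, htk, he', he1', he'', he1'', hw'⟩ := h2
  have hik : i ≠ k := by rintro rfl; exact htk hti
  have hjk : j ≠ k := by rintro rfl; exact htk htj
  obtain ⟨g, hg, hgv⟩ := id hv'
  obtain ⟨g', hg', hgw⟩ := id hw'
  have hvX : v ∈ cycVerts inc c (ty i) i := ⟨f, hf, hfv.2.1⟩
  have hwX : w ∈ cycVerts inc c (ty i) i := ⟨f, hf, hfv.2.2⟩
  have htk0 : ty k ≠ 0 := (F.type k hk).1
  have hfin : ∀ a : Fin 4, ∃ n, n ≠ 0 ∧ n ≠ 1 ∧ n ≠ a := by decide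
  obtain ⟨m, hm0, hm1, hmk⟩ := hfin (ty k)
  obtain ⟨c', hb, b1, b2, b3, m1, m2, m3, hoff⟩ := F.realize_three hij hik hjk
    (s₁ := (f, v, m)) (s₂ := (g, v', m)) (s₃ := (g', w', 1))
    ⟨hf, hfv.2.1, hm0, by rw [hti]; exact hm1⟩ ⟨hg, hgv, hm0, by rw [htj]; exact hm1⟩
    ⟨hg', hgw, one_ne_zero, htk.symm⟩ hi hj hk
  dsimp only at b1 b2 b3 m1 m2 m3
  have hec : c' e = 1 := (F.leg_keeps hoff hi hvX he.2.1 (he1.trans hti.symm)).trans he1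
  have hec' : c' e' = 1 := (F.leg_keeps hoff hi hwX he'.2.1 (he1'.trans hti.symm)).trans he1'
  have hec'' : c' e'' = ty k := (F.leg_keeps hoff hk hw' he''.2.2 he1'').trans he1''
  have m4 : Misses inc c' w (ty k) := hb.misses_other_end F.cubic hfv b1 (k := 1) (m := m)
    (by decide) hm0 htk0 hm1.symm htk.symm hmk m1 he'.2.1 hec'
  obtain ⟨n1, n2, n3⟩ := F.leg_ne_of_adj hi hti hf hfv he he1 he' he1'
  refine hb.not_two_chains F.cubic hfv b1 one_ne_zero hm0 htk0
    (kempeClosed_pair F.cubic hb.1 one_ne_zero he hec m1 m2)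
    (kempeClosed_triple F.cubic hb.1 one_ne_zero htk0 he' hec' he'' hec'' m4 m3) (by simp)
    (by simp) ?_ m1 m4
  rintro x (rfl | rfl) (h | h | h)
  · exact hfv.1 h
  · exact n2 h.symm
  · exact hik (F.eq_of_mem hi hk hvX (h ▸ hw'))
  · exact n1 h
  · exact n3 h
  · exact hjk (F.eq_of_mem hj hk hv' (h ▸ hw'))

/-- Both chains have two edges, one in the colours 1 and `ty j`, the other in 1 and `ty k`. The
types must differ because `v` and `w` miss different colours. -/
theorem not_cross_cross [Finite E] (F : Frame inc c ty) {i j k f e₁ e₂ e₁' e₂' : E} (hi : c i = 0)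
    (hti : ty i = 1) (hf : f ∈ cyc inc c (ty i) i) {v w u v' u' w' : V} (hfv : Joins inc f v w)
    (htjk : ty j ≠ ty k) (h1 : Cross inc c ty j e₁ e₂ v u v')
    (h2 : Cross inc c ty k e₁' e₂' w u' w') : False := by
  obtain ⟨hj, htj, he, he1, heo, heo1, hv'⟩ := h1
  obtain ⟨hk, htk, he', he1', heo', heo1', hw'⟩ := h2
  have hik : i ≠ k := by rintro rfl; exact htk hti
  have hij : i ≠ j := by rintro rfl; exact htj hti
  have hjk : j ≠ k := by rintro rfl; exact htjk rfl
  obtain ⟨g, hg, hgv⟩ := id hv'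
  obtain ⟨g', hg', hgw⟩ := id hw'
  have hvX : v ∈ cycVerts inc c (ty i) i := ⟨f, hf, hfv.2.1⟩
  have hwX : w ∈ cycVerts inc c (ty i) i := ⟨f, hf, hfv.2.2⟩
  have htk0 : ty k ≠ 0 := (F.type k hk).1
  have htj0 : ty j ≠ 0 := (F.type j hj).1
  obtain ⟨c', hb, b1, b2, b3, m1, m2, m3, hoff⟩ := F.realize_three hij hik hjk
    (s₁ := (f, v, ty j)) (s₂ := (g, v', 1)) (s₃ := (g', w', 1))
    ⟨hf, hfv.2.1, htj0, by rw [hti]; exact htj⟩ ⟨hg, hgv, one_ne_zero, htj.symm⟩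
    ⟨hg', hgw, one_ne_zero, htk.symm⟩ hi hj hk
  dsimp only at b1 b2 b3 m1 m2 m3
  have hec : c' e₁ = 1 := (F.leg_keeps hoff hi hvX he.2.1 (he1.trans hti.symm)).trans he1
  have hec' : c' e₁' = 1 := (F.leg_keeps hoff hi hwX he'.2.1 (he1'.trans hti.symm)).trans he1'
  have heoc : c' e₂ = ty j := (F.leg_keeps hoff hj hv' heo.2.2 heo1).trans heo1
  have heoc' : c' e₂' = ty k := (F.leg_keeps hoff hk hw' heo'.2.2 heo1').trans heo1'
  have m4 : Misses inc c' w (ty k) := hb.misses_other_end F.cubic hfv b1 (k := 1) (m := ty j)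
    (by decide) htj0 htk0 htj.symm htk.symm htjk m1 he'.2.1 hec'
  obtain ⟨n1, n2, n3⟩ := F.leg_ne_of_adj hi hti hf hfv he he1 he' he1'
  refine hb.not_two_chains F.cubic hfv b1 one_ne_zero htj0 htk0
    (kempeClosed_triple F.cubic hb.1 one_ne_zero htj0 he hec heo heoc m1 m2)
    (kempeClosed_triple F.cubic hb.1 one_ne_zero htk0 he' hec' heo' heoc' m4 m3) (by simp)
    (by simp) ?_ m1 m4
  rintro x (rfl | rfl | rfl) (h | h | h)
  · exact hfv.1 h
  · exact n2 h.symm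
  · exact hik (F.eq_of_mem hi hk hvX (h ▸ hw'))
  · exact n1 h
  · exact n3 h
  -- Were the middle vertex of one chain the end of the other, its edge of colour `ty j` would lie
  -- on the cycle of `k`, and the cycles of `j` and `k` would meet.
  · have hx : x ∈ cycVerts inc c (ty k) k := h ▸ hw'
    have : e₂ ∈ cyc inc c (ty k) k := mem_cyc_of_mem_cycVerts hx heo.2.1 (heo1 ▸ htjk)
    exact hjk (F.eq_of_mem hj hk hv' ⟨e₂, this, heo.2.2⟩)
  · exact hij (F.eq_of_mem hi hj hwX (h ▸ hv'))
  · have hx : u' ∈ cycVerts inc c (ty j) j := h ▸ hv'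
    have : e₂' ∈ cyc inc c (ty j) j := mem_cyc_of_mem_cycVerts hx heo'.2.1 (heo1' ▸ htjk.symm)
    exact hjk (F.eq_of_mem hj hk ⟨e₂', this, heo'.2.2⟩ hw')
  · exact hjk (F.eq_of_mem hj hk hv' (h ▸ hw'))

end Frame

/-! ### Windows on the cycles -/

/-- The vertices `v` and `w` are consecutive on the cycle of `i`. -/
def CycAdj (inc : E → V → Prop) (c ty : E → Fin 4) (i : E) (v w : V) : Prop :=
  ∃ f ∈ cyc inc c (ty i) i, Joins inc f v w

theorem CycAdj.symm {inc : E → V → Prop} {c ty : E → Fin 4} {i : E} {v w : V}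
    (h : CycAdj inc c ty i v w) : CycAdj inc c ty i w v := by
  obtain ⟨f, hf, hj⟩ := h
  exact ⟨f, hf, hj.symm⟩

theorem CycAdj.left_mem {inc : E → V → Prop} {c ty : E → Fin 4} {i : E} {v w : V}
    (h : CycAdj inc c ty i v w) : v ∈ cycVerts inc c (ty i) i := by
  obtain ⟨f, hf, hj⟩ := h
  exact ⟨f, hf, hj.2.1⟩

theorem CycAdj.right_mem {inc : E → V → Prop} {c ty : E → Fin 4} {i : E} {v w : V}
    (h : CycAdj inc c ty i v w) : w ∈ cycVerts inc c (ty i) i := h.symm.left_mem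

/-- There are no triangles. -/
def NoTriangle (inc : E → V → Prop) : Prop :=
  ∀ e f g x y z, Joins inc e x y → Joins inc f y z → ¬ Joins inc g z x

/-- There are no cycles of length four. -/
def NoSquare (inc : E → V → Prop) : Prop :=
  ∀ e f g h x y z w, Joins inc e x y → Joins inc f y z → Joins inc g z w → x ≠ z → y ≠ w →
    ¬ Joins inc h w x

/-- A path of length three together with a sign. -/
structure Window (V : Type u) (E : Type v) where
  o : V
  s : V
  t : V
  r : V
  h : E
  f : E
  k : E
  sign : Bool

/-- The window is a path on the cycle of `i`. -/
structure IsWindow (inc : E → V → Prop) (c ty : E → Fin 4) (i : E) (w : Window V E) : Prop where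
  h_mem : w.h ∈ cyc inc c (ty i) i
  f_mem : w.f ∈ cyc inc c (ty i) i
  k_mem : w.k ∈ cyc inc c (ty i) i
  joins_h : Joins inc w.h w.o w.s
  joins_f : Joins inc w.f w.s w.t
  joins_k : Joins inc w.k w.t w.r
  o_ne_t : w.o ≠ w.t
  s_ne_r : w.s ≠ w.r

/-- The edge `e` of colour `ty i` meets the first half of the window. -/
def Strong (inc : E → V → Prop) (c ty : E → Fin 4) (w : Window V E) (i e : E) : Prop :=
  c e = ty i ∧ (inc e w.o ∨ inc e w.s)

/-- The edge `e` of colour `ty i` meets the second half of the window. -/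
def Weak (inc : E → V → Prop) (c ty : E → Fin 4) (w : Window V E) (i e : E) : Prop :=
  c e = ty i ∧ (inc e w.t ∨ inc e w.r)

namespace Frame

variable {inc : E → V → Prop} {c ty : E → Fin 4}

theorem exists_leg [Finite E] (F : Frame inc c ty) {i : E} (hi : c i = 0) {v : V}
    (hv : v ∈ cycVerts inc c (ty i) i) : ∃ e, inc e v ∧ c e = ty i :=
  F.best.sees_of_mem_cycVerts F.cubic F.simple hi (F.type i hi) hv

theorem exists_next [Finite E] (F : Frame inc c ty) {i f : E} (hi : c i = 0)
    (hf : f ∈ cyc inc c (ty i) i) {v : V} (hfv : inc f v) :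
    ∃ e g, g ∈ cyc inc c (ty i) i ∧ g ≠ f ∧ e ≠ f ∧ e ≠ g ∧ inc g v ∧ inc e v ∧ c e = ty i ∧
      ∀ x, inc x v → x = e ∨ x = f ∨ x = g := by
  obtain ⟨e, hev, hec⟩ := F.exists_leg hi ⟨f, hf, hfv⟩
  have hfc := ne_of_mem_cyc (F.blank_ne hi) hf
  have hef : e ≠ f := by rintro rfl; exact hfc hec
  obtain ⟨g, hge, hgf, hgv, hall⟩ := F.cubic.exists_third hev hfv hef
  refine ⟨e, g, mem_cyc_of_adj hf hfv hgv fun hh => hge ?_, hgf, hef, hge.symm, hgv, hev, hec,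
    hall⟩
  exact F.best.1 v g e hgv hev (hh.trans hec.symm) (hh ▸ (F.type i hi).1)

theorem exists_cycAdj [Finite E] (F : Frame inc c ty) {i : E} (hi : c i = 0) {u v : V}
    (h : CycAdj inc c ty i u v) : ∃ w, w ≠ u ∧ CycAdj inc c ty i v w := by
  obtain ⟨f, hf, hj⟩ := h
  obtain ⟨-, g, hg, hgf, -, -, hgv, -⟩ := F.exists_next hi hf hj.2.2
  obtain ⟨w, hw⟩ := F.cubic.exists_joins hgv
  refine ⟨w, ?_, g, hg, hw⟩
  rintro rfl
  exact hgf (F.simple g f _ _ hw hj.symm)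

/-- The vertices of an odd cycle are not alternately in and out of a set. -/
theorem exists_cycAdj_notMem [Finite E] [Finite V] (F : Frame inc c ty) {i : E} (hi : c i = 0)
    (B : V → Prop) (hB : ∀ v w, CycAdj inc c ty i v w → B v → ¬ B w) :
    ∃ v w, CycAdj inc c ty i v w ∧ ¬ B v ∧ ¬ B w := by
  by_contra hcon
  push Not at hcon
  have hiff : ∀ v w, CycAdj inc c ty i v w → (B w ↔ ¬ B v) := fun v w h =>
    ⟨fun hw hv => hB v w h hv hw, fun hv => hcon v w h hv⟩
  have htype := F.type i hi
  have : ∃ x y, Joins inc i x y ∧ B x := by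
    obtain ⟨x, y, hxy, hw⟩ := F.cubic.ends i
    have hj : Joins inc i x y := ⟨hxy, (hw x).2 (Or.inl rfl), (hw y).2 (Or.inr rfl)⟩
    by_cases hx : B x
    · exact ⟨x, y, hj, hx⟩
    · exact ⟨y, x, hj.symm, (hiff x y ⟨i, self_mem_cyc, hj⟩).2 hx⟩
  obtain ⟨x, y, hj, hx⟩ := this
  have hxy : CycAdj inc c ty i x y := ⟨i, self_mem_cyc, hj⟩
  have hy : ¬ B y := fun h => (hiff x y hxy).1 h hx
  have hmatch : ∀ e v, inc e v → inc i v → c e = 0 → e = i := fun e v he hv h0 =>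
    F.best.blank_matching F.cubic he hv h0 hi
  obtain ⟨e, g, hg, hgi, hei, heg, hgx, hex, hec, hall⟩ :=
    F.exists_next hi self_mem_cyc hj.2.1
  have hgk := ne_of_mem_cyc (F.blank_ne hi) hg
  have hg0 : c g ≠ 0 := fun h0 => hgi (hmatch g x hgx hj.2.1 h0)
  have hfin : ∀ a b : Fin 4, ∃ n, n ≠ 0 ∧ n ≠ a ∧ n ≠ b := by decide
  obtain ⟨m, hm0, hmk, hmg⟩ := hfin (ty i) (c g)
  have hxm : Misses inc c x m := by
    intro z hz
    rcases hall z hz with rfl | rfl | rfl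
    · exact hec ▸ hmk.symm
    · exact hi ▸ hm0.symm
    · exact hmg.symm
  obtain ⟨ey, hey, heyc⟩ := htype.2 y hj.2.2
  have hyn : Misses inc c y (c g) := F.best.misses_other_end F.cubic hj hi htype.1 hm0 hg0
    hmk.symm hgk.symm hmg hxm hey heyc
  -- Away from the ends of `i`, every vertex of the cycle sees all three colours.
  have hsee : ∀ v ∈ cycVerts inc c (ty i) i, ∀ n, n ≠ 0 → Misses inc c v n → v = x ∨ v = y := by
    rintro v ⟨f, hf, hfv⟩ n hn0 hmiss
    by_contra hne
    have hvi : ¬ inc i v := fun h => hne (F.cubic.eq_or_eq hj h)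
    obtain ⟨e', g', hg', hgf, hef, heg', hgv, hev, hec', hall'⟩ := F.exists_next hi hf hfv
    have hz : ∀ z ∈ cyc inc c (ty i) i, inc z v → c z ≠ 0 := fun z hz hzv h0 => by
      have := F.best.eq_of_mem_cyc F.cubic F.simple hi htype hz h0
      exact hvi (this ▸ hzv)
    have h1 := ne_of_mem_cyc (F.blank_ne hi) hf
    have h2 := ne_of_mem_cyc (F.blank_ne hi) hg'
    have h3 := hz f hf hfv
    have h4 := hz g' hg' hgv
    have h5 : c f ≠ c g' := fun hh => hgf (F.best.1 v _ _ hgv hfv hh.symm h4)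
    have h6 := hmiss f hfv
    have h7 := hmiss g' hgv
    have h8 := hec' ▸ hmiss e' hev
    have hfin' : ∀ a b d n : Fin 4, a ≠ 0 → b ≠ 0 → d ≠ 0 → a ≠ b → a ≠ d → b ≠ d → n ≠ 0 →
      a = n ∨ b = n ∨ d = n := by decide
    rcases hfin' _ _ _ n h3 h4 htype.1 h5 h1 h2 hn0 with h | h | h
    · exact h6 h
    · exact h7 h
    · exact h8 h
  have hym : ¬ Misses inc c y m := fun h =>
    F.best.not_misses_both F.cubic hj hi hm0 hxm h
  have hxg : ¬ Misses inc c x (c g) := fun h => h g hgx rfl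
  have hpart : ∀ v ∈ cycVerts inc c (ty i) i, ∀ n, n ≠ 0 → n ≠ ty i → ¬ Misses inc c v n →
      CycAdj inc c ty i v (partner inc c n v) ∧ ¬ Misses inc c (partner inc c n v) n := by
    intro v hv n hn0 hnk hmiss
    simp only [Misses] at hmiss
    push Not at hmiss
    obtain ⟨z, hzv, hzn⟩ := hmiss
    obtain ⟨w, hw⟩ := F.cubic.exists_joins hzv
    rw [partner_eq F.cubic F.best.1 hn0 hw hzn]
    exact ⟨⟨z, mem_cyc_of_mem_cycVerts hv hzv (hzn ▸ hnk), hw⟩, fun h => h z hw.2.2 hzn⟩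
  set X := cycVerts inc c (ty i) i with hX
  set P : Set V := {v | v ∈ X ∧ B v} with hP
  set N : Set V := {v | v ∈ X ∧ ¬ B v} with hN
  have hxX : x ∈ X := hxy.left_mem
  have hyX : y ∈ X := hxy.right_mem
  -- If `B` alternated, the edges of colour `m` would match `N` into `P` without `x`, and those of
  -- colour `c g` would match `P` into `N` without `y`. Both inclusions are strict, which is
  -- impossible.
  have le1 : N.ncard ≤ (P \ {x}).ncard := by
    refine Set.ncard_le_ncard_of_injOn (partner inc c m) ?_
      (partner_involutive F.cubic F.best.1 hm0).injective.injOn (Set.toFinite _)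
    rintro v ⟨hvX, hvB⟩
    have hs : ¬ Misses inc c v m := fun h => by
      rcases hsee v hvX m hm0 h with rfl | rfl
      · exact hvB hx
      · exact hym h
    obtain ⟨h1, h2⟩ := hpart v hvX m hm0 hmk hs
    refine ⟨⟨h1.right_mem, (hiff _ _ h1).2 hvB⟩, fun h => h2 ?_⟩
    rw [Set.mem_singleton_iff.1 h]
    exact hxm
  have le2 : P.ncard ≤ (N \ {y}).ncard := by
    refine Set.ncard_le_ncard_of_injOn (partner inc c (c g)) ?_
      (partner_involutive F.cubic F.best.1 hg0).injective.injOn (Set.toFinite _)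
    rintro v ⟨hvX, hvB⟩
    have hs : ¬ Misses inc c v (c g) := fun h => by
      rcases hsee v hvX _ hg0 h with rfl | rfl
      · exact hxg h
      · exact hy hvB
    obtain ⟨h1, h2⟩ := hpart v hvX _ hg0 hgk hs
    refine ⟨⟨h1.right_mem, fun h => (hiff _ _ h1).1 h hvB⟩, fun h => h2 ?_⟩
    rw [Set.mem_singleton_iff.1 h]
    exact hyn
  have lt1 := Set.ncard_sdiff_singleton_lt_of_mem (show x ∈ P from ⟨hxX, hx⟩) (Set.toFinite _)
  have lt2 := Set.ncard_sdiff_singleton_lt_of_mem (show y ∈ N from ⟨hyX, hy⟩) (Set.toFinite _)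
  omega

/-- A path with three edges on the cycle of `i` is a window. -/
theorem exists_isWindow {i : E} {o s t r : V} (h1 : CycAdj inc c ty i o s)
    (h2 : CycAdj inc c ty i s t) (h3 : CycAdj inc c ty i t r) (hot : o ≠ t) (hsr : s ≠ r)
    (σ : Bool) : ∃ w : Window V E, IsWindow inc c ty i w ∧ w.o = o ∧ w.s = s ∧ w.t = t ∧
      w.r = r ∧ w.sign = σ := by
  obtain ⟨h, hh, jh⟩ := h1
  obtain ⟨f, hf, jf⟩ := h2
  obtain ⟨k, hk, jk⟩ := h3
  exact ⟨⟨o, s, t, r, h, f, k, σ⟩, ⟨hh, hf, hk, jh, jf, jk, hot, hsr⟩, rfl, rfl, rfl, rfl, rfl⟩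

theorem exists_some_window [Finite E] (F : Frame inc c ty) {i : E} (hi : c i = 0) :
    ∃ w : Window V E, IsWindow inc c ty i w := by
  obtain ⟨x, y, hxy, hw⟩ := F.cubic.ends i
  have h1 : CycAdj inc c ty i x y :=
    ⟨i, self_mem_cyc, hxy, (hw x).2 (Or.inl rfl), (hw y).2 (Or.inr rfl)⟩
  obtain ⟨z, hz, h2⟩ := F.exists_cycAdj hi h1
  obtain ⟨t, ht, h3⟩ := F.exists_cycAdj hi h2
  obtain ⟨w, hw, -⟩ := exists_isWindow h1 h2 h3 hz.symm ht.symm true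
  exact ⟨w, hw⟩

end Frame

/-! ### Choosing windows with compatible signs -/

/-- The combinatorial core of the choice of a window: `S τ` and `W τ` are the restrictions on the
vertices of a cycle that come from the windows chosen before. -/
theorem exists_good_path {A : V → V → Prop} (hsymm : ∀ v w, A v w → A w v)
    (hnext : ∀ u v, A u v → ∃ w, w ≠ u ∧ A v w) (S W : Bool → V → Prop)
    (hodd : ∀ B : V → Prop, (∀ v w, A v w → B v → ¬ B w) → ∃ v w, A v w ∧ ¬ B v ∧ ¬ B w)
    (a0 : ∀ v τ, S τ v → ¬ S (!τ) v) (a1 : ∀ v w τ τ', A v w → S τ v → ¬ S τ' w)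
    (a2 : ∀ v w τ, A v w → S τ v → ¬ W (!τ) w)
    (a3 : ∀ v w τ, A v w → W τ v → ¬ W (!τ) w) (a5 : ∀ v w τ, A v w → S τ v → ¬ W τ v) :
    ∃ o s t r σ, A o s ∧ A s t ∧ A t r ∧ o ≠ t ∧ s ≠ r ∧ ¬ S (!σ) o ∧ ¬ S (!σ) s ∧ ¬ W σ o ∧
      ¬ W σ s ∧ ¬ S σ t ∧ ¬ S σ r := by
  -- Next to an `S`-vertex followed by two vertices free of `S`, a window starts at the `S`-vertex
  -- with sign `τ`, unless `W (!τ)` is absent at `w`; then the reversed window with sign `!τ` is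
  -- used.
  have main : ∀ τ s v w, S τ s → A s v → A v w → s ≠ w → (∀ τ, ¬ S τ v) → (∀ τ, ¬ S τ w) →
      ∃ o s t r σ, A o s ∧ A s t ∧ A t r ∧ o ≠ t ∧ s ≠ r ∧ ¬ S (!σ) o ∧ ¬ S (!σ) s ∧ ¬ W σ o ∧
        ¬ W σ s ∧ ¬ S σ t ∧ ¬ S σ r := by
    intro τ s v w hs hsv hvw hsw hv hw
    by_cases hW : W (!τ) w
    · obtain ⟨w2, hw2, hA⟩ := hnext _ _ hvw
      refine ⟨s, v, w, w2, τ, hsv, hvw, hA, hsw, hw2.symm, a0 _ _ hs, hv _, a5 _ _ _ hsv hs, ?_,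
        hw _, ?_⟩
      · intro h
        exact a3 _ _ _ hvw h hW
      · intro h
        exact a2 _ _ _ (hsymm _ _ hA) h hW
    · obtain ⟨p, hp, hA⟩ := hnext _ _ (hsymm _ _ hsv)
      exact ⟨w, v, s, p, !τ, hsymm _ _ hvw, hsymm _ _ hsv, hA, hsw.symm, hp.symm, hw _, hv _, hW,
        a2 _ _ _ hsv hs, a0 _ _ hs, a1 _ _ _ _ hA hs⟩
  -- A vertex is bad if it carries an `S` or if both values of `W` hold there. Bad vertices are
  -- never consecutive, so oddness yields two consecutive good ones, from which the path is
  -- continued.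
  obtain ⟨v, w, hvw, hv, hw⟩ := hodd
    (fun v => (∃ τ, S τ v) ∨ (W true v ∧ W false v)) (by
      rintro v w hvw (⟨τ, hv⟩ | hv) (⟨τ', hw⟩ | hw)
      · exact a1 _ _ _ _ hvw hv hw
      · have := a2 _ _ _ hvw hv
        cases τ
        · exact this hw.1
        · exact this hw.2
      · have := a2 _ _ _ (hsymm _ _ hvw) hw
        cases τ'
        · exact this hv.1
        · exact this hv.2
      · exact a3 v w true hvw hv.1 hw.2)
  push Not at hv hw
  obtain ⟨a, haw, hva⟩ := hnext _ _ (hsymm _ _ hvw)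
  obtain ⟨b, hbv, hab⟩ := hnext _ _ hva
  by_cases ha : ∃ τ, S τ a
  · obtain ⟨τ, ha⟩ := ha
    exact main τ a v w ha (hsymm _ _ hva) hvw haw hv.1 hw.1
  push Not at ha
  by_cases hb : ∃ τ, S τ b
  · obtain ⟨τ, hb⟩ := hb
    exact main τ b a v hb (hsymm _ _ hab) (hsymm _ _ hva) hbv ha hv.1
  push Not at hb
  -- With no `S` on the four vertices, only `W` on the first half matters. Each vertex has at most
  -- one forbidden sign, and by `a3` consecutive vertices do not have opposite ones.
  have : ∃ σ, ¬ W σ v ∧ ¬ W σ w := by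
    by_cases h1 : W true v
    · exact ⟨false, hv.2 h1, a3 v w true hvw h1⟩
    · by_cases h2 : W true w
      · exact ⟨false, a3 w v true (hsymm _ _ hvw) h2, hw.2 h2⟩
      · exact ⟨true, h1, h2⟩
  obtain ⟨σ, h1, h2⟩ := this
  exact ⟨w, v, a, b, σ, hsymm _ _ hvw, hva, hab, haw.symm, hbv.symm, hw.1 _, hv.1 _, h2, h1, ha _,
    hb _⟩

theorem IsWindow.o_mem {inc : E → V → Prop} {c ty : E → Fin 4} {i : E} {w : Window V E}
    (h : IsWindow inc c ty i w) : w.o ∈ cycVerts inc c (ty i) i := ⟨w.h, h.h_mem, h.joins_h.2.1⟩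

theorem IsWindow.s_mem {inc : E → V → Prop} {c ty : E → Fin 4} {i : E} {w : Window V E}
    (h : IsWindow inc c ty i w) : w.s ∈ cycVerts inc c (ty i) i := ⟨w.h, h.h_mem, h.joins_h.2.2⟩

theorem IsWindow.t_mem {inc : E → V → Prop} {c ty : E → Fin 4} {i : E} {w : Window V E}
    (h : IsWindow inc c ty i w) : w.t ∈ cycVerts inc c (ty i) i := ⟨w.k, h.k_mem, h.joins_k.2.1⟩

theorem IsWindow.r_mem {inc : E → V → Prop} {c ty : E → Fin 4} {i : E} {w : Window V E}
    (h : IsWindow inc c ty i w) : w.r ∈ cycVerts inc c (ty i) i := ⟨w.k, h.k_mem, h.joins_k.2.2⟩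

/-- In the absence of short cycles, no edge is both strong and weak for the same window. -/
theorem IsWindow.not_weak {inc : E → V → Prop} {c ty : E → Fin 4} {i : E} {w : Window V E}
    (h : IsWindow inc c ty i w) (hs : NoDigon inc) (ht : NoTriangle inc)
    (hq : NoSquare inc) (hi : c i ≠ ty i) {e : E} (h1 : Strong inc c ty w i e) :
    ¬ Weak inc c ty w i e := by
  intro h2
  have hne : ∀ f ∈ cyc inc c (ty i) i, e ≠ f := by
    rintro f hf rfl
    exact ne_of_mem_cyc hi hf h1.1
  have hor : w.o ≠ w.r := by
    intro hh
    refine ht _ _ w.k _ _ _ h.joins_h h.joins_f ?_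
    rw [hh]
    exact h.joins_k
  rcases h1.2 with ho | hss <;> rcases h2.2 with hh | hh
  · exact ht _ _ e _ _ _ h.joins_h h.joins_f ⟨h.o_ne_t.symm, hh, ho⟩
  · exact hq _ _ _ e _ _ _ _ h.joins_h h.joins_f h.joins_k h.o_ne_t h.s_ne_r
      ⟨hor.symm, hh, ho⟩
  · exact hne _ h.f_mem (hs _ _ _ _ ⟨h.joins_f.1, hss, hh⟩ h.joins_f)
  · exact ht _ _ e _ _ _ h.joins_f h.joins_k ⟨h.s_ne_r.symm, hh, hss⟩

namespace Frame

variable {inc : E → V → Prop} {c ty : E → Fin 4}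

theorem link_of_inc [Finite E] (F : Frame inc c ty) {i j e : E} (hi : c i = 0) (hj : c j = 0)
    (htj : ty j = 1) (hij : i ≠ j) {v v' : V} (hv : v ∈ cycVerts inc c (ty i) i)
    (hv' : v' ∈ cycVerts inc c (ty j) j) (he : inc e v) (he' : inc e v') (hec : c e = ty j) :
    Link inc c ty j e v v' :=
  ⟨hj, htj, ⟨fun h => hij (F.eq_of_mem hi hj hv (h ▸ hv')), he, he'⟩, hec.trans htj, hv'⟩

theorem link_of_strong [Finite E] (F : Frame inc c ty) {i j e : E} (hi : c i = 0) (hj : c j = 0)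
    (htj : ty j = 1) (hij : i ≠ j) {v : V} {w : Window V E} (hw : IsWindow inc c ty j w)
    (hv : v ∈ cycVerts inc c (ty i) i) (he : inc e v) (hs : Strong inc c ty w j e) :
    ∃ v', (v' = w.o ∨ v' = w.s) ∧ Link inc c ty j e v v' := by
  rcases hs.2 with h | h
  · exact ⟨_, Or.inl rfl, F.link_of_inc hi hj htj hij hv hw.o_mem he h hs.1⟩
  · exact ⟨_, Or.inr rfl, F.link_of_inc hi hj htj hij hv hw.s_mem he h hs.1⟩

theorem link_of_weak [Finite E] (F : Frame inc c ty) {i j e : E} (hi : c i = 0) (hj : c j = 0)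
    (htj : ty j = 1) (hij : i ≠ j) {v : V} {w : Window V E} (hw : IsWindow inc c ty j w)
    (hv : v ∈ cycVerts inc c (ty i) i) (he : inc e v) (hs : Weak inc c ty w j e) :
    ∃ v', Link inc c ty j e v v' := by
  rcases hs.2 with h | h
  · exact ⟨_, F.link_of_inc hi hj htj hij hv hw.t_mem he h hs.1⟩
  · exact ⟨_, F.link_of_inc hi hj htj hij hv hw.r_mem he h hs.1⟩

theorem link_unique [Finite E] (F : Frame inc c ty) {j j' e e' : E} {v v' v'' : V}
    (h : Link inc c ty j e v v') (h' : Link inc c ty j' e' v v'') : j = j' ∧ e = e' := by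
  obtain ⟨hj, -, he, he1, hm⟩ := h
  obtain ⟨hj', -, he', he1', hm'⟩ := h'
  have : e = e' := F.best.1 v e e' he.2.1 he'.2.1 (he1.trans he1'.symm)
    (by rw [he1]; exact one_ne_zero)
  subst this
  have := F.cubic.joins_right_unique he he'
  subst this
  exact ⟨F.eq_of_mem hj hj' hm hm', rfl⟩

theorem cross_of_strong [Finite E] (F : Frame inc c ty) {i k e e' : E} (hi : c i = 0)
    (hti : ty i = 1) (hk : c k = 0) (htk : ty k ≠ 1) {v u : V} {w : Window V E}
    (hw : IsWindow inc c ty k w) (hv : v ∈ cycVerts inc c (ty i) i) (he : Joins inc e v u)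
    (hec : c e = 1) (hu : inc e' u) (hs : Strong inc c ty w k e') :
    ∃ v', Cross inc c ty k e e' v u v' := by
  have hik : i ≠ k := by rintro rfl; exact htk hti
  have hne : u ∉ cycVerts inc c (ty k) k := fun h =>
    hik (F.eq_of_mem hi hk hv ⟨e, mem_cyc_of_mem_cycVerts h he.2.2 (hec ▸ htk.symm), he.2.1⟩)
  rcases hs.2 with h | h
  · exact ⟨_, hk, htk, he, hec, ⟨fun hh => hne (hh ▸ hw.o_mem), hu, h⟩, hs.1, hw.o_mem⟩
  · exact ⟨_, hk, htk, he, hec, ⟨fun hh => hne (hh ▸ hw.s_mem), hu, h⟩, hs.1, hw.s_mem⟩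

/-- The end of the leg would lie on the cycle of `j` and, through its edge of colour `ty k`, also on
that of `k`. -/
theorem link_not_cross [Finite E] (F : Frame inc c ty) {j k e e' e'' : E} {v v' u w' : V}
    (h : Link inc c ty j e v v') (h' : Cross inc c ty k e' e'' v u w') : False := by
  obtain ⟨hj, htj, he, he1, hm⟩ := h
  obtain ⟨hk, htk, he', he1', he'', he1'', hm'⟩ := h'
  have : e = e' := F.best.1 v e e' he.2.1 he'.2.1 (he1.trans he1'.symm)
    (by rw [he1]; exact one_ne_zero)
  subst this
  have := F.cubic.joins_right_unique he he'
  subst this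
  have hjk : j ≠ k := by rintro rfl; exact htk htj
  refine hjk (F.eq_of_mem hj hk ⟨e'', ?_, he''.2.2⟩ hm')
  exact mem_cyc_of_mem_cycVerts hm he''.2.1 (by rw [he1'', htj]; exact htk)

/-- A system of windows whose signs are compatible for the cycles in `T`. -/
structure Compatible (inc : E → V → Prop) (c ty : E → Fin 4) (win : E → Window V E)
    (T : E → Prop) : Prop where
  window : ∀ d, c d = 0 → IsWindow inc c ty d (win d)
  weak : ∀ i j e, T i → T j → Strong inc c ty (win i) i e → Weak inc c ty (win j) j e →
    (win i).sign ≠ (win j).sign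
  strong : ∀ i j e, T i → T j → Strong inc c ty (win i) i e → Strong inc c ty (win j) j e →
    (win i).sign = (win j).sign
  cross : ∀ i k e e' v, T i → c k = 0 → ty k ≠ 1 → Strong inc c ty (win i) i e → inc e v →
    Strong inc c ty (win k) k e' → inc e' v →
    (ty k = 2 → (win i).sign = false) ∧ (ty k = 3 → (win i).sign = true)

-- The earlier choices are recorded as conditions `S` and `W` on the vertices of the new cycle. The
-- excluded configurations give the hypotheses of `exists_good_path`, and its conclusion is exactly
-- what compatibility with the earlier windows asks.
open Classical in
theorem Compatible.insert [Finite E] [Finite V] (F : Frame inc c ty) (ht : NoTriangle inc)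
    (hq : NoSquare inc) {win : E → Window V E} {T : E → Prop}
    (hT : ∀ i, T i → c i = 0 ∧ ty i = 1) (h : Compatible inc c ty win T) {i : E} (hi : c i = 0)
    (hti : ty i = 1) (hiT : ¬ T i) :
    ∃ w, Compatible inc c ty (Function.update win i w) (fun j => j = i ∨ T j) := by
  let X := cycVerts inc c (ty i) i
  let S : Bool → V → Prop := fun τ v => v ∈ X ∧ ∃ j e, T j ∧ inc e v ∧
    Strong inc c ty (win j) j e ∧ (win j).sign = τ
  -- `W τ v` means that a strong leg at `v` must not have sign `τ`. Besides weak legs of earlier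
  -- windows this covers strong legs of types 2 and 3 at the far end: their values 3 and 8 are only
  -- two away from 1 (sign `true`) and 10 (sign `false`) respectively.
  let W : Bool → V → Prop := fun τ v => v ∈ X ∧
    ((∃ j e, T j ∧ inc e v ∧ Weak inc c ty (win j) j e ∧ (win j).sign = τ) ∨
      ∃ k e e' u, c k = 0 ∧ ty k = (if τ then 2 else 3) ∧ Joins inc e v u ∧ c e = 1 ∧
        inc e' u ∧ Strong inc c ty (win k) k e')
  have hij : ∀ j, T j → i ≠ j := by rintro j hj rfl; exact hiT hj
  have hSl : ∀ τ v, S τ v → ∃ j e v', T j ∧ Link inc c ty j e v v' ∧ (win j).sign = τ ∧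
      (v' = (win j).o ∨ v' = (win j).s) ∧ Strong inc c ty (win j) j e := by
    rintro τ v ⟨hv, j, e, hj, he, hs, hσ⟩
    obtain ⟨v', hv', hl⟩ := F.link_of_strong hi (hT j hj).1 (hT j hj).2 (hij j hj)
      (h.window j (hT j hj).1) hv he hs
    exact ⟨j, e, v', hj, hl, hσ, hv', hs⟩
  have hne1 : ∀ τ : Bool, (if τ then 2 else 3 : Fin 4) ≠ 1 := by decide
  have hneg : ∀ τ : Bool, (if τ then 2 else 3 : Fin 4) ≠ (if !τ then 2 else 3) := by decide
  have hWl : ∀ τ v, W τ v → (∃ j e v', T j ∧ Link inc c ty j e v v' ∧ (win j).sign = τ ∧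
      Weak inc c ty (win j) j e) ∨
      ∃ k e e' u v', ty k = (if τ then 2 else 3) ∧ Cross inc c ty k e e' v u v' := by
    rintro τ v ⟨hv, ⟨j, e, hj, he, hs, hσ⟩ | ⟨k, e, e', u, hk, htk, he, hec, hu, hs⟩⟩
    · obtain ⟨v', hl⟩ := F.link_of_weak hi (hT j hj).1 (hT j hj).2 (hij j hj)
        (h.window j (hT j hj).1) hv he hs
      exact Or.inl ⟨j, e, v', hj, hl, hσ, hs⟩
    · obtain ⟨v', hc⟩ := F.cross_of_strong hi hti hk (htk ▸ hne1 τ) (h.window k hk) hv he hec hu hs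
      exact Or.inr ⟨k, e, e', u, v', htk, hc⟩
  obtain ⟨o, s, t, r, σ, h1, h2, h3, hot, hsr, g1, g2, g3, g4, g5, g6⟩ :=
    exists_good_path (A := CycAdj inc c ty i) (fun v w h => h.symm)
    (fun u v h => F.exists_cycAdj hi h) S W (F.exists_cycAdj_notMem hi) (by
      intro v τ hv hw
      obtain ⟨j, e, v', hj, hl, hσ, -⟩ := hSl _ _ hv
      obtain ⟨j', e', w', hj', hl', hσ', -⟩ := hSl _ _ hw
      obtain ⟨rfl, -⟩ := F.link_unique hl hl'
      rw [hσ] at hσ'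
      cases τ <;> simp at hσ') (by
      rintro v w τ τ' ⟨f, hf, hvw⟩ hv hw
      obtain ⟨j, e, v', hj, hl, hσ, hv', -⟩ := hSl _ _ hv
      obtain ⟨j', e', w', hj', hl', hσ', hw', -⟩ := hSl _ _ hw
      by_cases hjj : j = j'
      · subst hjj
        have hwin := h.window j (hT j hj).1
        have hne : v' ≠ w' := (F.leg_ne_of_adj hi hti hf hvw hl.2.2.1 hl.2.2.2.1 hl'.2.2.1
          hl'.2.2.2.1).2.2
        have hadj : Joins inc (win j).h v' w' := by
          rcases hv' with rfl | rfl <;> rcases hw' with rfl | rfl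
          · exact absurd rfl hne
          · exact hwin.joins_h
          · exact hwin.joins_h.symm
          · exact absurd rfl hne
        exact F.not_link_link_adj hi hti hf hvw (hij j hj) hl hl' hwin.h_mem hadj
      · exact F.not_link_link hi hti hf hvw (hij j hj) (hij j' hj') hjj hl hl') (by
      rintro v w τ ⟨f, hf, hvw⟩ hv hw
      obtain ⟨j, e, v', hj, hl, hσ, -⟩ := hSl _ _ hv
      rcases hWl _ _ hw with ⟨j', e', w', hj', hl', hσ', -⟩ | ⟨k, e', e'', u, w', htk, hl'⟩
      · refine F.not_link_link hi hti hf hvw (hij j hj) (hij j' hj') ?_ hl hl'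
        rintro rfl
        rw [hσ] at hσ'
        cases τ <;> simp at hσ'
      · exact F.not_link_cross hi hti hf hvw (hij j hj) hl hl') (by
      rintro v w τ ⟨f, hf, hvw⟩ hv hw
      rcases hWl _ _ hv with ⟨j, e, v', hj, hl, hσ, -⟩ | ⟨k, e, ee, u, v', htk, hl⟩ <;>
      rcases hWl _ _ hw with ⟨j', e', w', hj', hl', hσ', -⟩ | ⟨k', e', ee', u', w', htk', hl'⟩
      · refine F.not_link_link hi hti hf hvw (hij j hj) (hij j' hj') ?_ hl hl'
        rintro rfl
        rw [hσ] at hσ'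
        cases τ <;> simp at hσ'
      · exact F.not_link_cross hi hti hf hvw (hij j hj) hl hl'
      · exact F.not_link_cross hi hti hf hvw.symm (hij j' hj') hl' hl
      · refine F.not_cross_cross hi hti hf hvw ?_ hl hl'
        rw [htk, htk']
        exact hneg τ) (by
      rintro v w τ - hv hw
      obtain ⟨j, e, v', hj, hl, hσ, -, hs⟩ := hSl _ _ hv
      rcases hWl _ _ hw with ⟨j', e', w', hj', hl', hσ', hs'⟩ | ⟨k, e', e'', u, w', htk, hl'⟩
      · obtain ⟨rfl, rfl⟩ := F.link_unique hl hl'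
        exact (h.window j (hT j hj).1).not_weak F.simple ht hq
          (F.blank_ne (hT j hj).1) hs hs'
      · exact F.link_not_cross hl hl')
  obtain ⟨w, hw, rfl, rfl, rfl, rfl, rfl⟩ := exists_isWindow h1 h2 h3 hot hsr σ
  refine ⟨w, ?_, ?_, ?_, ?_⟩
  · intro d hd
    by_cases hdi : d = i
    · subst hdi
      rwa [Function.update_self]
    · rw [Function.update_of_ne hdi]
      exact h.window d hd
  · rintro j k e (rfl | hj) (rfl | hk) hs hwk
    · rw [Function.update_self] at hs hwk
      exact absurd hwk (hw.not_weak F.simple ht hq (F.blank_ne hi) hs)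
    · rw [Function.update_self] at hs ⊢
      rw [Function.update_of_ne (hij k hk).symm] at hwk ⊢
      intro hσ
      rcases hs.2 with ho | ho
      · exact g3 ⟨h1.left_mem, Or.inl ⟨k, e, hk, ho, hwk, hσ.symm⟩⟩
      · exact g4 ⟨h1.right_mem, Or.inl ⟨k, e, hk, ho, hwk, hσ.symm⟩⟩
    · rw [Function.update_self] at hwk ⊢
      rw [Function.update_of_ne (hij j hj).symm] at hs ⊢
      intro hσ
      rcases hwk.2 with ho | ho
      · exact g5 ⟨h2.right_mem, j, e, hj, ho, hs, hσ⟩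
      · exact g6 ⟨h3.right_mem, j, e, hj, ho, hs, hσ⟩
    · rw [Function.update_of_ne (hij j hj).symm] at hs ⊢
      rw [Function.update_of_ne (hij k hk).symm] at hwk ⊢
      exact h.weak j k e hj hk hs hwk
  · have key : ∀ k e, T k → Strong inc c ty w i e → Strong inc c ty (win k) k e →
        w.sign = (win k).sign := by
      intro k e hk hs hwk
      by_contra hσ
      have hσ' : (win k).sign = !w.sign := by
        cases h1 : w.sign <;> cases h2 : (win k).sign <;> simp_all
      rcases hs.2 with ho | ho
      · exact g1 ⟨h1.left_mem, k, e, hk, ho, hwk, hσ'⟩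
      · exact g2 ⟨h1.right_mem, k, e, hk, ho, hwk, hσ'⟩
    rintro j k e (rfl | hj) (rfl | hk) hs hwk
    · rfl
    · rw [Function.update_self] at hs ⊢
      rw [Function.update_of_ne (hij k hk).symm] at hwk ⊢
      exact key k e hk hs hwk
    · rw [Function.update_self] at hwk ⊢
      rw [Function.update_of_ne (hij j hj).symm] at hs ⊢
      exact (key j e hj hwk hs).symm
    · rw [Function.update_of_ne (hij j hj).symm] at hs ⊢
      rw [Function.update_of_ne (hij k hk).symm] at hwk ⊢
      exact h.strong j k e hj hk hs hwk
  · rintro j k e e' u hj hk htk hs hu hs' hu'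
    have hki : k ≠ i := by rintro rfl; exact htk hti
    rw [Function.update_of_ne hki] at hs'
    rcases hj with rfl | hj
    · rw [Function.update_self] at hs ⊢
      have hjk : j ≠ k := hki.symm
      have hwk := h.window k hk
      have hlegk : e' ∉ cyc inc c (ty j) j := by
        rcases hs'.2 with hh | hh
        · exact F.leg_notMem_cyc hk hi hwk.o_mem hh hs'.1
        · exact F.leg_notMem_cyc hk hi hwk.s_mem hh hs'.1
      have key : ∀ v, v ∈ X → inc e v → ¬ W w.sign v →
          (ty k = 2 → w.sign = false) ∧ (ty k = 3 → w.sign = true) := by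
        intro v hv hev hW
        have hvu : v ≠ u := by
          rintro rfl
          exact hlegk (mem_cyc_of_mem_cycVerts hv hu' (by rw [hs'.1, hti]; exact htk))
        have hW' : ty k ≠ (if w.sign then 2 else 3) := fun hh =>
          hW ⟨hv, Or.inr ⟨k, e, e', u, hk, hh, ⟨hvu, hev, hu⟩, hs.1.trans hti, hu', hs'⟩⟩
        cases hσ : w.sign <;> simp [hσ] at hW' ⊢ <;> exact hW'
      rcases hs.2 with ho | ho
      · exact key _ h1.left_mem ho g3
      · exact key _ h1.right_mem ho g4
    · rw [Function.update_of_ne (hij j hj).symm] at hs ⊢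
      exact h.cross j k e e' u hj hk htk hs hu hs' hu'

/-- Windows of types 2 and 3 are arbitrary and fixed at the start; only those of type 1 are
replaced, one at a time. -/
theorem exists_compatible [Finite E] [Finite V] (F : Frame inc c ty) (ht : NoTriangle inc)
    (hq : NoSquare inc) :
    ∃ win, Compatible inc c ty win (fun i => c i = 0 ∧ ty i = 1) := by
  classical
  have hfin : {i | c i = 0 ∧ ty i = 1}.Finite := Set.toFinite _
  have key : ∀ T : Set E, T.Finite → T ⊆ {i | c i = 0 ∧ ty i = 1} →
      ∃ win : E → Window V E, Compatible inc c ty win (fun i => i ∈ T) := by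
    intro T hT
    induction T, hT using Set.Finite.induction_on with
    | empty =>
      intro _
      have : ∀ d, ∃ w : Window V E, c d = 0 → IsWindow inc c ty d w := by
        intro d
        by_cases hd : c d = 0
        · obtain ⟨w, hw⟩ := F.exists_some_window hd
          exact ⟨w, fun _ => hw⟩
        · obtain ⟨v, -⟩ := F.cubic.ends d
          exact ⟨⟨v, v, v, v, d, d, d, true⟩, fun h => absurd h hd⟩
      choose win hwin using this
      exact ⟨win, hwin, fun _ _ _ h => absurd h (by simp), fun _ _ _ h => absurd h (by simp),
        fun _ _ _ _ _ h => absurd h (by simp)⟩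
    | @insert i T hiT _ ih =>
      intro hsub
      obtain ⟨win, hwin⟩ := ih fun x hx => hsub (Set.mem_insert_of_mem _ hx)
      have hi := hsub (Set.mem_insert i T)
      obtain ⟨w, hw⟩ := Compatible.insert F ht hq
        (fun j hj => hsub (Set.mem_insert_of_mem _ hj)) hwin hi.1 hi.2 hiT
      exact ⟨_, hw⟩
  exact key _ hfin subset_rfl

end Frame

/-! ### The values modulo eleven -/

/-- The numbers `a` and `b` are at circular distance at least `3` modulo `11`. -/
def Far (a b : Fin 11) : Prop :=
  (a.val + 3 ≤ b.val ∧ b.val ≤ a.val + 8) ∨ (b.val + 3 ≤ a.val ∧ a.val ≤ b.val + 8)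

instance (a b : Fin 11) : Decidable (Far a b) := inferInstanceAs (Decidable (_ ∨ _))

theorem Far.symm {a b : Fin 11} (h : Far a b) : Far b a := Or.symm h

/-- The colour of an edge away from the windows. -/
def baseVal (k : Fin 4) : Fin 11 := ![0, 0, 4, 7] k

/-- The colour to be missed at the vertex `s` of a window. -/
def missCol (k : Fin 4) (σ : Bool) : Fin 4 := if k = 1 then (if σ then 2 else 3) else 1

/-- The colour of the strong edges of a window. -/
def legVal (k : Fin 4) (σ : Bool) : Fin 11 :=
  if k = 1 then (if σ then 1 else 10) else if k = 2 then 3 else 8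

/-- The colour of the edge `h` of a window. -/
def hVal (k : Fin 4) (σ : Bool) : Fin 11 :=
  if k = 1 then (if σ then 9 else 2) else if k = 2 then 6 else 5

/-- The colour of the edge `f` of a window. -/
def fVal (k : Fin 4) (σ : Bool) : Fin 11 :=
  if k = 1 then (if σ then 6 else 5) else if k = 2 then 9 else 2

/-- The colour of the edge `k` of a window. -/
def kVal (k : Fin 4) (σ : Bool) : Fin 11 :=
  if k = 1 then (if σ then 3 else 8) else if k = 2 then 1 else 10

/-- This and the next three statements check the vertices `o`, `s`, `t`, `r` of a window. For type 1
and sign `true` the cycle reads 4, 9, 6, 3, 7 through the window. The reflection `x ↦ -x` modulo 11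
exchanges the two signs of type 1, and also types 2 and 3. -/
theorem far_first : ∀ (k : Fin 4) (σ : Bool), k ≠ 0 → Far (legVal k σ) (hVal k σ) ∧
    Far (legVal k σ) (baseVal (missCol k σ)) ∧ Far (hVal k σ) (baseVal (missCol k σ)) := by
  decide

theorem far_second : ∀ (k : Fin 4) (σ : Bool), k ≠ 0 → Far (legVal k σ) (hVal k σ) ∧
    Far (legVal k σ) (fVal k σ) ∧ Far (hVal k σ) (fVal k σ) := by
  decide

theorem far_third : ∀ (k : Fin 4) (σ : Bool) (a : Fin 11), k ≠ 0 →
    (a = baseVal k ∨ k = 1 ∧ a = legVal k (!σ)) → Far a (fVal k σ) ∧ Far a (kVal k σ) ∧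
      Far (fVal k σ) (kVal k σ) := by
  decide

theorem far_fourth : ∀ (k n : Fin 4) (σ : Bool) (a : Fin 11), k ≠ 0 → n ≠ 0 → n ≠ k →
    n ≠ missCol k σ → (a = baseVal k ∨ k = 1 ∧ a = legVal k (!σ)) → Far a (kVal k σ) ∧
      Far a (baseVal n) ∧ Far (kVal k σ) (baseVal n) := by
  decide

theorem far_outside : ∀ (k m n : Fin 4) (σ : Bool) (a : Fin 11), k ≠ 0 → n ≠ 0 → n ≠ k →
    m ≠ 0 → m ≠ k → m ≠ n → (a = baseVal k ∨ a = legVal k σ) → Far a (baseVal m) ∧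
      Far a (baseVal n) ∧ Far (baseVal m) (baseVal n) := by
  decide

/-- Two strong legs at a common vertex off the cycles can only conflict when one of them has type 1,
since 3 and 8 are far apart; the hypotheses are the cross condition on signs, read both ways. -/
theorem far_both : ∀ (k m : Fin 4) (σ τ : Bool), k ≠ 0 → m ≠ 0 → k ≠ m →
    (k = 1 → (m = 2 → σ = false) ∧ (m = 3 → σ = true)) →
    (m = 1 → (k = 2 → τ = false) ∧ (k = 3 → τ = true)) →
    Far (legVal k σ) (legVal m τ) := by
  decide

theorem far_one : ∀ (k m : Fin 4) (σ : Bool), k ≠ 0 → m ≠ 0 → k ≠ m →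
    Far (legVal k σ) (baseVal m) ∧ Far (baseVal m) (legVal k σ) := by
  decide

theorem far_base : ∀ (k m : Fin 4), k ≠ 0 → m ≠ 0 → k ≠ m → Far (baseVal k) (baseVal m) := by
  decide

theorem missCol_ne : ∀ (k : Fin 4) (σ : Bool), missCol k σ ≠ 0 ∧ missCol k σ ≠ k := by
  decide

theorem legVal_eq : ∀ (k : Fin 4) (σ τ : Bool), (k = 1 → σ = τ) → legVal k σ = legVal k τ := by
  decide

theorem far_of_three {inc : E → V → Prop} {φ : E → Fin 11} {v : V} {a b d : E}
    (hall : ∀ x, inc x v → x = a ∨ x = b ∨ x = d)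
    (h : Far (φ a) (φ b) ∧ Far (φ a) (φ d) ∧ Far (φ b) (φ d)) {e f : E} (he : inc e v)
    (hf : inc f v) (hef : e ≠ f) : Far (φ e) (φ f) := by
  obtain ⟨h1, h2, h3⟩ := h
  rcases hall e he with rfl | rfl | rfl <;> rcases hall f hf with rfl | rfl | rfl
  · exact absurd rfl hef
  · exact h1
  · exact h2
  · exact h1.symm
  · exact absurd rfl hef
  · exact h3
  · exact h2.symm
  · exact h3.symm
  · exact absurd rfl hef

/-! ### The colouring of a graph without short cycles -/

/-- The colouring `c'` arises from `c` by moving each uncoloured edge to the middle of its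
window. -/
structure Placed (inc : E → V → Prop) (c ty : E → Fin 4) (win : E → Window V E)
    (c' : E → Fin 4) : Prop where
  best : IsBest inc c'
  f_eq : ∀ d, c d = 0 → c' (win d).f = 0
  misses : ∀ d, c d = 0 → Misses inc c' (win d).s (missCol (ty d) (win d).sign)
  ne : ∀ d, c d = 0 → ∀ e ∈ cyc inc c (ty d) d, c' e ≠ ty d
  blank : ∀ e, c' e = 0 → ∃ d, c d = 0 ∧ e = (win d).f
  off : ∀ e, (∀ d, c d = 0 → e ∉ cyc inc c (ty d) d) → c' e = c e

open Classical in
/-- The colouring with eleven colours. -/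
noncomputable def finalColor (inc : E → V → Prop) (c ty : E → Fin 4) (win : E → Window V E)
    (c' : E → Fin 4) (e : E) : Fin 11 :=
  if h : ∃ d, c d = 0 ∧ e = (win d).h then hVal (ty h.choose) (win h.choose).sign
  else if h : ∃ d, c d = 0 ∧ e = (win d).f then fVal (ty h.choose) (win h.choose).sign
  else if h : ∃ d, c d = 0 ∧ e = (win d).k then kVal (ty h.choose) (win h.choose).sign
  else if h : ∃ d, c d = 0 ∧ Strong inc c ty (win d) d e then
    legVal (ty h.choose) (win h.choose).sign
  else baseVal (c' e)

theorem IsWindow.o_ne_r {inc : E → V → Prop} {c ty : E → Fin 4} {i : E} {w : Window V E}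
    (h : IsWindow inc c ty i w) (ht : NoTriangle inc) : w.o ≠ w.r := by
  intro hh
  refine ht _ _ w.k _ _ _ h.joins_h h.joins_f ?_
  rw [hh]
  exact h.joins_k

namespace Frame

variable {inc : E → V → Prop} {c ty : E → Fin 4} {win : E → Window V E} {c' : E → Fin 4}

theorem exists_placed [Finite E] (F : Frame inc c ty)
    (hw : ∀ d, c d = 0 → IsWindow inc c ty d (win d)) : ∃ c', Placed inc c ty win c' := by
  obtain ⟨c', s, hb, hs, hbl, hoff⟩ := F.realize
    (fun d s => s = ((win d).f, (win d).s, missCol (ty d) (win d).sign)) (fun d hd =>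
      ⟨_, ⟨(hw d hd).f_mem, (hw d hd).joins_f.2.1, (missCol_ne _ _).1, (missCol_ne _ _).2⟩, rfl⟩)
  refine ⟨c', hb, fun d hd => ?_, fun d hd => ?_, fun d hd => (hs d hd).2.2.2.2, fun e he => ?_,
    hoff⟩
  · have := (hs d hd).2.2.1
    rwa [(hs d hd).2.1] at this
  · have := (hs d hd).2.2.2.1
    rwa [(hs d hd).2.1] at this
  · obtain ⟨d, hd, rfl⟩ := hbl e he
    exact ⟨d, hd, by rw [(hs d hd).2.1]⟩

theorem eq_of_mem_cyc [Finite E] (F : Frame inc c ty) {d d' e : E} (h : c d = 0) (h' : c d' = 0)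
    (he : e ∈ cyc inc c (ty d) d) (he' : e ∈ cyc inc c (ty d') d') : d = d' := by
  obtain ⟨v, _, _, hv⟩ := F.cubic.ends e
  exact F.eq_of_mem h h' ⟨e, he, (hv v).2 (Or.inl rfl)⟩ ⟨e, he', (hv v).2 (Or.inl rfl)⟩

theorem window_ne (hw : ∀ d, c d = 0 → IsWindow inc c ty d (win d)) (F : Frame inc c ty)
    (ht : NoTriangle inc) {d : E} (hd : c d = 0) :
    (win d).h ≠ (win d).f ∧ (win d).h ≠ (win d).k ∧ (win d).f ≠ (win d).k := by
  have w := hw d hd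
  refine ⟨fun h => ?_, fun h => ?_, fun h => ?_⟩
  · rcases F.cubic.eq_or_eq w.joins_f (h ▸ w.joins_h.2.1) with h1 | h1
    · exact w.joins_h.1 h1
    · exact w.o_ne_t h1
  · rcases F.cubic.eq_or_eq w.joins_k (h ▸ w.joins_h.2.1) with h1 | h1
    · exact w.o_ne_t h1
    · exact w.o_ne_r ht h1
  · rcases F.cubic.eq_or_eq w.joins_k (h ▸ w.joins_f.2.1) with h1 | h1
    · exact w.joins_f.1 h1
    · exact w.s_ne_r h1

theorem strong_notMem_cyc [Finite E] (F : Frame inc c ty)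
    (hw : ∀ d, c d = 0 → IsWindow inc c ty d (win d)) {d d' e : E} (hd : c d = 0) (hd' : c d' = 0)
    (hs : Strong inc c ty (win d) d e) : e ∉ cyc inc c (ty d') d' := by
  rcases hs.2 with h | h
  · exact F.leg_notMem_cyc hd hd' (hw d hd).o_mem h hs.1
  · exact F.leg_notMem_cyc hd hd' (hw d hd).s_mem h hs.1

theorem finalColor_h [Finite E] (F : Frame inc c ty)
    (hw : ∀ d, c d = 0 → IsWindow inc c ty d (win d)) {d : E} (hd : c d = 0) :
    finalColor inc c ty win c' (win d).h = hVal (ty d) (win d).sign := by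
  have hex : ∃ d', c d' = 0 ∧ (win d).h = (win d').h := ⟨d, hd, rfl⟩
  rw [finalColor, dif_pos hex]
  obtain ⟨h1, h2⟩ := hex.choose_spec
  generalize hex.choose = d' at h1 h2 ⊢
  rw [← F.eq_of_mem_cyc hd h1 (hw d hd).h_mem (h2 ▸ (hw _ h1).h_mem)]

theorem finalColor_f [Finite E] (F : Frame inc c ty)
    (hw : ∀ d, c d = 0 → IsWindow inc c ty d (win d)) (ht : NoTriangle inc) {d : E}
    (hd : c d = 0) : finalColor inc c ty win c' (win d).f = fVal (ty d) (win d).sign := by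
  have hex : ∃ d', c d' = 0 ∧ (win d).f = (win d').f := ⟨d, hd, rfl⟩
  have hne := window_ne hw F ht hd
  rw [finalColor, dif_neg, dif_pos hex]
  · obtain ⟨h1, h2⟩ := hex.choose_spec
    generalize hex.choose = d' at h1 h2 ⊢
    rw [← F.eq_of_mem_cyc hd h1 (hw d hd).f_mem (h2 ▸ (hw _ h1).f_mem)]
  · rintro ⟨d', h1, h2⟩
    have := F.eq_of_mem_cyc hd h1 (hw d hd).f_mem (h2 ▸ (hw _ h1).h_mem)
    subst this
    exact hne.1 h2.symm

theorem finalColor_k [Finite E] (F : Frame inc c ty)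
    (hw : ∀ d, c d = 0 → IsWindow inc c ty d (win d)) (ht : NoTriangle inc) {d : E}
    (hd : c d = 0) : finalColor inc c ty win c' (win d).k = kVal (ty d) (win d).sign := by
  have hex : ∃ d', c d' = 0 ∧ (win d).k = (win d').k := ⟨d, hd, rfl⟩
  have hne := window_ne hw F ht hd
  rw [finalColor, dif_neg, dif_neg, dif_pos hex]
  · obtain ⟨h1, h2⟩ := hex.choose_spec
    generalize hex.choose = d' at h1 h2 ⊢
    rw [← F.eq_of_mem_cyc hd h1 (hw d hd).k_mem (h2 ▸ (hw _ h1).k_mem)]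
  · rintro ⟨d', h1, h2⟩
    have := F.eq_of_mem_cyc hd h1 (hw d hd).k_mem (h2 ▸ (hw _ h1).f_mem)
    subst this
    exact hne.2.2 h2.symm
  · rintro ⟨d', h1, h2⟩
    have := F.eq_of_mem_cyc hd h1 (hw d hd).k_mem (h2 ▸ (hw _ h1).h_mem)
    subst this
    exact hne.2.1 h2.symm

theorem finalColor_of_notMem
    (hw : ∀ d, c d = 0 → IsWindow inc c ty d (win d)) {e : E}
    (he : ∀ d, c d = 0 → e ∉ cyc inc c (ty d) d) :
    (∃ d, c d = 0 ∧ Strong inc c ty (win d) d e ∧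
      finalColor inc c ty win c' e = legVal (ty d) (win d).sign) ∨
    (∀ d, c d = 0 → ¬ Strong inc c ty (win d) d e) ∧
      finalColor inc c ty win c' e = baseVal (c' e) := by
  rw [finalColor, dif_neg, dif_neg, dif_neg]
  · split_ifs with h
    · exact Or.inl ⟨_, h.choose_spec.1, h.choose_spec.2, rfl⟩
    · exact Or.inr ⟨fun d hd hs => h ⟨d, hd, hs⟩, rfl⟩
  · rintro ⟨d, hd, rfl⟩
    exact he d hd (hw d hd).k_mem
  · rintro ⟨d, hd, rfl⟩
    exact he d hd (hw d hd).f_mem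
  · rintro ⟨d, hd, rfl⟩
    exact he d hd (hw d hd).h_mem

theorem finalColor_of_mem [Finite E] (F : Frame inc c ty)
    (hw : ∀ d, c d = 0 → IsWindow inc c ty d (win d)) {d e : E} (hd : c d = 0)
    (he : e ∈ cyc inc c (ty d) d) (h1 : e ≠ (win d).h) (h2 : e ≠ (win d).f)
    (h3 : e ≠ (win d).k) : finalColor inc c ty win c' e = baseVal (c' e) := by
  rw [finalColor, dif_neg, dif_neg, dif_neg, dif_neg]
  · rintro ⟨d', hd', hs⟩
    exact F.strong_notMem_cyc hw hd' hd hs he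
  · rintro ⟨d', hd', rfl⟩
    have := F.eq_of_mem_cyc hd hd' he (hw d' hd').k_mem
    subst this
    exact h3 rfl
  · rintro ⟨d', hd', rfl⟩
    have := F.eq_of_mem_cyc hd hd' he (hw d' hd').f_mem
    subst this
    exact h2 rfl
  · rintro ⟨d', hd', rfl⟩
    have := F.eq_of_mem_cyc hd hd' he (hw d' hd').h_mem
    subst this
    exact h1 rfl

theorem finalColor_strong [Finite E] (F : Frame inc c ty)
    (hC : Compatible inc c ty win (fun i => c i = 0 ∧ ty i = 1)) {d e : E} (hd : c d = 0)
    (hs : Strong inc c ty (win d) d e) :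
    finalColor inc c ty win c' e = legVal (ty d) (win d).sign := by
  rcases finalColor_of_notMem (c' := c') hC.window
    (fun d' hd' => F.strong_notMem_cyc hC.window hd hd' hs) with ⟨d', hd', hs', h⟩ | ⟨h, -⟩
  · rw [h]
    have htt : ty d' = ty d := hs'.1.symm.trans hs.1
    rw [htt]
    refine legVal_eq _ _ _ fun h1 => ?_
    exact hC.strong d' d e ⟨hd', htt.trans h1⟩ ⟨hd, h1⟩ hs' hs
  · exact absurd hs (h d hd)

/-- If the leg is strong for another window, both cycles have the same type. For types 2 and 3 this
contradicts `not_linked`; for type 1 the signs are opposite. -/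
theorem finalColor_weak [Finite E] (F : Frame inc c ty) (ht : NoTriangle inc) (hq : NoSquare inc)
    (hC : Compatible inc c ty win (fun i => c i = 0 ∧ ty i = 1)) (hP : Placed inc c ty win c')
    {d e : E} (hd : c d = 0) (hs : Weak inc c ty (win d) d e) :
    finalColor inc c ty win c' e = baseVal (ty d) ∨
      ty d = 1 ∧ finalColor inc c ty win c' e = legVal (ty d) (!(win d).sign) := by
  have hw := hC.window d hd
  obtain ⟨v, hv, hev⟩ : ∃ v, v ∈ cycVerts inc c (ty d) d ∧ inc e v := by
    rcases hs.2 with h | h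
    · exact ⟨_, hw.t_mem, h⟩
    · exact ⟨_, hw.r_mem, h⟩
  have hnot : ∀ d', c d' = 0 → e ∉ cyc inc c (ty d') d' := fun d' hd' =>
    F.leg_notMem_cyc hd hd' hv hev hs.1
  rcases finalColor_of_notMem (c' := c') hC.window hnot with ⟨d', hd', hs', h⟩ | ⟨-, h⟩
  · right
    have htt : ty d' = ty d := hs'.1.symm.trans hs.1
    have hne : d ≠ d' := by
      rintro rfl
      exact hw.not_weak F.simple ht hq (F.blank_ne hd) hs' hs
    have h1 : ty d = 1 := by
      by_contra h1
      obtain ⟨v', hv', hev'⟩ : ∃ v, v ∈ cycVerts inc c (ty d') d' ∧ inc e v := by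
        rcases hs'.2 with h | h
        · exact ⟨_, (hC.window d' hd').o_mem, h⟩
        · exact ⟨_, (hC.window d' hd').s_mem, h⟩
      exact F.not_linked hd hd' hne h1 htt.symm
        ⟨fun hh => hne (F.eq_of_mem hd hd' hv (by rw [hh]; exact hv')), hev, hev'⟩ hs.1 hv hv'
    refine ⟨h1, h.trans ?_⟩
    rw [htt]
    refine legVal_eq _ _ _ fun _ => ?_
    have := hC.weak d' d e ⟨hd', htt.trans h1⟩ ⟨hd, h1⟩ hs' hs
    revert this
    cases (win d).sign <;> cases (win d').sign <;> simp
  · left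
    rw [h, hP.off e hnot, hs.1]

/-- At a vertex of a cycle its position relative to the window decides which numerical check
applies. At a vertex off all cycles the three edges carry the three colours, each at its base value
or moved as a strong leg. -/
theorem far_finalColor [Finite E] (F : Frame inc c ty) (ht : NoTriangle inc) (hq : NoSquare inc)
    (hC : Compatible inc c ty win (fun i => c i = 0 ∧ ty i = 1)) (hP : Placed inc c ty win c')
    {v : V} {e f : E} (he : inc e v) (hf : inc f v) (hef : e ≠ f) :
    Far (finalColor inc c ty win c' e) (finalColor inc c ty win c' f) := by
  set φ := finalColor inc c ty win c' with hφ
  by_cases hv : ∃ d, c d = 0 ∧ v ∈ cycVerts inc c (ty d) d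
  · obtain ⟨d, hd, hv⟩ := hv
    have hw := hC.window d hd
    have ht0 := (F.type d hd).1
    have hbm : ∀ z ∈ cyc inc c (ty d) d, z ≠ (win d).f → c' z ≠ 0 := by
      intro z hz hzf h0
      obtain ⟨d', hd', rfl⟩ := hP.blank z h0
      have := F.eq_of_mem_cyc hd hd' hz (hC.window d' hd').f_mem
      subst this
      exact hzf rfl
    have hwne := window_ne hC.window F ht hd
    have hmiss := missCol_ne (ty d) (win d).sign
    have hh0 := hbm _ hw.h_mem hwne.1
    have hk0 := hbm _ hw.k_mem hwne.2.2.symm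
    have hh1 := hP.ne d hd _ hw.h_mem
    have hk1 := hP.ne d hd _ hw.k_mem
    have hh2 := hP.misses d hd _ hw.joins_h.2.2
    have hprop : ∀ z z' u, inc z u → inc z' u → z ≠ z' → c' z ≠ 0 → c' z ≠ c' z' :=
      fun z z' u h1 h2 h3 h4 h5 => h3 (hP.best.1 u z z' h1 h2 h5 h4)
    obtain ⟨g0, hg0, hg0v⟩ := id hv
    by_cases hvo : v = (win d).o
    · subst hvo
      obtain ⟨l, g, hg, hgh, hlh, hlg, hgv, hlv, hlc, hall⟩ :=
        F.exists_next hd hw.h_mem hw.joins_h.2.1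
      have hgf : g ≠ (win d).f := by
        rintro rfl
        rcases F.cubic.eq_or_eq hw.joins_f hgv with h | h
        · exact hw.joins_h.1 h
        · exact hw.o_ne_t h
      have hgk : g ≠ (win d).k := by
        rintro rfl
        rcases F.cubic.eq_or_eq hw.joins_k hgv with h | h
        · exact hw.o_ne_t h
        · exact hw.o_ne_r ht h
      refine far_of_three hall ?_ he hf hef
      rw [hφ, F.finalColor_strong hC hd ⟨hlc, Or.inl hlv⟩, F.finalColor_h hC.window hd,
        F.finalColor_of_mem hC.window hd hg hgh hgf hgk]
      -- The edge `h` carries neither the type nor the colour missed at `s`, so the other cycle edge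
      -- at `o` carries the latter.
      have : c' g = missCol (ty d) (win d).sign := by
        have h1 := hbm g hg hgf
        have h2 := hP.ne d hd g hg
        have h3 := hprop _ _ _ hgv hw.joins_h.2.1 hgh h1
        have hfin : ∀ k m a b : Fin 4, k ≠ 0 → m ≠ 0 → m ≠ k → a ≠ 0 → a ≠ k → a ≠ m → b ≠ 0 →
          b ≠ k → b ≠ a → b = m := by decide
        exact hfin _ _ _ _ ht0 hmiss.1 hmiss.2 hh0 hh1 hh2 h1 h2 h3
      rw [this]
      exact far_first _ _ ht0
    by_cases hvs : v = (win d).s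
    · subst hvs
      obtain ⟨l, g, hg, hgh, hlh, hlg, hgv, hlv, hlc, hall⟩ :=
        F.exists_next hd hw.h_mem hw.joins_h.2.2
      have : g = (win d).f := by
        rcases hall _ hw.joins_f.2.1 with h | h | h
        · exact absurd (h ▸ hlc) (ne_of_mem_cyc (F.blank_ne hd) hw.f_mem)
        · exact absurd h.symm hwne.1
        · exact h.symm
      subst this
      refine far_of_three hall ?_ he hf hef
      rw [hφ, F.finalColor_strong hC hd ⟨hlc, Or.inr hlv⟩, F.finalColor_h hC.window hd,
        F.finalColor_f hC.window ht hd]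
      exact far_second _ _ ht0
    by_cases hvt : v = (win d).t
    · subst hvt
      obtain ⟨l, g, hg, hgh, hlh, hlg, hgv, hlv, hlc, hall⟩ :=
        F.exists_next hd hw.f_mem hw.joins_f.2.2
      have : g = (win d).k := by
        rcases hall _ hw.joins_k.2.1 with h | h | h
        · exact absurd (h ▸ hlc) (ne_of_mem_cyc (F.blank_ne hd) hw.k_mem)
        · exact absurd h.symm hwne.2.2
        · exact h.symm
      subst this
      refine far_of_three hall ?_ he hf hef
      have hl := F.finalColor_weak ht hq hC hP hd ⟨hlc, Or.inl hlv⟩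
      rw [hφ, F.finalColor_f hC.window ht hd, F.finalColor_k hC.window ht hd]
      exact far_third _ _ _ ht0 hl
    by_cases hvr : v = (win d).r
    · subst hvr
      obtain ⟨l, g, hg, hgh, hlh, hlg, hgv, hlv, hlc, hall⟩ :=
        F.exists_next hd hw.k_mem hw.joins_k.2.2
      have hgf : g ≠ (win d).f := by
        rintro rfl
        rcases F.cubic.eq_or_eq hw.joins_f hgv with h | h
        · exact hvs h
        · exact hvt h
      have hgk : g ≠ (win d).h := by
        rintro rfl
        rcases F.cubic.eq_or_eq hw.joins_h hgv with h | h
        · exact hvo h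
        · exact hvs h
      refine far_of_three hall ?_ he hf hef
      have hl := F.finalColor_weak ht hq hC hP hd ⟨hlc, Or.inr hlv⟩
      rw [hφ, F.finalColor_k hC.window ht hd, F.finalColor_of_mem hC.window hd hg hgk hgf hgh]
      have h1 := hbm g hg hgf
      have h2 := hP.ne d hd g hg
      refine far_fourth _ _ _ _ ht0 h1 h2 ?_ hl
      have h3 := hprop _ _ _ hgv hw.joins_k.2.2 hgh h1
      obtain ⟨l', hl', hlt'⟩ := F.exists_leg hd hw.t_mem
      have hlc' : c' l' = ty d := by
        rw [hP.off l' fun d' hd' => F.leg_notMem_cyc hd hd' hw.t_mem hl' hlt', hlt']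
      -- Around the uncoloured edge, `t` misses the colour of `h`. So `k` carries the colour missed
      -- at `s`, and the next cycle edge at `r` cannot have it.
      have hh3 : Misses inc c' (win d).t (c' (win d).h) :=
        hP.best.misses_other_end F.cubic hw.joins_f (hP.f_eq d hd) ht0 hmiss.1 hh0
          hmiss.2.symm hh1.symm hh2.symm (hP.misses d hd) hl' hlc'
      have h4 := hh3 _ hw.joins_k.2.1
      have hfin : ∀ k m a b : Fin 4, k ≠ 0 → m ≠ 0 → m ≠ k → a ≠ 0 → a ≠ k → a ≠ m → b ≠ 0 →
          b ≠ k → b ≠ a → b = m := by decide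
      rw [← hfin _ _ _ _ ht0 hmiss.1 hmiss.2 hh0 hh1 hh2 hk0 hk1 h4]
      exact h3
    · obtain ⟨l, g, hg, hgh, hlh, hlg, hgv, hlv, hlc, hall⟩ := F.exists_next hd hg0 hg0v
      have hout : ∀ z, inc z v → z ≠ (win d).h ∧ z ≠ (win d).f ∧ z ≠ (win d).k := by
        intro z hz
        refine ⟨?_, ?_, ?_⟩ <;> rintro rfl
        · exact (F.cubic.eq_or_eq hw.joins_h hz).elim hvo hvs
        · exact (F.cubic.eq_or_eq hw.joins_f hz).elim hvs hvt
        · exact (F.cubic.eq_or_eq hw.joins_k hz).elim hvt hvr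
      have o1 := hout _ hg0v
      have o2 := hout _ hgv
      refine far_of_three hall ?_ he hf hef
      rw [hφ, F.finalColor_of_mem hC.window hd hg0 o1.1 o1.2.1 o1.2.2,
        F.finalColor_of_mem hC.window hd hg o2.1 o2.2.1 o2.2.2]
      have hnot : ∀ d', c d' = 0 → l ∉ cyc inc c (ty d') d' := fun d' hd' =>
        F.leg_notMem_cyc hd hd' hv hlv hlc
      have hl : ∃ σ, finalColor inc c ty win c' l = baseVal (ty d) ∨
          finalColor inc c ty win c' l = legVal (ty d) σ := by
        rcases finalColor_of_notMem (c' := c') hC.window hnot with ⟨d', hd', hs', h⟩ | ⟨-, h⟩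
        · have htt : ty d' = ty d := hs'.1.symm.trans hlc
          exact ⟨_, Or.inr (htt ▸ h)⟩
        · refine ⟨true, Or.inl ?_⟩
          rw [h, hP.off l hnot, hlc]
      obtain ⟨σ, hl⟩ := hl
      have z1 := hbm g0 hg0 o1.2.1
      exact far_outside _ _ _ σ _ ht0 (hbm g hg o2.2.1) (hP.ne d hd g hg) z1 (hP.ne d hd g0 hg0)
        (hprop _ _ _ hg0v hgv hgh.symm z1) hl
  · push Not at hv
    have hnot : ∀ z, inc z v → ∀ d, c d = 0 → z ∉ cyc inc c (ty d) d := fun z hz d hd hh =>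
      hv d hd ⟨z, hh, hz⟩
    have hn0 : ∀ z, inc z v → c z ≠ 0 := fun z hz h0 => hnot z hz z h0 self_mem_cyc
    have e0 := hn0 e he
    have f0 := hn0 f hf
    have hne : c e ≠ c f := fun hh => hef (F.best.1 v e f he hf hh e0)
    have ee := finalColor_of_notMem (c' := c') hC.window (hnot e he)
    have ff := finalColor_of_notMem (c' := c') hC.window (hnot f hf)
    rw [hP.off e (hnot e he)] at ee
    rw [hP.off f (hnot f hf)] at ff
    rw [hφ]
    rcases ee with ⟨d, hd, hs, h⟩ | ⟨-, h⟩ <;> rcases ff with ⟨d', hd', hs', h'⟩ | ⟨-, h'⟩ <;>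
      rw [h, h']
    · rw [hs.1] at e0 hne
      rw [hs'.1] at f0 hne
      refine far_both _ _ _ _ e0 f0 hne (fun h1 => ?_) (fun h1 => ?_)
      · exact hC.cross d d' e f v ⟨hd, h1⟩ hd' (h1 ▸ hne.symm) hs he hs' hf
      · exact hC.cross d' d f e v ⟨hd', h1⟩ hd (h1 ▸ hne) hs' hf hs he
    · rw [hs.1] at e0 hne
      exact (far_one _ _ _ e0 f0 hne).1
    · rw [hs'.1] at f0 hne
      exact (far_one _ _ _ f0 e0 hne.symm).2
    · exact far_base _ _ e0 f0 hne

end Frame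

/-- The edges of a cubic graph can be coloured with eleven colours so that the colours of adjacent
edges are far from each other. -/
def Colorable (inc : E → V → Prop) : Prop :=
  ∃ φ : E → Fin 11, ∀ v e f, inc e v → inc f v → e ≠ f → Far (φ e) (φ f)

theorem colorable_of_no_short_cycle [Finite V] [Finite E] {inc : E → V → Prop} (hc : IsCubic inc)
    (hs : NoDigon inc) (ht : NoTriangle inc) (hq : NoSquare inc) : Colorable inc := by
  obtain ⟨c, ty, F⟩ := exists_frame hc hs
  obtain ⟨win, hC⟩ := F.exists_compatible ht hq
  obtain ⟨c', hP⟩ := F.exists_placed hC.window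
  exact ⟨_, fun v e f => F.far_finalColor ht hq hC hP⟩

/-! ### Splicing out vertex sets without creating bridges -/

/-- The edge `e` has one end in `X` and one end outside. -/
def Crosses (inc : E → V → Prop) (X : Set V) (e : E) : Prop :=
  ∃ u ∈ X, ∃ v ∉ X, inc e u ∧ inc e v

/-- No edge cut consists of exactly one edge. -/
def NoBridge (inc : E → V → Prop) : Prop :=
  ∀ X e, Crosses inc X e → ∃ f, f ≠ e ∧ Crosses inc X f

/-- The edges that leave `Q` are arranged in pairs `p i`, `q i`, whose ends outside `Q` are the
distinct vertices `x i` and `y i`. -/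
structure Splice (inc : E → V → Prop) (Q : Set V) {n : ℕ} (p q : Fin n → E) (x y : Fin n → V) :
    Prop where
  p_x : ∀ i, inc (p i) (x i)
  q_y : ∀ i, inc (q i) (y i)
  x_notMem : ∀ i, x i ∉ Q
  y_notMem : ∀ i, y i ∉ Q
  p_mem : ∀ i, ∃ u ∈ Q, inc (p i) u
  q_mem : ∀ i, ∃ u ∈ Q, inc (q i) u
  ne : ∀ i, x i ≠ y i
  p_inj : Function.Injective p
  q_inj : Function.Injective q
  p_ne_q : ∀ i j, p i ≠ q j
  cross : ∀ e u v, inc e u → inc e v → u ∈ Q → v ∉ Q → ∃ i, e = p i ∨ e = q i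

open Classical in
/-- The map that identifies `q i` with `p i`. -/
noncomputable def glue {n : ℕ} (p q : Fin n → E) (f : E) : E :=
  if h : ∃ i, f = q i then p h.choose else f

/-- The edges that remain when the set `Q` is spliced out. -/
def SpliceEdge (inc : E → V → Prop) (Q : Set V) {n : ℕ} (q : Fin n → E) : Type v :=
  {e : E // (∃ v ∉ Q, inc e v) ∧ ∀ i, e ≠ q i}

/-- The graph obtained by deleting `Q` and joining the edges `p i` and `q i`. -/
def spliceInc (inc : E → V → Prop) (Q : Set V) {n : ℕ} (p q : Fin n → E) :
    SpliceEdge inc Q q → {v // v ∉ Q} → Prop :=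
  fun e v => ∃ f, glue p q f = e.1 ∧ inc f v.1

instance [Finite E] (inc : E → V → Prop) (Q : Set V) {n : ℕ} (q : Fin n → E) :
    Finite (SpliceEdge inc Q q) := inferInstanceAs (Finite (Subtype _))

namespace Splice

variable {inc : E → V → Prop} {Q : Set V} {n : ℕ} {p q : Fin n → E} {x y : Fin n → V}

theorem glue_q (S : Splice inc Q p q x y) (i : Fin n) : glue p q (q i) = p i := by
  have h : ∃ j, q i = q j := ⟨i, rfl⟩
  rw [glue, dif_pos h]
  exact congrArg p (S.q_inj h.choose_spec).symm

theorem glue_of_ne {f : E} (h : ∀ i, f ≠ q i) : glue p q f = f := by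
  rw [glue, dif_neg]
  rintro ⟨i, hi⟩
  exact h i hi

theorem glue_p (S : Splice inc Q p q x y) (i : Fin n) : glue p q (p i) = p i :=
  glue_of_ne (S.p_ne_q i)

theorem eq_x (S : Splice inc Q p q x y) (hc : IsCubic inc) {i : Fin n} {v : V} (hv : v ∉ Q)
    (h : inc (p i) v) : v = x i := by
  obtain ⟨u, hu, hpu⟩ := S.p_mem i
  have hj : Joins inc (p i) u (x i) := ⟨fun hh => S.x_notMem i (hh ▸ hu), hpu, S.p_x i⟩
  rcases hc.eq_or_eq hj h with rfl | rfl
  · exact absurd hu hv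
  · rfl

theorem eq_y (S : Splice inc Q p q x y) (hc : IsCubic inc) {i : Fin n} {v : V} (hv : v ∉ Q)
    (h : inc (q i) v) : v = y i := by
  obtain ⟨u, hu, hpu⟩ := S.q_mem i
  have hj : Joins inc (q i) u (y i) := ⟨fun hh => S.y_notMem i (hh ▸ hu), hpu, S.q_y i⟩
  rcases hc.eq_or_eq hj h with rfl | rfl
  · exact absurd hu hv
  · rfl

theorem glue_eq_glue (S : Splice inc Q p q x y) {f g : E} (h : glue p q f = glue p q g)
    (hne : f ≠ g) : ∃ i, (f = p i ∧ g = q i) ∨ (f = q i ∧ g = p i) := by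
  by_cases hf : ∃ i, f = q i <;> by_cases hg : ∃ i, g = q i
  · obtain ⟨i, rfl⟩ := hf
    obtain ⟨j, rfl⟩ := hg
    rw [S.glue_q, S.glue_q] at h
    exact absurd (congrArg q (S.p_inj h)) hne
  · obtain ⟨i, rfl⟩ := hf
    push Not at hg
    rw [S.glue_q, glue_of_ne hg] at h
    exact ⟨i, Or.inr ⟨rfl, h.symm⟩⟩
  · obtain ⟨i, rfl⟩ := hg
    push Not at hf
    rw [S.glue_q, glue_of_ne hf] at h
    exact ⟨i, Or.inl ⟨h, rfl⟩⟩
  · push Not at hf hg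
    rw [glue_of_ne hf, glue_of_ne hg] at h
    exact absurd h hne

/-- Because `x i ≠ y i`, joining `p i` and `q i` makes no loop: only one of them ends at a given
vertex outside `Q`. -/
theorem glue_injOn (S : Splice inc Q p q x y) (hc : IsCubic inc) {f g : E} {v : V} (hv : v ∉ Q)
    (hf : inc f v) (hg : inc g v) (h : glue p q f = glue p q g) : f = g := by
  by_contra hne
  obtain ⟨i, ⟨rfl, rfl⟩ | ⟨rfl, rfl⟩⟩ := S.glue_eq_glue h hne
  · exact S.ne i ((S.eq_x hc hv hf).symm.trans (S.eq_y hc hv hg))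
  · exact S.ne i ((S.eq_x hc hv hg).symm.trans (S.eq_y hc hv hf))

theorem glue_mem (S : Splice inc Q p q x y) {f : E} {v : V} (hv : v ∉ Q) (hf : inc f v) :
    (∃ v ∉ Q, inc (glue p q f) v) ∧ ∀ i, glue p q f ≠ q i := by
  by_cases h : ∃ i, f = q i
  · obtain ⟨i, rfl⟩ := h
    rw [S.glue_q]
    exact ⟨⟨x i, S.x_notMem i, S.p_x i⟩, S.p_ne_q i⟩
  · push Not at h
    rw [glue_of_ne h]
    exact ⟨⟨v, hv, hf⟩, h⟩

theorem isCubic (S : Splice inc Q p q x y) (hc : IsCubic inc) :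
    IsCubic (spliceInc inc Q p q) := by
  refine ⟨?_, ?_⟩
  · rintro ⟨e, ⟨v, hv, hev⟩, heq⟩
    by_cases hp : ∃ i, e = p i
    · obtain ⟨i, rfl⟩ := hp
      refine ⟨⟨x i, S.x_notMem i⟩, ⟨y i, S.y_notMem i⟩, fun h => S.ne i (congrArg Subtype.val h),
        ?_⟩
      rintro ⟨w, hw⟩
      constructor
      · rintro ⟨f, hf, hfw⟩
        dsimp only at hf hfw
        by_cases hfp : f = p i
        · left
          subst hfp
          exact Subtype.ext (S.eq_x hc hw hfw)
        · right
          obtain ⟨j, ⟨h1, h2⟩ | ⟨h1, h2⟩⟩ := S.glue_eq_glue (hf.trans (S.glue_p i).symm) hfp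
          · exact absurd h2 (S.p_ne_q i j)
          · have := S.p_inj h2
            subst this h1
            exact Subtype.ext (S.eq_y hc hw hfw)
      · rintro (h | h)
        · cases h
          exact ⟨p i, S.glue_p i, S.p_x i⟩
        · cases h
          exact ⟨q i, S.glue_q i, S.q_y i⟩
    · push Not at hp
      obtain ⟨w, hw⟩ := hc.exists_joins hev
      have hwQ : w ∉ Q := fun h => by
        obtain ⟨i, hi | hi⟩ := S.cross e w v hw.2.2 hev h hv
        · exact hp i hi
        · exact heq i hi
      refine ⟨⟨v, hv⟩, ⟨w, hwQ⟩, fun h => hw.1 (congrArg Subtype.val h), ?_⟩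
      rintro ⟨z, hz⟩
      constructor
      · rintro ⟨f, hf, hfz⟩
        dsimp only at hf hfz
        by_cases hfe : f = e
        · subst hfe
          rcases hc.eq_or_eq hw hfz with rfl | rfl
          · exact Or.inl rfl
          · exact Or.inr rfl
        · obtain ⟨j, ⟨h1, h2⟩ | ⟨h1, h2⟩⟩ :=
            S.glue_eq_glue (hf.trans (glue_of_ne heq).symm) hfe
          · exact absurd h2 (heq j)
          · exact absurd h2 (hp j)
      · rintro (h | h)
        · cases h
          exact ⟨e, glue_of_ne heq, hev⟩
        · cases h
          exact ⟨e, glue_of_ne heq, hw.2.2⟩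
  · rintro ⟨v, hv⟩
    obtain ⟨e, f, g, hef, heg, hfg, hall⟩ := hc.star v
    have he := (hall e).2 (by simp)
    have hf := (hall f).2 (by simp)
    have hg := (hall g).2 (by simp)
    refine ⟨⟨glue p q e, S.glue_mem hv he⟩, ⟨glue p q f, S.glue_mem hv hf⟩,
      ⟨glue p q g, S.glue_mem hv hg⟩, ?_, ?_, ?_, ?_⟩
    · exact fun h => hef (S.glue_injOn hc hv he hf (congrArg Subtype.val h))
    · exact fun h => heg (S.glue_injOn hc hv he hg (congrArg Subtype.val h))
    · exact fun h => hfg (S.glue_injOn hc hv hf hg (congrArg Subtype.val h))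
    · rintro ⟨h, hh⟩
      constructor
      · rintro ⟨k, rfl, hk⟩
        rcases (hall k).1 hk with rfl | rfl | rfl
        · exact Or.inl rfl
        · exact Or.inr (Or.inl rfl)
        · exact Or.inr (Or.inr rfl)
      · rintro (h | h | h)
        · cases h; exact ⟨e, rfl, he⟩
        · cases h; exact ⟨f, rfl, hf⟩
        · cases h; exact ⟨g, rfl, hg⟩

theorem exists_coloring (S : Splice inc Q p q x y) (hc : IsCubic inc)
    (h : Colorable (spliceInc inc Q p q)) : ∃ φ : E → Fin 11, (∀ i, φ (p i) = φ (q i)) ∧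
      ∀ v ∉ Q, ∀ e f, inc e v → inc f v → e ≠ f → Far (φ e) (φ f) := by
  classical
  obtain ⟨φ, hφ⟩ := h
  refine ⟨fun e => if h : (∃ v ∉ Q, inc (glue p q e) v) ∧ ∀ i, glue p q e ≠ q i then
    φ ⟨glue p q e, h⟩ else 0, fun i => ?_, fun v hv e f he hf hef => ?_⟩
  · simp only [S.glue_q, S.glue_p]
  · dsimp only
    rw [dif_pos (S.glue_mem hv he), dif_pos (S.glue_mem hv hf)]
    refine hφ ⟨v, hv⟩ _ _ ⟨e, rfl, he⟩ ⟨f, rfl, hf⟩ fun hh => hef ?_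
    exact S.glue_injOn hc hv he hf (congrArg Subtype.val hh)

/-- A colouring of the spliced graph extends if the edges inside `Q` can be coloured. -/
theorem colorable (S : Splice inc Q p q x y) (hc : IsCubic inc)
    (h : Colorable (spliceInc inc Q p q))
    (hext : ∀ φ : E → Fin 11, (∀ i, φ (p i) = φ (q i)) →
      (∀ v ∉ Q, ∀ e f, inc e v → inc f v → e ≠ f → Far (φ e) (φ f)) →
      ∃ ψ : E → Fin 11, (∀ v ∉ Q, ∀ e, inc e v → ψ e = φ e) ∧
        ∀ v ∈ Q, ∀ e f, inc e v → inc f v → e ≠ f → Far (ψ e) (ψ f)) : Colorable inc := by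
  obtain ⟨φ, h1, h2⟩ := S.exists_coloring hc h
  obtain ⟨ψ, h3, h4⟩ := hext φ h1 h2
  refine ⟨ψ, fun v e f he hf hef => ?_⟩
  by_cases hv : v ∈ Q
  · exact h4 v hv e f he hf hef
  · rw [h3 v hv e he, h3 v hv f hf]
    exact h2 v hv e f he hf hef

/-- If every pair had an end in `X`, adding `Q` to `X` would give a cut of the original graph over
the same single glued edge. Since that cut has at least two edges, they are the two halves of one
pair, and both outer ends of this pair lie outside `X`. -/
theorem not_all_mem (S : Splice inc Q p q x y) (hc : IsCubic inc) (hb : NoBridge inc)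
    {X : Set {v // v ∉ Q}} {e : SpliceEdge inc Q q} (hX : Crosses (spliceInc inc Q p q) X e)
    (huniq : ∀ f, Crosses (spliceInc inc Q p q) X f → f = e) :
    ∃ i, ⟨x i, S.x_notMem i⟩ ∉ X ∧ ⟨y i, S.y_notMem i⟩ ∉ X := by
  by_contra hcon
  push Not at hcon
  have hxy : ∀ i, (⟨x i, S.x_notMem i⟩ : {v // v ∉ Q}) ∈ X ∨ ⟨y i, S.y_notMem i⟩ ∈ X := fun i => by
    by_cases h : (⟨x i, S.x_notMem i⟩ : {v // v ∉ Q}) ∈ X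
    · exact Or.inl h
    · exact Or.inr (hcon i h)
  -- This is the union of `X` and `Q`.
  let Y : Set V := {v | ∀ h : v ∉ Q, ⟨v, h⟩ ∈ X}
  have hYQ : ∀ v ∈ Q, v ∈ Y := fun v hv h => absurd hv h
  have hYn : ∀ v, v ∉ Y → ∃ h : v ∉ Q, (⟨v, h⟩ : {v // v ∉ Q}) ∉ X := fun v hv => by
    by_contra hh
    push Not at hh
    exact hv hh
  obtain ⟨⟨u, hu⟩, huX, ⟨v, hv⟩, hvX, ⟨f₁, hf₁, hu₁⟩, f₂, hf₂, hv₂⟩ := hX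
  dsimp only at hu₁ hv₂
  have hvY : v ∉ Y := fun h => hvX (h hv)
  have hcr : Crosses inc Y f₂ := by
    by_cases hff : f₁ = f₂
    · subst hff
      exact ⟨u, fun _ => huX, v, hvY, hu₁, hv₂⟩
    · obtain ⟨i, ⟨-, rfl⟩ | ⟨-, rfl⟩⟩ := S.glue_eq_glue (hf₁.trans hf₂.symm) hff
      · obtain ⟨z, hz, hpz⟩ := S.q_mem i
        exact ⟨z, hYQ z hz, v, hvY, hpz, hv₂⟩
      · obtain ⟨z, hz, hpz⟩ := S.p_mem i
        exact ⟨z, hYQ z hz, v, hvY, hpz, hv₂⟩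
  obtain ⟨g, hgf, a, ha, b, hb', hga, hgb⟩ := hb _ _ hcr
  obtain ⟨hbQ, hbX⟩ := hYn b hb'
  have hge : glue p q g = e.1 := by
    have : Crosses (spliceInc inc Q p q) X ⟨glue p q g, S.glue_mem hbQ hgb⟩ := by
      by_cases haQ : a ∈ Q
      · obtain ⟨i, rfl | rfl⟩ := S.cross g a b hga hgb haQ hbQ
        · have := S.eq_x hc hbQ hgb
          subst this
          exact ⟨_, (hxy i).resolve_left hbX, _, hbX, ⟨q i, (S.glue_q i).trans (S.glue_p i).symm, S.q_y i⟩,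
            p i, rfl, hgb⟩
        · have := S.eq_y hc hbQ hgb
          subst this
          exact ⟨_, (hxy i).resolve_right hbX, _, hbX, ⟨p i, (S.glue_p i).trans (S.glue_q i).symm, S.p_x i⟩,
            q i, rfl, hgb⟩
      · exact ⟨⟨a, haQ⟩, ha haQ, ⟨b, hbQ⟩, hbX, ⟨g, rfl, hga⟩, g, rfl, hgb⟩
    exact congrArg Subtype.val (huniq _ this)
  obtain ⟨i, ⟨rfl, rfl⟩ | ⟨rfl, rfl⟩⟩ := S.glue_eq_glue (hge.trans hf₂.symm) hgf
  · have h1 := S.eq_x hc hbQ hgb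
    have h2 := S.eq_y hc hv hv₂
    subst h1 h2
    exact (hxy i).elim hbX hvX
  · have h1 := S.eq_y hc hbQ hgb
    have h2 := S.eq_x hc hv hv₂
    subst h1 h2
    exact (hxy i).elim hvX hbX

theorem crosses_compl {inc : E → V → Prop} {X : Set V} {e : E} (h : Crosses inc X e) :
    Crosses inc Xᶜ e := by
  obtain ⟨u, hu, v, hv, h1, h2⟩ := h
  exact ⟨v, hv, u, fun h => h hu, h2, h1⟩

/-- A bridge of the spliced graph separates two pairs. -/
theorem exists_separated (S : Splice inc Q p q x y) (hc : IsCubic inc) (hb : NoBridge inc)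
    {X : Set {v // v ∉ Q}} {e : SpliceEdge inc Q q} (hX : Crosses (spliceInc inc Q p q) X e)
    (huniq : ∀ f, Crosses (spliceInc inc Q p q) X f → f = e) :
    (∃ i, ⟨x i, S.x_notMem i⟩ ∉ X ∧ ⟨y i, S.y_notMem i⟩ ∉ X) ∧
      ∃ i, ⟨x i, S.x_notMem i⟩ ∈ X ∧ ⟨y i, S.y_notMem i⟩ ∈ X := by
  refine ⟨S.not_all_mem hc hb hX huniq, ?_⟩
  obtain ⟨i, h1, h2⟩ := S.not_all_mem hc hb (crosses_compl hX) fun f hf =>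
    huniq f (compl_compl X ▸ crosses_compl hf)
  exact ⟨i, not_not.1 h1, not_not.1 h2⟩

/-- A vertex that is an outer end of every pair cannot lie on both sides of a bridge. -/
theorem noBridge (S : Splice inc Q p q x y) (hc : IsCubic inc) (hb : NoBridge inc)
    (hy : ∀ i j, y i = y j) : NoBridge (spliceInc inc Q p q) := by
  intro X e hX
  by_contra hcon
  push Not at hcon
  obtain ⟨⟨i, -, h1⟩, j, -, h2⟩ := S.exists_separated hc hb hX fun f hf => by
    by_contra hfe
    exact hcon f hfe hf
  exact h1 (by simpa only [hy i j] using h2)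

end Splice

/-- Every bridgeless cubic graph obtained by splicing out a nonempty set can be coloured. -/
def SplicesColorable (inc : E → V → Prop) : Prop :=
  ∀ (Q : Set V) (n : ℕ) (p q : Fin n → E) (x y : Fin n → V), Q.Nonempty →
    Splice inc Q p q x y → NoBridge (spliceInc inc Q p q) → Colorable (spliceInc inc Q p q)

/-! ### Digons and triangles -/

/-- The values not far from a given one form an interval of five, and two such intervals cannot
cover eleven values. -/
theorem exists_far_common : ∀ a b : Fin 11, ∃ r, Far a r ∧ Far b r := by
  decide

/-- Three parallel edges form a component, so there are no pairs to join, and the component takes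
the values 0, 4, 7. -/
theorem colorable_of_triple {inc : E → V → Prop} (hc : IsCubic inc) (hb : NoBridge inc)
    (hr : SplicesColorable inc) {e f g : E} {x y : V} (hef : e ≠ f) (heg : e ≠ g) (hfg : f ≠ g)
    (he : Joins inc e x y) (hf : Joins inc f x y) (hg : Joins inc g x y) : Colorable inc := by
  classical
  have hx : ∀ h, inc h x → h = e ∨ h = f ∨ h = g := by
    obtain ⟨k, hk1, hk2, hk, hall⟩ := hc.exists_third he.2.1 hf.2.1 hef
    intro h hh
    have h1 := hall g hg.2.1
    have h2 := hall h hh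
    grind
  have hy : ∀ h, inc h y → h = e ∨ h = f ∨ h = g := by
    obtain ⟨k, hk1, hk2, hk, hall⟩ := hc.exists_third he.2.2 hf.2.2 hef
    intro h hh
    have h1 := hall g hg.2.2
    have h2 := hall h hh
    grind
  have hQ : ∀ h, (h = e ∨ h = f ∨ h = g) → ∀ v, inc h v → v ∈ ({x, y} : Set V) := by
    rintro h (rfl | rfl | rfl) v hv
    · exact hc.eq_or_eq he hv
    · exact hc.eq_or_eq hf hv
    · exact hc.eq_or_eq hg hv
  have S : Splice inc {x, y} (n := 0) ![] ![] ![] ![] := by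
    refine ⟨fun i => i.elim0, fun i => i.elim0, fun i => i.elim0, fun i => i.elim0,
      fun i => i.elim0, fun i => i.elim0, fun i => i.elim0, fun i => i.elim0, fun i => i.elim0,
      fun i => i.elim0, ?_⟩
    rintro h u v hu hv (rfl | rfl) hvQ
    · exact absurd (hQ h (hx h hu) v hv) hvQ
    · exact absurd (hQ h (hy h hu) v hv) hvQ
  refine S.colorable hc (hr _ _ _ _ _ _ ⟨x, Or.inl rfl⟩ S
    (S.noBridge hc hb fun i => i.elim0)) fun φ _ _ => ?_
  obtain ⟨ψ, hψ⟩ : ∃ ψ : E → Fin 11, ψ = fun h => if h = e then 0 else if h = f then 4 else if h = g then 7 else φ h :=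
    ⟨_, rfl⟩
  refine ⟨ψ, ?_, ?_⟩
  · intro v hv h hh
    rw [hψ]
    dsimp only
    rw [if_neg, if_neg, if_neg]
    · rintro rfl; exact hv (hQ h (by simp) v hh)
    · rintro rfl; exact hv (hQ h (by simp) v hh)
    · rintro rfl; exact hv (hQ h (by simp) v hh)
  · intro v hv h k hh hk hhk
    have hall : ∀ h, inc h v → h = e ∨ h = f ∨ h = g := by
      rcases hv with rfl | rfl
      · exact hx
      · exact hy
    refine far_of_three hall ?_ hh hk hhk
    simp only [hψ, if_true, if_neg hef.symm, if_neg heg.symm, if_neg hfg.symm]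
    decide

/-- The two edges leaving the digon are joined and get a common value. The parallel edges then need
two values far from it and from each other. -/
theorem colorable_of_digon {inc : E → V → Prop} (hc : IsCubic inc) (hb : NoBridge inc)
    (hr : SplicesColorable inc) {e f : E} {x y : V} (hef : e ≠ f) (he : Joins inc e x y)
    (hf : Joins inc f x y) : Colorable inc := by
  classical
  obtain ⟨k, hke, hkf, hk, hallx⟩ := hc.exists_third he.2.1 hf.2.1 hef
  obtain ⟨l, hle, hlf, hl, hally⟩ := hc.exists_third he.2.2 hf.2.2 hef
  by_cases hkl : k = l
  · subst hkl
    exact colorable_of_triple hc hb hr hef hke.symm hkf.symm he hf ⟨he.1, hk, hl⟩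
  obtain ⟨x', hx'⟩ := hc.exists_joins hk
  obtain ⟨y', hy'⟩ := hc.exists_joins hl
  have hky : ¬ inc k y := fun h => by rcases hally k h with h | h | h <;> grind
  have hlx : ¬ inc l x := fun h => by rcases hallx l h with h | h | h <;> grind
  have hxQ : x' ∉ ({x, y} : Set V) := by
    rintro (h | h)
    · exact hx'.1 h.symm
    · exact hky (h ▸ hx'.2.2)
  have hyQ : y' ∉ ({x, y} : Set V) := by
    rintro (h | h)
    · exact hlx (h ▸ hy'.2.2)
    · exact hy'.1 h.symm
  have hinner : ∀ v ∉ ({x, y} : Set V), ¬ inc e v ∧ ¬ inc f v := fun v hv =>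
    ⟨fun h => hv (hc.eq_or_eq he h), fun h => hv (hc.eq_or_eq hf h)⟩
  -- If the two leaving edges met again, the third edge at their meeting point would be a bridge.
  have hxy' : x' ≠ y' := by
    rintro rfl
    obtain ⟨g, hgk, hgl, hg, hall⟩ := hc.exists_third hx'.2.2 hy'.2.2 hkl
    obtain ⟨z, hz⟩ := hc.exists_joins hg
    have hge : g ≠ e := by rintro rfl; exact (hinner _ hxQ).1 hg
    have hgf : g ≠ f := by rintro rfl; exact (hinner _ hxQ).2 hg
    have hzX : z ∉ ({x, y, x'} : Set V) := by
      rintro (rfl | rfl | rfl)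
      · rcases hallx g hz.2.2 with h | h | h
        · exact hge h
        · exact hgf h
        · exact hgk h
      · rcases hally g hz.2.2 with h | h | h
        · exact hge h
        · exact hgf h
        · exact hgl h
      · exact hz.1 rfl
    obtain ⟨h, hhg, a, ha, b, hbX, hha, hhb⟩ :=
      hb {x, y, x'} g ⟨x', by simp, z, hzX, hg, hz.2.2⟩
    have hcases : h = e ∨ h = f ∨ h = k ∨ h = l := by
      rcases ha with rfl | rfl | rfl
      · rcases hallx h hha with h1 | h1 | h1 <;> simp [h1]
      · rcases hally h hha with h1 | h1 | h1 <;> simp [h1]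
      · rcases hall h hha with h1 | h1 | h1
        · simp [h1]
        · simp [h1]
        · exact absurd h1 hhg
    apply hbX
    rcases hcases with rfl | rfl | rfl | rfl
    · rcases hc.eq_or_eq he hhb with h | h <;> simp [h]
    · rcases hc.eq_or_eq hf hhb with h | h <;> simp [h]
    · rcases hc.eq_or_eq hx' hhb with h | h <;> simp [h]
    · rcases hc.eq_or_eq hy' hhb with h | h <;> simp [h]
  have S : Splice inc {x, y} ![k] ![l] ![x'] ![y'] := by
    refine ⟨by simpa using hx'.2.2, by simpa using hy'.2.2, by simpa using hxQ, by simpa using hyQ,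
      by simp [hk], by simp [hl], by simpa using hxy', Function.injective_of_subsingleton _,
      Function.injective_of_subsingleton _, by simpa using hkl, ?_⟩
    rintro h u v hu hv (rfl | rfl) hvQ
    · rcases hallx h hu with rfl | rfl | rfl
      · exact absurd hv (hinner v hvQ).1
      · exact absurd hv (hinner v hvQ).2
      · exact ⟨0, Or.inl rfl⟩
    · rcases hally h hu with rfl | rfl | rfl
      · exact absurd hv (hinner v hvQ).1
      · exact absurd hv (hinner v hvQ).2
      · exact ⟨0, Or.inr rfl⟩
  refine S.colorable hc (hr _ _ _ _ _ _ ⟨x, Or.inl rfl⟩ S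
    (S.noBridge hc hb fun i j => by rw [Subsingleton.elim i j])) fun φ hφ _ => ?_
  have hφ0 : φ k = φ l := hφ 0
  obtain ⟨a, h1, -⟩ := exists_far_common (φ k) (φ k)
  obtain ⟨b, h2, h3⟩ := exists_far_common (φ k) a
  obtain ⟨ψ, hψ⟩ : ∃ ψ : E → Fin 11, ψ = fun h => if h = e then a else if h = f then b else φ h :=
    ⟨_, rfl⟩
  refine ⟨ψ, ?_, ?_⟩
  · intro v hv h hh
    rw [hψ]
    dsimp only
    rw [if_neg, if_neg]
    · rintro rfl; exact (hinner v hv).2 hh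
    · rintro rfl; exact (hinner v hv).1 hh
  · rintro v (rfl | rfl) h h' hh hh' hne
    · refine far_of_three hallx ?_ hh hh' hne
      simp only [hψ, if_true, if_neg hef.symm, if_neg hke, if_neg hkf]
      exact ⟨h3, h1.symm, h2.symm⟩
    · refine far_of_three hally ?_ hh hh' hne
      simp only [hψ, if_true, if_neg hef.symm, if_neg hle, if_neg hlf, ← hφ0]
      exact ⟨h3, h1.symm, h2.symm⟩

/-- Deleting `y` and `z` and joining each of their leaving edges to the triangle edge from the other
vertex to `x` amounts to contracting the triangle to `x`. Both pairs have `x` as an outer end, so no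
bridge arises. -/
theorem colorable_of_triangle {inc : E → V → Prop} (hc : IsCubic inc) (hb : NoBridge inc)
    (hs : NoDigon inc) (hr : SplicesColorable inc) {e f g : E} {x y z : V}
    (he : Joins inc e x y) (hf : Joins inc f y z) (hg : Joins inc g z x) : Colorable inc := by
  classical
  have hef : e ≠ f := by
    rintro rfl
    rcases hc.eq_or_eq he hf.2.2 with h | h
    · exact hg.1 h
    · exact hf.1 h.symm
  have hfg : f ≠ g := by
    rintro rfl
    rcases hc.eq_or_eq hf hg.2.2 with h | h
    · exact he.1 h
    · exact hg.1 h.symm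
  have heg : e ≠ g := by
    rintro rfl
    rcases hc.eq_or_eq he hg.2.1 with h | h
    · exact hg.1 h
    · exact hf.1 h.symm
  obtain ⟨k, hke, hkf, hk, hally⟩ := hc.exists_third he.2.2 hf.2.1 hef
  obtain ⟨l, hlf, hlg, hl, hallz⟩ := hc.exists_third hf.2.2 hg.2.1 hfg
  obtain ⟨m, hme, hmg, hm, hallx⟩ := hc.exists_third he.2.1 hg.2.2 heg
  obtain ⟨y', hy'⟩ := hc.exists_joins hk
  obtain ⟨z', hz'⟩ := hc.exists_joins hl
  have hyz : y' ≠ z := by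
    rintro rfl
    exact hkf (hs _ _ _ _ hy' hf)
  have hzy : z' ≠ y := by
    rintro rfl
    exact hlf (hs _ _ _ _ hz' hf.symm)
  have hyx : y' ≠ x := by
    rintro rfl
    exact hke (hs _ _ _ _ hy' he.symm)
  have hzx : z' ≠ x := by
    rintro rfl
    exact hlg (hs _ _ _ _ hz' hg)
  have hkl : k ≠ l := by
    rintro rfl
    rcases hc.eq_or_eq hy' hl with h | h
    · exact hf.1 h.symm
    · exact hyz h.symm
  have hkg : k ≠ g := by
    rintro rfl
    rcases hc.eq_or_eq hy' hg.2.1 with h | h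
    · exact hf.1 h.symm
    · exact hyz h.symm
  have hle : l ≠ e := by
    rintro rfl
    rcases hc.eq_or_eq hz' he.2.2 with h | h
    · exact hf.1 h
    · exact hzy h.symm
  have hxQ : x ∉ ({y, z} : Set V) := by
    rintro (h | h)
    · exact he.1 h
    · exact hg.1 h.symm
  have hyQ : y' ∉ ({y, z} : Set V) := by
    rintro (h | h)
    · exact hy'.1 h.symm
    · exact hyz h
  have hzQ : z' ∉ ({y, z} : Set V) := by
    rintro (h | h)
    · exact hzy h
    · exact hz'.1 h.symm
  have hinner : ∀ v ∉ ({y, z} : Set V), ¬ inc f v := fun v hv h => hv (hc.eq_or_eq hf h)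
  have S : Splice inc {y, z} ![k, l] ![g, e] ![y', z'] ![x, x] := by
    refine ⟨?_, ?_, ?_, ?_, ?_, ?_, ?_, ?_, ?_, ?_, ?_⟩
    · simpa [Fin.forall_fin_two] using ⟨hy'.2.2, hz'.2.2⟩
    · simpa [Fin.forall_fin_two] using ⟨hg.2.2, he.2.1⟩
    · rw [Fin.forall_fin_two]; exact ⟨hyQ, hzQ⟩
    · rw [Fin.forall_fin_two]; exact ⟨hxQ, hxQ⟩
    · rw [Fin.forall_fin_two]; exact ⟨⟨y, by simp, hk⟩, ⟨z, by simp, hl⟩⟩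
    · rw [Fin.forall_fin_two]; exact ⟨⟨z, by simp, hg.2.1⟩, ⟨y, by simp, he.2.2⟩⟩
    · rw [Fin.forall_fin_two]; exact ⟨hyx, hzx⟩
    · intro i j; fin_cases i <;> fin_cases j <;> simp [hkl, hkl.symm]
    · intro i j; fin_cases i <;> fin_cases j <;> simp [heg, heg.symm]
    · intro i j; fin_cases i <;> fin_cases j <;> simp [hkg, hke, hlg, hle]
    · rintro h u v hu hv (rfl | rfl) hvQ
      · rcases hally h hu with rfl | rfl | rfl
        · exact ⟨1, Or.inr rfl⟩
        · exact absurd hv (hinner v hvQ)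
        · exact ⟨0, Or.inl rfl⟩
      · rcases hallz h hu with rfl | rfl | rfl
        · exact absurd hv (hinner v hvQ)
        · exact ⟨0, Or.inr rfl⟩
        · exact ⟨1, Or.inl rfl⟩
  refine S.colorable hc (hr _ _ _ _ _ _ ⟨y, Or.inl rfl⟩ S
    (S.noBridge hc hb fun i j => by fin_cases i <;> fin_cases j <;> rfl)) fun φ hφ hfar => ?_
  have hφ0 : φ k = φ g := hφ 0
  have hφ1 : φ l = φ e := hφ 1
  have h1 := hfar x hxQ e g he.2.1 hg.2.2 heg
  have h2 := hfar x hxQ m e hm he.2.1 hme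
  have h3 := hfar x hxQ m g hm hg.2.2 hmg
  -- At `y` and at `z` the two other edges have the values of `e` and `g`, so `f` can take the value
  -- of the third edge at `x`.
  obtain ⟨ψ, hψ⟩ : ∃ ψ : E → Fin 11, ψ = fun h => if h = f then φ m else φ h :=
    ⟨_, rfl⟩
  refine ⟨ψ, ?_, ?_⟩
  · intro v hv h hh
    rw [hψ]
    dsimp only
    rw [if_neg]
    rintro rfl; exact hinner v hv hh
  · rintro v (rfl | rfl) h h' hh hh' hne
    · refine far_of_three hally ?_ hh hh' hne
      simp only [hψ, if_true, if_neg hef, if_neg hkf, hφ0]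
      exact ⟨h2.symm, h1, h3⟩
    · refine far_of_three hallz ?_ hh hh' hne
      simp only [hψ, if_true, if_neg hfg.symm, if_neg hlf, hφ1]
      exact ⟨h3, h2, h1.symm⟩

/-! ### Cycles of length four -/

/-- A cycle `a b c d` of length four together with the edges leaving it. -/
structure Square (inc : E → V → Prop) (Q : Set V) (a b c d a' b' c' d' : V)
    (e₁ e₂ e₃ e₄ la lb lc ld : E) : Prop where
  mem : ∀ v, v ∈ Q ↔ v = a ∨ v = b ∨ v = c ∨ v = d
  j₁ : Joins inc e₁ a b
  j₂ : Joins inc e₂ b c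
  j₃ : Joins inc e₃ c d
  j₄ : Joins inc e₄ d a
  ja : Joins inc la a a'
  jb : Joins inc lb b b'
  jc : Joins inc lc c c'
  jd : Joins inc ld d d'
  alla : ∀ h, inc h a → h = e₁ ∨ h = e₄ ∨ h = la
  allb : ∀ h, inc h b → h = e₂ ∨ h = e₁ ∨ h = lb
  allc : ∀ h, inc h c → h = e₃ ∨ h = e₂ ∨ h = lc
  alld : ∀ h, inc h d → h = e₄ ∨ h = e₃ ∨ h = ld
  na : a' ∉ Q
  nb : b' ∉ Q
  nc : c' ∉ Q
  nd : d' ∉ Q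
  ab : a' ≠ b'
  bc : b' ≠ c'
  cd : c' ≠ d'
  da : d' ≠ a'
  ac : a ≠ c
  bd : b ≠ d

namespace Square

variable {inc : E → V → Prop} {Q : Set V} {a b c d a' b' c' d' : V}
  {e₁ e₂ e₃ e₄ la lb lc ld : E}

/-- Turning the cycle by one step exchanges the two ways of pairing consecutive leaving edges. -/
theorem rotate (S : Square inc Q a b c d a' b' c' d' e₁ e₂ e₃ e₄ la lb lc ld) :
    Square inc Q b c d a b' c' d' a' e₂ e₃ e₄ e₁ lb lc ld la :=
  ⟨fun v => by rw [S.mem v]; tauto, S.j₂, S.j₃, S.j₄, S.j₁, S.jb, S.jc, S.jd, S.ja, S.allb, S.allc,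
    S.alld, S.alla, S.nb, S.nc, S.nd, S.na, S.bc, S.cd, S.da, S.ab, S.bd, S.ac.symm⟩

theorem ne_of_joins (hc : IsCubic inc) {e f : E} {x y z w : V} (he : Joins inc e x y)
    (hf : Joins inc f z w) (h1 : x ≠ z) (h2 : x ≠ w) : e ≠ f := by
  rintro rfl
  exact (hc.eq_or_eq hf he.2.1).elim h1 h2

theorem a_mem (S : Square inc Q a b c d a' b' c' d' e₁ e₂ e₃ e₄ la lb lc ld) : a ∈ Q :=
  (S.mem a).2 (by simp)

theorem ne_of_mem {v w : V} (hv : v ∈ Q) (hw : w ∉ Q) : v ≠ w := fun h => hw (h ▸ hv)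

theorem splice (S : Square inc Q a b c d a' b' c' d' e₁ e₂ e₃ e₄ la lb lc ld) (hc : IsCubic inc) :
    Splice inc Q ![la, lc] ![lb, ld] ![a', c'] ![b', d'] := by
  have ma := S.a_mem
  have mb := S.rotate.a_mem
  have mc := S.rotate.rotate.a_mem
  have md := S.rotate.rotate.rotate.a_mem
  have hab : la ≠ lb := ne_of_joins hc S.ja S.jb S.j₁.1 (ne_of_mem ma S.nb)
  have had : la ≠ ld := ne_of_joins hc S.ja S.jd S.j₄.1.symm (ne_of_mem ma S.nd)
  have hac : la ≠ lc := ne_of_joins hc S.ja S.jc S.ac (ne_of_mem ma S.nc)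
  have hbd : lb ≠ ld := ne_of_joins hc S.jb S.jd S.bd (ne_of_mem mb S.nd)
  have hcb : lc ≠ lb := ne_of_joins hc S.jc S.jb S.j₂.1.symm (ne_of_mem mc S.nb)
  have hcd : lc ≠ ld := ne_of_joins hc S.jc S.jd S.j₃.1 (ne_of_mem mc S.nd)
  refine ⟨?_, ?_, ?_, ?_, ?_, ?_, ?_, ?_, ?_, ?_, ?_⟩
  · rw [Fin.forall_fin_two]; exact ⟨S.ja.2.2, S.jc.2.2⟩
  · rw [Fin.forall_fin_two]; exact ⟨S.jb.2.2, S.jd.2.2⟩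
  · rw [Fin.forall_fin_two]; exact ⟨S.na, S.nc⟩
  · rw [Fin.forall_fin_two]; exact ⟨S.nb, S.nd⟩
  · rw [Fin.forall_fin_two]; exact ⟨⟨a, ma, S.ja.2.1⟩, ⟨c, mc, S.jc.2.1⟩⟩
  · rw [Fin.forall_fin_two]; exact ⟨⟨b, mb, S.jb.2.1⟩, ⟨d, md, S.jd.2.1⟩⟩
  · rw [Fin.forall_fin_two]; exact ⟨S.ab, S.cd⟩
  · intro i j; fin_cases i <;> fin_cases j <;> simp [hac, hac.symm]
  · intro i j; fin_cases i <;> fin_cases j <;> simp [hbd, hbd.symm]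
  · intro i j; fin_cases i <;> fin_cases j <;> simp [hab, had, hcb, hcd]
  · intro h u v hu hv huQ hvQ
    have hin : ∀ {e x y}, x ∈ Q → y ∈ Q → Joins inc e x y → ¬ inc e v := fun hx hy hj hh =>
      (hc.eq_or_eq hj hh).elim (fun h => hvQ (h ▸ hx)) (fun h => hvQ (h ▸ hy))
    have i1 := hin ma mb S.j₁
    have i2 := hin mb mc S.j₂
    have i3 := hin mc md S.j₃
    have i4 := hin md ma S.j₄
    rcases (S.mem u).1 huQ with rfl | rfl | rfl | rfl
    · rcases S.alla h hu with rfl | rfl | rfl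
      · exact absurd hv i1
      · exact absurd hv i4
      · exact ⟨0, Or.inl rfl⟩
    · rcases S.allb h hu with rfl | rfl | rfl
      · exact absurd hv i2
      · exact absurd hv i1
      · exact ⟨0, Or.inr rfl⟩
    · rcases S.allc h hu with rfl | rfl | rfl
      · exact absurd hv i3
      · exact absurd hv i2
      · exact ⟨1, Or.inl rfl⟩
    · rcases S.alld h hu with rfl | rfl | rfl
      · exact absurd hv i4
      · exact absurd hv i3
      · exact ⟨1, Or.inr rfl⟩

/-- The opposite edges `e₂` and `e₄` share a value far from both pair values. Each of `e₁` and `e₃`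
then only has to avoid that value and the value of its own pair. -/
theorem colorable (S : Square inc Q a b c d a' b' c' d' e₁ e₂ e₃ e₄ la lb lc ld)
    (hc : IsCubic inc) (h : Colorable (spliceInc inc Q ![la, lc] ![lb, ld])) : Colorable inc := by
  classical
  have ma := S.a_mem
  have mb := S.rotate.a_mem
  have mc := S.rotate.rotate.a_mem
  have md := S.rotate.rotate.rotate.a_mem
  refine (S.splice hc).colorable hc h fun φ hφ _ => ?_
  have hφ0 : φ la = φ lb := hφ 0
  have hφ1 : φ lc = φ ld := hφ 1
  obtain ⟨r, h1, h2⟩ := exists_far_common (φ la) (φ lc)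
  obtain ⟨s, h3, h4⟩ := exists_far_common (φ la) r
  obtain ⟨t, h5, h6⟩ := exists_far_common (φ lc) r
  replace h3 := h3.symm
  replace h4 := h4.symm
  replace h5 := h5.symm
  replace h6 := h6.symm
  have n12 : e₁ ≠ e₂ := ne_of_joins hc S.j₁ S.j₂ S.j₁.1 S.ac
  have n13 : e₁ ≠ e₃ := ne_of_joins hc S.j₁ S.j₃ S.ac S.j₄.1.symm
  have n14 : e₁ ≠ e₄ := ne_of_joins hc S.j₁.symm S.j₄ S.bd S.j₁.1.symm
  have n23 : e₂ ≠ e₃ := ne_of_joins hc S.j₂ S.j₃ S.j₂.1 S.bd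
  have n24 : e₂ ≠ e₄ := ne_of_joins hc S.j₂ S.j₄ S.bd S.j₁.1.symm
  have n34 : e₃ ≠ e₄ := ne_of_joins hc S.j₃ S.j₄ S.j₃.1 S.ac.symm
  have hout : ∀ {l e x x' y z}, Joins inc l x x' → Joins inc e y z → x' ∉ Q → y ∈ Q → z ∈ Q →
      l ≠ e := fun hl he hx hy hz => ne_of_joins hc hl.symm he (ne_of_mem hy hx).symm
        (ne_of_mem hz hx).symm
  have hψ : ∀ {l x x'}, Joins inc l x x' → x' ∉ Q → l ≠ e₁ ∧ l ≠ e₂ ∧ l ≠ e₃ ∧ l ≠ e₄ :=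
    fun hl hx => ⟨hout hl S.j₁ hx ma mb, hout hl S.j₂ hx mb mc, hout hl S.j₃ hx mc md,
      hout hl S.j₄ hx md ma⟩
  let ψ : E → Fin 11 := fun h => if h = e₁ then s else if h = e₂ then r else if h = e₃ then t else
    if h = e₄ then r else φ h
  have v1 : ψ e₁ = s := by simp [ψ]
  have v2 : ψ e₂ = r := by simp [ψ, n12.symm]
  have v3 : ψ e₃ = t := by simp [ψ, n13.symm, n23.symm]
  have v4 : ψ e₄ = r := by simp [ψ, n14.symm, n24.symm, n34.symm]
  have vl : ∀ {l x x'}, Joins inc l x x' → x' ∉ Q → ψ l = φ l := fun hl hx => by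
    obtain ⟨g1, g2, g3, g4⟩ := hψ hl hx
    simp [ψ, g1, g2, g3, g4]
  refine ⟨ψ, ?_, ?_⟩
  · intro v hv l hl
    obtain ⟨x, hx⟩ := hc.exists_joins hl
    exact vl hx.symm hv
  · intro v hv l l' hl hl' hne
    rcases (S.mem v).1 hv with rfl | rfl | rfl | rfl
    · refine far_of_three S.alla ?_ hl hl' hne
      rw [v1, v4, vl S.ja S.na]
      exact ⟨h4, h3, h1.symm⟩
    · refine far_of_three S.allb ?_ hl hl' hne
      rw [v2, v1, vl S.jb S.nb, ← hφ0]
      exact ⟨h4.symm, h1.symm, h3⟩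
    · refine far_of_three S.allc ?_ hl hl' hne
      rw [v3, v2, vl S.jc S.nc]
      exact ⟨h6, h5, h2.symm⟩
    · refine far_of_three S.alld ?_ hl hl' hne
      rw [v4, v3, vl S.jd S.nd, ← hφ1]
      exact ⟨h6.symm, h2.symm, h5⟩

/-- If one of the two ways of splicing out a cycle of length four creates a bridge, then there is
a set that is left by only one edge away from the cycle and separates the pairs. -/
theorem exists_cut (S : Square inc Q a b c d a' b' c' d' e₁ e₂ e₃ e₄ la lb lc ld)
    (hc : IsCubic inc) (hb : NoBridge inc)
    (h : ¬ NoBridge (spliceInc inc Q ![la, lc] ![lb, ld])) :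
    ∃ (X : Set V) (e : E) (u v : V), inc e u ∧ inc e v ∧ u ∉ Q ∧ v ∉ Q ∧ u ∈ X ∧ v ∉ X ∧
      a' ∈ X ∧ b' ∈ X ∧ c' ∉ X ∧ d' ∉ X ∧
      ∀ f u v, inc f u → inc f v → u ∉ Q → v ∉ Q → u ∈ X → v ∉ X → f = e := by
  have T := S.splice hc
  have h01 : ∀ i : Fin 2, i = 0 ∨ i = 1 := by decide
  simp only [NoBridge] at h
  push Not at h
  obtain ⟨X, e, hX, huniq⟩ := h
  have huniq' : ∀ f, Crosses (spliceInc inc Q ![la, lc] ![lb, ld]) X f → f = e := fun f hf => by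
    by_contra hne
    exact huniq f hne hf
  have key : ∀ (X : Set {v // v ∉ Q}), Crosses (spliceInc inc Q ![la, lc] ![lb, ld]) X e →
      (∀ f, Crosses (spliceInc inc Q ![la, lc] ![lb, ld]) X f → f = e) →
      (⟨a', S.na⟩ ∈ X ∧ ⟨b', S.nb⟩ ∈ X) → (⟨c', S.nc⟩ ∉ X ∧ ⟨d', S.nd⟩ ∉ X) →
      ∃ (X : Set V) (e : E) (u v : V), inc e u ∧ inc e v ∧ u ∉ Q ∧ v ∉ Q ∧ u ∈ X ∧ v ∉ X ∧
      a' ∈ X ∧ b' ∈ X ∧ c' ∉ X ∧ d' ∉ X ∧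
      ∀ f u v, inc f u → inc f v → u ∉ Q → v ∉ Q → u ∈ X → v ∉ X → f = e := by
    rintro X ⟨⟨u, hu⟩, huX, ⟨v, hv⟩, hvX, ⟨f₁, hf₁, hu₁⟩, f₂, hf₂, hv₂⟩ huniq hx hy
    dsimp only at hu₁ hv₂
    -- The bridge is not a glued edge, as both outer ends of a pair lie on the same side; it is thus
    -- an edge of the original graph.
    have hff : f₁ = f₂ := by
      by_contra hne
      rcases T.glue_eq_glue (hf₁.trans hf₂.symm) hne with ⟨i, ⟨rfl, rfl⟩ | ⟨rfl, rfl⟩⟩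
      · have h1 := T.eq_x hc hu hu₁
        have h2 := T.eq_y hc hv hv₂
        subst h1 h2
        rcases h01 i with rfl | rfl
        · exact hvX hx.2
        · exact hy.1 huX
      · have h1 := T.eq_y hc hu hu₁
        have h2 := T.eq_x hc hv hv₂
        subst h1 h2
        rcases h01 i with rfl | rfl
        · exact hvX hx.1
        · exact hy.2 huX
    subst hff
    refine ⟨{v | ∃ h : v ∉ Q, (⟨v, h⟩ : {v // v ∉ Q}) ∈ X}, f₁, u, v, hu₁, hv₂, hu, hv, ⟨hu, huX⟩,
      fun ⟨_, h⟩ => hvX h, ⟨S.na, hx.1⟩, ⟨S.nb, hx.2⟩, fun ⟨_, h⟩ => hy.1 h, fun ⟨_, h⟩ => hy.2 h,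
      ?_⟩
    rintro f z w hfz hfw hz hw ⟨_, hzX⟩ hwX
    have hcr : Crosses (spliceInc inc Q ![la, lc] ![lb, ld]) X
        ⟨glue ![la, lc] ![lb, ld] f, T.glue_mem hz hfz⟩ :=
      ⟨⟨z, hz⟩, hzX, ⟨w, hw⟩, fun h => hwX ⟨hw, h⟩, ⟨f, rfl, hfz⟩, f, rfl, hfw⟩
    have hfe : glue ![la, lc] ![lb, ld] f = e.1 := congrArg Subtype.val (huniq _ hcr)
    by_contra hne
    have hPQ : ∀ i, (f ≠ ![la, lc] i) ∧ f ≠ ![lb, ld] i := by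
      intro i
      constructor
      · rintro rfl
        have h1 := T.eq_x hc hz hfz
        have h2 := T.eq_x hc hw hfw
        exact hwX ⟨hw, by simpa only [h2, ← h1] using hzX⟩
      · rintro rfl
        have h1 := T.eq_y hc hz hfz
        have h2 := T.eq_y hc hw hfw
        exact hwX ⟨hw, by simpa only [h2, ← h1] using hzX⟩
    obtain ⟨i, ⟨h, -⟩ | ⟨h, -⟩⟩ := T.glue_eq_glue (hfe.trans hf₁.symm) hne
    · exact (hPQ i).1 h
    · exact (hPQ i).2 h
  obtain ⟨⟨i, hi1, hi2⟩, j, hj1, hj2⟩ := T.exists_separated hc hb hX huniq'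
  have hij : i ≠ j := by
    rintro rfl
    exact hi1 hj1
  have h2 : (i = 0 ∧ j = 1) ∨ (i = 1 ∧ j = 0) :=
    (by decide : ∀ i j : Fin 2, i ≠ j → (i = 0 ∧ j = 1) ∨ (i = 1 ∧ j = 0)) i j hij
  rcases h2 with ⟨rfl, rfl⟩ | ⟨rfl, rfl⟩
  · exact key Xᶜ (Splice.crosses_compl hX)
      (fun f hf => huniq' f (compl_compl X ▸ Splice.crosses_compl hf)) ⟨hi1, hi2⟩
      ⟨fun h => h hj1, fun h => h hj2⟩
  · exact key X hX huniq' ⟨hj1, hj2⟩ ⟨hi1, hi2⟩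

/-- One of the two ways of splicing out a cycle of length four does not create a bridge. -/
theorem noBridge_or (S : Square inc Q a b c d a' b' c' d' e₁ e₂ e₃ e₄ la lb lc ld)
    (hc : IsCubic inc) (hb : NoBridge inc) :
    NoBridge (spliceInc inc Q ![la, lc] ![lb, ld]) ∨
      NoBridge (spliceInc inc Q ![lb, ld] ![lc, la]) := by
  by_contra hcon
  push Not at hcon
  obtain ⟨X, e, u, v, heu, hev, hu, hv, huX, hvX, xa, xb, xc, xd, hX⟩ := S.exists_cut hc hb hcon.1
  obtain ⟨Y, f, z, w, hfz, hfw, hz, hw, hzY, hwY, yb, yc, yd, ya, hY⟩ :=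
    S.rotate.exists_cut hc hb hcon.2
  have T := S.splice hc
  have hcross : ∀ g s t, inc g s → inc g t → s ∉ Q → t ∉ Q →
      (s ∈ X ∧ t ∉ X → g = e ∧ s = u ∧ t = v) ∧ (s ∈ Y ∧ t ∉ Y → g = f ∧ s = z ∧ t = w) := by
    intro g s t hgs hgt hs ht
    constructor
    · rintro ⟨h1, h2⟩
      have := hX g s t hgs hgt hs ht h1 h2
      subst this
      have hj : Joins inc g u v := ⟨fun h => hvX (h ▸ huX), heu, hev⟩
      refine ⟨rfl, ?_, ?_⟩
      · rcases hc.eq_or_eq hj hgs with h | h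
        · exact h
        · exact absurd (h ▸ h1) hvX
      · rcases hc.eq_or_eq hj hgt with h | h
        · exact absurd (h ▸ huX) h2
        · exact h
    · rintro ⟨h1, h2⟩
      have := hY g s t hgs hgt hs ht h1 h2
      subst this
      have hj : Joins inc g z w := ⟨fun h => hwY (h ▸ hzY), hfz, hfw⟩
      refine ⟨rfl, ?_, ?_⟩
      · rcases hc.eq_or_eq hj hgs with h | h
        · exact h
        · exact absurd (h ▸ h1) hwY
      · rcases hc.eq_or_eq hj hgt with h | h
        · exact absurd (h ▸ hzY) h2
        · exact h
  -- A part of the outside reached from the square by a single leg must be left by another edge,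
  -- which stays outside the square; otherwise the leg would be a bridge.
  have hcorner : ∀ (C : Set V) (l : E) (q q' : V), q ∈ Q → Joins inc l q q' → q' ∉ Q → q' ∈ C →
      (∀ v ∈ Q, v ∉ C) → (∀ g s t, inc g s → inc g t → s ∈ Q → t ∈ C → g = l) →
      ∃ g s t, inc g s ∧ inc g t ∧ s ∉ Q ∧ t ∉ Q ∧ s ∈ C ∧ t ∉ C := by
    intro C l q q' hq hl hq' hqC hQC hall
    obtain ⟨g, hgl, s, hs, t, ht, hgs, hgt⟩ := hb C l ⟨q', hqC, q, hQC q hq, hl.2.2, hl.2.1⟩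
    refine ⟨g, s, t, hgs, hgt, fun h => hQC s h hs, fun h => hgl ?_, hs, ht⟩
    exact hall g t s hgt hgs h hs
  have hleg : ∀ g s t, inc g s → inc g t → s ∈ Q → t ∉ Q →
      (g = la ∧ t = a') ∨ (g = lb ∧ t = b') ∨ (g = lc ∧ t = c') ∨ (g = ld ∧ t = d') := by
    intro g s t hgs hgt hs ht
    obtain ⟨i, rfl | rfl⟩ := T.cross g s t hgs hgt hs ht
    · have := T.eq_x hc ht hgt
      subst this
      revert i
      rw [Fin.forall_fin_two]
      exact ⟨fun _ _ _ => by simp, fun _ _ _ => by simp⟩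
    · have := T.eq_y hc ht hgt
      subst this
      revert i
      rw [Fin.forall_fin_two]
      exact ⟨fun _ _ _ => by simp, fun _ _ _ => by simp⟩
  have ma := S.a_mem
  have mb := S.rotate.a_mem
  have mc := S.rotate.rotate.a_mem
  have md := S.rotate.rotate.rotate.a_mem
  -- The two cuts divide the outside into four quarters, each containing exactly one of `a'`, `b'`,
  -- `c'`, `d'`.
  obtain ⟨g₁, s₁, t₁, hA⟩ := hcorner {v | v ∉ Q ∧ v ∈ X ∧ v ∉ Y} la a a' ma S.ja S.na
    ⟨S.na, xa, ya⟩ (fun v hv h => h.1 hv) (fun g s t hgs hgt hs ht => by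
      obtain ⟨ht1, ht2, ht3⟩ := ht
      have := hleg g s t hgs hgt hs ht1
      grind)
  obtain ⟨g₂, s₂, t₂, hB⟩ := hcorner {v | v ∉ Q ∧ v ∈ X ∧ v ∈ Y} lb b b' mb S.jb S.nb
    ⟨S.nb, xb, yb⟩ (fun v hv h => h.1 hv) (fun g s t hgs hgt hs ht => by
      obtain ⟨ht1, ht2, ht3⟩ := ht
      have := hleg g s t hgs hgt hs ht1
      grind)
  obtain ⟨g₃, s₃, t₃, hC⟩ := hcorner {v | v ∉ Q ∧ v ∉ X ∧ v ∈ Y} lc c c' mc S.jc S.nc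
    ⟨S.nc, xc, yc⟩ (fun v hv h => h.1 hv) (fun g s t hgs hgt hs ht => by
      obtain ⟨ht1, ht2, ht3⟩ := ht
      have := hleg g s t hgs hgt hs ht1
      grind)
  obtain ⟨g₄, s₄, t₄, hD⟩ := hcorner {v | v ∉ Q ∧ v ∉ X ∧ v ∉ Y} ld d d' md S.jd S.nd
    ⟨S.nd, xd, yd⟩ (fun v hv h => h.1 hv) (fun g s t hgs hgt hs ht => by
      obtain ⟨ht1, ht2, ht3⟩ := ht
      have := hleg g s t hgs hgt hs ht1
      grind)
  simp only [Set.mem_ofPred_eq] at hA hB hC hD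
  -- An edge between two quarters crosses one of the cuts, so it is `e` or `f`, and its ends are
  -- among `u`, `v`, `z`, `w`.
  have key : ∀ g s t, inc g s → inc g t → s ∉ Q → t ∉ Q → (s ∈ X ↔ t ∉ X) ∨ (s ∈ Y ↔ t ∉ Y) →
      s = u ∨ s = v ∨ s = z ∨ s = w := by
    intro g s t hgs hgt hs ht h
    have h1 := hcross g s t hgs hgt hs ht
    have h2 := hcross g t s hgt hgs ht hs
    rcases h with h | h
    · by_cases hsX : s ∈ X
      · exact Or.inl (h1.1 ⟨hsX, h.1 hsX⟩).2.1
      · have htX : t ∈ X := not_not.1 fun hn => hsX (h.2 hn)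
        exact Or.inr (Or.inl (h2.1 ⟨htX, hsX⟩).2.2)
    · by_cases hsY : s ∈ Y
      · exact Or.inr (Or.inr (Or.inl (h1.2 ⟨hsY, h.1 hsY⟩).2.1))
      · have htY : t ∈ Y := not_not.1 fun hn => hsY (h.2 hn)
        exact Or.inr (Or.inr (Or.inr (h2.2 ⟨htY, hsY⟩).2.2))
  have kA : s₁ = u ∨ s₁ = w := by
    obtain ⟨h1, h2, h3, h4, ⟨-, h5, h6⟩, h7⟩ := hA
    have := key g₁ s₁ t₁ h1 h2 h3 h4 (by clear * - h4 h5 h6 h7; tauto)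
    rcases this with rfl | rfl | rfl | rfl
    · exact Or.inl rfl
    · exact absurd h5 hvX
    · exact absurd hzY h6
    · exact Or.inr rfl
  have kB : s₂ = u ∨ s₂ = z := by
    obtain ⟨h1, h2, h3, h4, ⟨-, h5, h6⟩, h7⟩ := hB
    have := key g₂ s₂ t₂ h1 h2 h3 h4 (by clear * - h4 h5 h6 h7; tauto)
    rcases this with rfl | rfl | rfl | rfl
    · exact Or.inl rfl
    · exact absurd h5 hvX
    · exact Or.inr rfl
    · exact absurd h6 hwY
  have kC : s₃ = v ∨ s₃ = z := by
    obtain ⟨h1, h2, h3, h4, ⟨-, h5, h6⟩, h7⟩ := hC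
    have := key g₃ s₃ t₃ h1 h2 h3 h4 (by clear * - h4 h5 h6 h7; tauto)
    rcases this with rfl | rfl | rfl | rfl
    · exact absurd huX h5
    · exact Or.inl rfl
    · exact Or.inr rfl
    · exact absurd h6 hwY
  have kD : s₄ = v ∨ s₄ = w := by
    obtain ⟨h1, h2, h3, h4, ⟨-, h5, h6⟩, h7⟩ := hD
    have := key g₄ s₄ t₄ h1 h2 h3 h4 (by clear * - h4 h5 h6 h7; tauto)
    rcases this with rfl | rfl | rfl | rfl
    · exact absurd huX h5
    · exact Or.inl rfl
    · exact absurd hzY h6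
    · exact Or.inr rfl
  obtain ⟨-, -, -, -, ⟨-, a1, a2⟩, -⟩ := hA
  obtain ⟨-, -, -, -, ⟨-, b1, b2⟩, -⟩ := hB
  obtain ⟨-, -, -, -, ⟨-, c1, c2⟩, -⟩ := hC
  obtain ⟨-, -, -, -, ⟨-, d1, d2⟩, -⟩ := hD
  -- The four quarters need all four ends, one each. This makes `e` run between opposite quarters,
  -- so it crosses the second cut as well and equals `f`; then only two quarters are reached.
  have e1 := hcross e u v heu hev hu hv
  have e2 := hcross e v u hev heu hv hu
  grind

end Square

theorem notMem_square {inc : E → V → Prop} (hs : NoDigon inc) (ht : NoTriangle inc)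
    {e₁ e₂ e₄ l : E} {a b c d a' : V} (j₁ : Joins inc e₁ a b) (j₂ : Joins inc e₂ b c)
    (j₄ : Joins inc e₄ d a) (j : Joins inc l a a') (h1 : l ≠ e₁) (h4 : l ≠ e₄) :
    a' ≠ a ∧ a' ≠ b ∧ a' ≠ c ∧ a' ≠ d := by
  refine ⟨j.1.symm, ?_, ?_, ?_⟩
  · rintro rfl
    exact h1 (hs _ _ _ _ j j₁)
  · rintro rfl
    exact ht _ _ _ _ _ _ j₁ j₂ j.symm
  · rintro rfl
    exact h4 (hs _ _ _ _ j j₄.symm)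

theorem exists_square {inc : E → V → Prop} (hc : IsCubic inc) (hs : NoDigon inc)
    (ht : NoTriangle inc) {e₁ e₂ e₃ e₄ : E} {a b c d : V} (j₁ : Joins inc e₁ a b)
    (j₂ : Joins inc e₂ b c) (j₃ : Joins inc e₃ c d) (j₄ : Joins inc e₄ d a) (hac : a ≠ c)
    (hbd : b ≠ d) : ∃ (a' b' c' d' : V) (la lb lc ld : E),
      Square inc {v | v = a ∨ v = b ∨ v = c ∨ v = d} a b c d a' b' c' d' e₁ e₂ e₃ e₄
        la lb lc ld := by
  have n12 : e₁ ≠ e₂ := Square.ne_of_joins hc j₁ j₂ j₁.1 hac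
  have n14 : e₁ ≠ e₄ := Square.ne_of_joins hc j₁.symm j₄ hbd j₁.1.symm
  have n23 : e₂ ≠ e₃ := Square.ne_of_joins hc j₂ j₃ j₂.1 hbd
  have n34 : e₃ ≠ e₄ := Square.ne_of_joins hc j₃ j₄ j₃.1 hac.symm
  obtain ⟨la, a1, a2, ha, alla⟩ := hc.exists_third j₁.2.1 j₄.2.2 n14
  obtain ⟨lb, b1, b2, hb, allb⟩ := hc.exists_third j₂.2.1 j₁.2.2 n12.symm
  obtain ⟨lc, c1, c2, hc', allc⟩ := hc.exists_third j₃.2.1 j₂.2.2 n23.symm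
  obtain ⟨ld, d1, d2, hd, alld⟩ := hc.exists_third j₄.2.1 j₃.2.2 n34.symm
  obtain ⟨a', ja⟩ := hc.exists_joins ha
  obtain ⟨b', jb⟩ := hc.exists_joins hb
  obtain ⟨c', jc⟩ := hc.exists_joins hc'
  obtain ⟨d', jd⟩ := hc.exists_joins hd
  have na := notMem_square hs ht j₁ j₂ j₄ ja a1 a2
  have nb := notMem_square hs ht j₂ j₃ j₁ jb b1 b2
  have nc := notMem_square hs ht j₃ j₄ j₂ jc c1 c2
  have nd := notMem_square hs ht j₄ j₁ j₃ jd d1 d2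
  refine ⟨a', b', c', d', la, lb, lc, ld, fun v => Iff.rfl, j₁, j₂, j₃, j₄, ja, jb, jc, jd, alla,
    allb, allc, alld, ?_, ?_, ?_, ?_, ?_, ?_, ?_, ?_, hac, hbd⟩
  · rintro (h | h | h | h) <;> simp [h] at na
  · rintro (h | h | h | h) <;> simp [h] at nb
  · rintro (h | h | h | h) <;> simp [h] at nc
  · rintro (h | h | h | h) <;> simp [h] at nd
  · rintro rfl
    exact ht _ _ _ _ _ _ ja.symm j₁ jb
  · rintro rfl
    exact ht _ _ _ _ _ _ jb.symm j₂ jc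
  · rintro rfl
    exact ht _ _ _ _ _ _ jc.symm j₃ jd
  · rintro rfl
    exact ht _ _ _ _ _ _ jd.symm j₄ ja

/-! ### Induction on the number of vertices -/

/-- Every bridgeless cubic multigraph has an edge colouring with eleven colours in which adjacent
edges have colours at circular distance at least three. -/
theorem colorable_of_noBridge [Finite V] [Finite E] {inc : E → V → Prop} (hc : IsCubic inc)
    (hb : NoBridge inc) : Colorable inc := by
  obtain ⟨n, hn⟩ : ∃ n, Nat.card V = n := ⟨_, rfl⟩
  induction n using Nat.strong_induction_on generalizing V E with
  | _ n ih =>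
    have hr : SplicesColorable inc := by
      intro Q m p q x y hQ S hb'
      refine ih (Nat.card {v // v ∉ Q}) ?_ (S.isCubic hc) hb' rfl
      rw [← hn]
      obtain ⟨v, hv⟩ := hQ
      exact Finite.card_subtype_lt (x := v) (not_not.2 hv)
    by_cases hs : NoDigon inc
    · by_cases ht : NoTriangle inc
      · by_cases hq : NoSquare inc
        · exact colorable_of_no_short_cycle hc hs ht hq
        · simp only [NoSquare] at hq
          push Not at hq
          obtain ⟨e₁, e₂, e₃, e₄, a, b, c, d, j₁, j₂, j₃, hac, hbd, j₄⟩ := hq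
          obtain ⟨a', b', c', d', la, lb, lc, ld, S⟩ := exists_square hc hs ht j₁ j₂ j₃ j₄ hac hbd
          rcases S.noBridge_or hc hb with h | h
          · exact S.colorable hc (hr _ _ _ _ _ _ ⟨a, S.a_mem⟩ (S.splice hc) h)
          · exact S.rotate.colorable hc (hr _ _ _ _ _ _ ⟨a, S.a_mem⟩ (S.rotate.splice hc) h)
      · simp only [NoTriangle] at ht
        push Not at ht
        obtain ⟨e, f, g, x, y, z, h1, h2, h3⟩ := ht
        exact colorable_of_triangle hc hb hs hr h1 h2 h3
    · simp only [NoDigon] at hs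
      push Not at hs
      obtain ⟨e, f, x, y, h1, h2, h3⟩ := hs
      exact colorable_of_digon hc hb hr h3 h1 h2

/-! ### Translation to multigraphs -/

variable {α β : Type*}

/-- The incidence relation between the edges and the vertices of a graph. -/
def incOf (G : Graph α β) (e : G.edgeSet) (x : G.vertexSet) : Prop := G.Inc e.1 x.1

theorem isCubic_incOf (G : Graph α β) [G.Loopless] (hG : G.IsCubic) : IsCubic (incOf G) := by
  constructor
  · rintro ⟨e, he⟩
    obtain ⟨x, y, hxy⟩ := G.exists_isLink_of_mem_edgeSet he
    refine ⟨⟨x, hxy.left_mem⟩, ⟨y, hxy.right_mem⟩, fun h => ?_, ?_⟩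
    · cases h
      exact G.not_isLoopAt e x hxy
    · rintro ⟨w, hw⟩
      constructor
      · intro h
        rcases Graph.Inc.eq_or_eq_of_isLink h hxy with rfl | rfl
        · exact Or.inl rfl
        · exact Or.inr rfl
      · rintro (h | h) <;> cases h
        · exact hxy.inc_left
        · exact hxy.inc_right
  · rintro ⟨x, hx⟩
    have h := hG x hx
    have hl : G.loopSet x = ∅ := by
      ext e
      simp
    rw [Graph.vertexDegree, hl, Set.encard_empty, add_zero, Set.encard_eq_three] at h
    obtain ⟨e, f, g, hef, heg, hfg, hall⟩ := h
    have hinc : ∀ h, G.Inc h x ↔ h = e ∨ h = f ∨ h = g := fun h => by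
      rw [← Graph.mem_incidenceSet, hall]
      simp
    refine ⟨⟨e, ((hinc e).2 (by simp)).edge_mem⟩, ⟨f, ((hinc f).2 (by simp)).edge_mem⟩,
      ⟨g, ((hinc g).2 (by simp)).edge_mem⟩, ?_, ?_, ?_, ?_⟩
    · simpa using hef
    · simpa using heg
    · simpa using hfg
    · rintro ⟨h, hh⟩
      simpa [incOf] using hinc h

/-- A walk joining the two sides after deletion of `e` has to cross the cut along another edge. -/
theorem noBridge_incOf (G : Graph α β) (hG : G.IsTwoEdgeConnected) : NoBridge (incOf G) := by
  rintro X ⟨e, he⟩ ⟨⟨u, hu⟩, huX, ⟨v, hv⟩, hvX, heu, hev⟩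
  by_contra hcon
  push Not at hcon
  have hpath := (hG.2 e he).2 u hu v hv
  have hmem : ∀ w, Relation.ReflTransGen (G.deleteEdges {e}).Adj u w →
      ∃ h : w ∈ G.vertexSet, (⟨w, h⟩ : G.vertexSet) ∈ X := by
    intro w hw
    induction hw with
    | refl => exact ⟨hu, huX⟩
    | @tail y z _ hyz ih =>
      obtain ⟨hy, hyX⟩ := ih
      obtain ⟨f, hf⟩ := hyz
      rw [Graph.deleteEdges_isLink] at hf
      obtain ⟨hf, hfe⟩ := hf
      refine ⟨hf.right_mem, ?_⟩
      by_contra hzX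
      exact hcon ⟨f, hf.edge_mem⟩ (fun h => hfe (congrArg Subtype.val h))
        ⟨⟨y, hy⟩, hyX, ⟨z, hf.right_mem⟩, hzX, hf.inc_left, hf.inc_right⟩
  exact hvX (hmem v hpath).2

theorem finite_edgeSet (G : Graph α β) (hfin : G.vertexSet.Finite) (hG : G.IsCubic) :
    G.edgeSet.Finite := by
  refine (hfin.biUnion (t := G.incidenceSet) fun x hx => ?_).subset fun e he => ?_
  · have h := hG x hx
    rw [Graph.vertexDegree] at h
    refine Set.finite_of_encard_le_coe (k := 3) ?_
    exact le_self_add.trans h.le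
  · obtain ⟨x, y, hxy⟩ := G.exists_isLink_of_mem_edgeSet he
    exact Set.mem_biUnion hxy.left_mem hxy.inc_left

end CubicEdgeColoring

theorem corollary1p8 {α β : Type*} (G : Graph α β) [G.Loopless]
    (hfin : G.vertexSet.Finite) (hcubic : G.IsCubic) (hconn : G.IsTwoEdgeConnected) :
    G.circularChromaticIndex ≤ (11 : ℝ≥0∞) / 3 := by
  have : Finite G.vertexSet := hfin
  have : Finite G.edgeSet := CubicEdgeColoring.finite_edgeSet G hfin hcubic
  obtain ⟨φ, hφ⟩ := CubicEdgeColoring.colorable_of_noBridge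
    (CubicEdgeColoring.isCubic_incOf G hcubic) (CubicEdgeColoring.noBridge_incOf G hconn)
  -- For `p = 11` and `q = 3` the colouring condition is `3 ≤ |a - b| ≤ 8`, which is `Far`.
  refine sInf_le ⟨11, 3, by norm_num, by norm_num, ⟨φ, ?_⟩, by norm_num⟩
  rintro e f ⟨hef, x, hex, hfx⟩
  have := hφ ⟨x, hex.vertex_mem⟩ e f hex hfx hef
  unfold CubicEdgeColoring.Far at this
  constructor
  · rw [le_abs]
    omega
  · rw [abs_le]
    omega
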